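/- Let $p$ be a prime, let $K$ be a finite extension of $\mathbb{Q}_p$ with the absolute value $|\cdot|$ extending the $p$-adic one ($|p| = p^{-1}$), and let $R=\{x\in K: |x|\le 1\}$ be its valuation ring. Let $G=(G^{(1)},\dots,G^{(m)})$ be an $m$-dimensional formal group law over $R$, that is, an $m$-tuple of power series $G^{(j)}(X,Y)\in R[[X_1,\dots,X_m,Y_1,\dots,Y_m]]$ with $$G^{(j)}(X,Y)=X_j+Y_j+\sum_{l,k=1}^m\gamma_{lk}^jX_lY_k+O(d\ge 3),\qquad G(G(X,Y),Z)=G(X,G(Y,Z)).$$ Let $\mathfrak g$ be its Lie algebra: the free $R$-module on $e_1,\dots,e_m$ with $[e_l,e_k]=\sum_j(\gamma_{lk}^j-\gamma_{kl}^j)e_j$. For $h\in\mathbb{R}$ let $\mathcal G(h)=\{z\in R^m : |z|<p^{-h}\}$ (maximum norm) with multiplication $z_1\cdot z_2=G(z_1,z_2)$ be the $m$-standard group of level $h$. Let $H^n_{la}(\mathcal G(h),K)$ be the $n$-th cohomology of the complex whose $n$-cochains are the locally analytic functions $\mathcal G(h)^n\to K$, with differential $$(\partial f)(x_1,\dots,x_{n+1})=f(x_2,\dots,x_{n+1})+\sum_{i=1}^n(-1)^if(x_1,\dots,x_ix_{i+1},\dots,x_{n+1})+(-1)^{n+1}f(x_1,\dots,x_n),$$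 and let $H^n(\mathfrak g,K)$ be the $n$-th cohomology of the complex of alternating $n$-forms on $\mathfrak g\otimes_RK$ with values in $K$, with differential $$(\partial\omega)(v_1,\dots,v_{n+1})=\sum_{r<s}(-1)^{r+s}\omega([v_r,v_s],v_1,\dots,\widehat{v_r},\dots,\widehat{v_s},\dots,v_{n+1}).$$ Let $\Phi_s$ be the map that differentiates cochains at the identity: for $n\ge1$, $\Phi_s$ is the continuous extension of $f_1\otimes\cdots\otimes f_n\mapsto df_1\wedge\cdots\wedge df_n$, i.e. if $f$ has the power series $\sum_J b_J t^J$ at the identity in the coordinates $t_a^{(j)}$ ($1\le a\le n$, $1\le j\le m$), then $\Phi_s(f)=\sum_{j_1,\dots,j_n}b_{j_1\dots j_n}\,dt^{(j_1)}\wedge\cdots\wedge dt^{(j_n)}$, where $b_{j_1\dots j_n}$ is the coefficient of $t_1^{(j_1)}\cdots t_n^{(j_n)}$; for $n=0$ it is the identity of $K$. Then for every real $h>\frac1{p-1}$ and every $n\ge0$, $\Phi_s$ sends locally analytic cocycles to Lie algebra cocycles and induces an isomorphism of $K$-vector spaces $$\Phi_s:H^n_{la}(\mathcal G(h),K)\xrightarrow{\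 \sim\ }H^n(\mathfrak g,K).$$ -/

import Mathlib

open scoped NNReal

noncomputable section

/-! ### Formal group laws -/

/-- An `m`-dimensional formal group law over `R`: an `m`-tuple of power series `G⁽ʲ⁾(X, Y)`, where the
variables `X` are indexed by `Sum.inl` and the variables `Y` by `Sum.inr`, such that
`G⁽ʲ⁾(X, Y) = X_j + Y_j + ∑ γ_{lk}^j X_l Y_k + O(d ≥ 3)` and `G(G(X, Y), Z) = G(X, G(Y, Z))`. -/
structure FormalGroupLaw (R : Type*) [CommRing R] (m : ℕ) where
  /-- the power series `G⁽ʲ⁾(X, Y)` -/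
  series : Fin m → MvPowerSeries (Fin m ⊕ Fin m) R
  constantCoeff_series : ∀ j, MvPowerSeries.constantCoeff (series j) = 0
  coeff_X : ∀ j i, MvPowerSeries.coeff (Finsupp.single (Sum.inl i) 1) (series j) =
    if i = j then 1 else 0
  coeff_Y : ∀ j i, MvPowerSeries.coeff (Finsupp.single (Sum.inr i) 1) (series j) =
    if i = j then 1 else 0
  coeff_XX : ∀ j i k, MvPowerSeries.coeff
    (Finsupp.single (Sum.inl i) 1 + Finsupp.single (Sum.inl k) 1) (series j) = 0
  coeff_YY : ∀ j i k, MvPowerSeries.coeff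
    (Finsupp.single (Sum.inr i) 1 + Finsupp.single (Sum.inr k) 1) (series j) = 0
  /-- associativity; the three sets of variables are `inl i`, `inr (inl i)`, `inr (inr i)` -/
  assoc : ∀ j,
    MvPowerSeries.subst (S := R) (τ := Fin m ⊕ Fin m ⊕ Fin m)
      (Sum.elim
        (fun i => MvPowerSeries.subst
          (Sum.elim (fun a => MvPowerSeries.X (Sum.inl a))
            (fun a => MvPowerSeries.X (Sum.inr (Sum.inl a)))) (series i))
        (fun i => MvPowerSeries.X (Sum.inr (Sum.inr i)))) (series j) =
    MvPowerSeries.subst (S := R) (τ := Fin m ⊕ Fin m ⊕ Fin m)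
      (Sum.elim
        (fun i => MvPowerSeries.X (Sum.inl i))
        (fun i => MvPowerSeries.subst
          (Sum.elim (fun a => MvPowerSeries.X (Sum.inr (Sum.inl a)))
            (fun a => MvPowerSeries.X (Sum.inr (Sum.inr a)))) (series i))) (series j)

namespace FormalGroupLaw

/-- The coefficient `γ_{lk}^j` of `X_l Y_k` in `G⁽ʲ⁾`. -/
def structureConst {R : Type*} [CommRing R] {m : ℕ} (G : FormalGroupLaw R m)
    (l k j : Fin m) : R :=
  MvPowerSeries.coeff (Finsupp.single (Sum.inl l) 1 + Finsupp.single (Sum.inr k) 1) (G.series j)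

/-- The Lie bracket of `𝔤 ⊗_R A`, where `𝔤` is the Lie algebra of `G`: the free module on
`e_1, …, e_m` with `[e_l, e_k] = ∑_j (γ_{lk}^j - γ_{kl}^j) e_j`, extended bilinearly. -/
def bracket {R : Type*} [CommRing R] {m : ℕ} (G : FormalGroupLaw R m)
    {A : Type*} [CommRing A] [Algebra R A] (x y : Fin m → A) : Fin m → A :=
  fun j => ∑ l, ∑ k, x l * y k *
    algebraMap R A (G.structureConst l k j - G.structureConst k l j)

end FormalGroupLaw

/-- The quotient `Z / (B ∩ Z)` of a module of cocycles `Z` by a module of coboundaries `B`. -/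
abbrev CocyclesModCoboundaries {A : Type*} [Ring A] {M : Type*} [AddCommGroup M] [Module A M]
    (Z B : Submodule A M) : Type _ :=
  Z ⧸ B.submoduleOf Z

/-! ### Lie algebra cohomology with trivial coefficients -/

/-- The Chevalley–Eilenberg differential of an alternating `n`-form `ω` on `𝔤 ⊗_R A` (coordinates
`Fin m → A`), with trivial coefficients, as a function of `n + 1` vectors:
`(∂ω)(v_0, …, v_n) = ∑_{r < s} (-1)^{r+s} ω([v_r, v_s], v_0, …, v̂_r, …, v̂_s, …, v_n)`. -/
def lieDifferential {R : Type*} [CommRing R] {m : ℕ} (G : FormalGroupLaw R m)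
    (A : Type*) [CommRing A] [Algebra R A] :
    (n : ℕ) → ((Fin m → A) [⋀^Fin n]→ₗ[A] A) →ₗ[A] ((Fin (n + 1) → Fin m → A) → A)
  | 0 => 0
  | n + 1 =>
    { toFun := fun ω v => ∑ s : Fin (n + 2), ∑ r : Fin (n + 1),
        if r.castSucc < s then
          (-1) ^ ((r : ℕ) + (s : ℕ)) *
            ω (Fin.cons (G.bracket (v r.castSucc) (v s))
              (fun i => v (s.succAbove (r.succAbove i))))
        else 0
      map_add' := fun ω η => by
        funext v
        simp only [Pi.add_apply, AlternatingMap.add_apply, ← Finset.sum_add_distrib]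
        refine Finset.sum_congr rfl fun s _ => Finset.sum_congr rfl fun r _ => ?_
        split_ifs <;> ring
      map_smul' := fun c ω => by
        funext v
        simp only [Pi.smul_apply, AlternatingMap.smul_apply, smul_eq_mul, Finset.mul_sum,
          RingHom.id_apply]
        refine Finset.sum_congr rfl fun s _ => Finset.sum_congr rfl fun r _ => ?_
        split_ifs <;> ring }

/-- `n`-cocycles of `𝔤 ⊗_R A` with coefficients in `A`. -/
def lieCocycles {R : Type*} [CommRing R] {m : ℕ} (G : FormalGroupLaw R m)
    (A : Type*) [CommRing A] [Algebra R A] (n : ℕ) :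
    Submodule A ((Fin m → A) [⋀^Fin n]→ₗ[A] A) :=
  LinearMap.ker (lieDifferential G A n)

/-- `n`-coboundaries of `𝔤 ⊗_R A` with coefficients in `A`: the forms `∂η`. -/
def lieCoboundaries {R : Type*} [CommRing R] {m : ℕ} (G : FormalGroupLaw R m)
    (A : Type*) [CommRing A] [Algebra R A] :
    (n : ℕ) → Submodule A ((Fin m → A) [⋀^Fin n]→ₗ[A] A)
  | 0 => ⊥
  | n + 1 =>
    { carrier := {ω | ∃ η : (Fin m → A) [⋀^Fin n]→ₗ[A] A, lieDifferential G A n η = ⇑ω}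
      add_mem' := by
        rintro ω ω' ⟨η, hη⟩ ⟨η', hη'⟩
        exact ⟨η + η', by rw [map_add, hη, hη']; rfl⟩
      zero_mem' := ⟨0, by rw [map_zero]; rfl⟩
      smul_mem' := by
        rintro c ω ⟨η, hη⟩
        exact ⟨c • η, by rw [map_smul, hη]; rfl⟩ }

/-- `Hⁿ(𝔤 ⊗_R A, A)`: cocycles modulo coboundaries. -/
abbrev LieCohomology {R : Type*} [CommRing R] {m : ℕ} (G : FormalGroupLaw R m)
    (A : Type*) [CommRing A] [Algebra R A] (n : ℕ) : Type _ :=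
  CocyclesModCoboundaries (lieCocycles G A n) (lieCoboundaries G A n)

/-! ### Standard groups -/

/-- The valuation ring `{x ∈ K : |x| ≤ 1}`. -/
abbrev unitBallRing (K : Type*) [NontriviallyNormedField K] [IsUltrametricDist K] : Subring K :=
  (NormedField.valuation : Valuation K ℝ≥0).integer

/-- The value at `z` of a power series with coefficients in the valuation ring. -/
def evalSeries {K : Type*} [NontriviallyNormedField K] [IsUltrametricDist K] {σ : Type*}
    (F : MvPowerSeries σ (unitBallRing K)) (z : σ → K) : K :=
  ∑' d : σ →₀ ℕ, ((MvPowerSeries.coeff d F : unitBallRing K) : K) * d.prod fun s e => z s ^ e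

/-- The polydisc `{z ∈ R^m : |z| < p^{-h}}`, where `|z|` is the maximum norm. -/
def levelDisc (p : ℕ) (K : Type*) [NontriviallyNormedField K] (m : ℕ) (h : ℝ) :
    Set (Fin m → K) :=
  {z | (∀ j, ‖z j‖ ≤ 1) ∧ ‖z‖ < (p : ℝ) ^ (-h)}

/-- The points of the `m`-standard group `𝒢(h)` of level `h` of the formal group law `G`. -/
@[ext]
structure StandardGroup (p : ℕ) {K : Type*} [NontriviallyNormedField K] [IsUltrametricDist K]
    {m : ℕ} (G : FormalGroupLaw (unitBallRing K) m) (h : ℝ) where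
  /-- the coordinates -/
  val : Fin m → K
  mem : val ∈ levelDisc p K m h

theorem norm_tsum_le_of_ultrametric {K : Type*} [NontriviallyNormedField K] [IsUltrametricDist K]
    {ι : Type*} {f : ι → K} {r : ℝ} (hr : 0 ≤ r) (hf : ∀ i, ‖f i‖ ≤ r) : ‖∑' i, f i‖ ≤ r := by
  by_cases hs : Summable f
  · have hc : IsClosed {x : K | ‖x‖ ≤ r} := isClosed_le continuous_norm continuous_const
    exact hc.mem_of_tendsto hs.hasSum (Filter.Eventually.of_forall fun s =>
      IsUltrametricDist.norm_sum_le_of_forall_le_of_nonneg hr fun i _ => hf i)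
  · rw [tsum_eq_zero_of_not_summable hs, norm_zero]
    exact hr

theorem norm_evalSeries_le {K : Type*} [NontriviallyNormedField K] [IsUltrametricDist K]
    {σ : Type*} (F : MvPowerSeries σ (unitBallRing K)) (hF : MvPowerSeries.constantCoeff F = 0)
    {z : σ → K} {r : ℝ} (hr : 0 ≤ r) (hr1 : r ≤ 1) (hz : ∀ s, ‖z s‖ ≤ r) :
    ‖evalSeries F z‖ ≤ r := by
  refine norm_tsum_le_of_ultrametric hr fun d => ?_
  rw [norm_mul]
  have hc : ‖((MvPowerSeries.coeff d F : unitBallRing K) : K)‖ ≤ 1 := (MvPowerSeries.coeff d F).2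
  rcases eq_or_ne d 0 with rfl | hd
  · have h0 : MvPowerSeries.coeff (0 : σ →₀ ℕ) F = 0 := by
      rw [MvPowerSeries.coeff_zero_eq_constantCoeff_apply, hF]
    simpa [h0] using hr
  · obtain ⟨s, hs⟩ := Finsupp.support_nonempty_iff.mpr hd
    have hp : ‖d.prod fun s e => z s ^ e‖ ≤ r := by
      classical
      rw [Finsupp.prod, norm_prod, ← Finset.mul_prod_erase _ _ hs]
      have h1 : ‖z s ^ d s‖ ≤ r := by
        rw [norm_pow]
        calc ‖z s‖ ^ d s ≤ ‖z s‖ ^ 1 :=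
              pow_le_pow_of_le_one (norm_nonneg _) ((hz s).trans hr1)
                (Nat.one_le_iff_ne_zero.mpr (Finsupp.mem_support_iff.mp hs))
          _ ≤ r := by simpa using hz s
      have h2 : ∏ x ∈ d.support.erase s, ‖z x ^ d x‖ ≤ 1 :=
        Finset.prod_le_one (fun _ _ => norm_nonneg _) fun x _ => by
          rw [norm_pow]
          exact pow_le_one₀ (norm_nonneg _) ((hz x).trans hr1)
      calc _ ≤ r * 1 := mul_le_mul h1 h2 (Finset.prod_nonneg fun _ _ => norm_nonneg _) hr
        _ = r := mul_one r
    calc _ ≤ 1 * r := mul_le_mul hc hp (norm_nonneg _) zero_le_one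
      _ = r := one_mul r

/-- The multiplication `z₁ · z₂ = G(z₁, z₂)` of the standard group. -/
instance StandardGroup.instMul {p : ℕ} {K : Type*} [NontriviallyNormedField K]
    [IsUltrametricDist K] {m : ℕ} {G : FormalGroupLaw (unitBallRing K) m} {h : ℝ} :
    Mul (StandardGroup p G h) where
  mul z₁ z₂ :=
    { val := fun j => evalSeries (G.series j) (Sum.elim z₁.val z₂.val)
      mem := by
        have h0 : 0 ≤ max ‖z₁.val‖ ‖z₂.val‖ := le_max_of_le_left (norm_nonneg _)
        have hb : ∀ j, ‖evalSeries (G.series j) (Sum.elim z₁.val z₂.val)‖ ≤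
            max ‖z₁.val‖ ‖z₂.val‖ := fun j => by
          refine norm_evalSeries_le _ (G.constantCoeff_series j) h0 (max_le ?_ ?_) ?_
          · exact (pi_norm_le_iff_of_nonneg zero_le_one).mpr z₁.mem.1
          · exact (pi_norm_le_iff_of_nonneg zero_le_one).mpr z₂.mem.1
          · rintro (s | s)
            · exact le_max_of_le_left (norm_le_pi_norm _ s)
            · exact le_max_of_le_right (norm_le_pi_norm _ s)
        refine ⟨fun j => (hb j).trans (max_le ?_ ?_), ?_⟩
        · exact (pi_norm_le_iff_of_nonneg zero_le_one).mpr z₁.mem.1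
        · exact (pi_norm_le_iff_of_nonneg zero_le_one).mpr z₂.mem.1
        · exact ((pi_norm_le_iff_of_nonneg h0).mpr hb).trans_lt (max_lt z₁.mem.2 z₂.mem.2) }

/-! ### Locally analytic group cohomology -/

/-- The coboundary of inhomogeneous cochains with trivial coefficients:
`(∂f)(x_1, …, x_{n+1}) = f(x_2, …, x_{n+1}) + ∑_{i=1}^n (-1)^i f(x_1, …, x_i x_{i+1}, …, x_{n+1})
  + (-1)^{n+1} f(x_1, …, x_n)`;
the last summand is the one with `j = n`, in which `Fin.contractNth` drops the last entry. -/
def cochainDifferential (M : Type*) [Mul M] (K : Type*) [CommRing K] (n : ℕ) :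
    ((Fin n → M) → K) →ₗ[K] ((Fin (n + 1) → M) → K) where
  toFun f x := f (fun i => x i.succ) +
    ∑ j : Fin (n + 1), (-1) ^ ((j : ℕ) + 1) * f (Fin.contractNth j (· * ·) x)
  map_add' f g := by
    funext x
    simp only [Pi.add_apply, mul_add, Finset.sum_add_distrib]
    ring
  map_smul' c f := by
    funext x
    simp only [Pi.smul_apply, smul_eq_mul, RingHom.id_apply, mul_add, Finset.mul_sum]
    congr 1
    exact Finset.sum_congr rfl fun j _ => by ring

open Classical in
/-- A function on `𝒢(h)ⁿ`, extended by zero to `(K^m)ⁿ`. -/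
def extendByZero {p : ℕ} {K : Type*} [NontriviallyNormedField K] [IsUltrametricDist K] {m : ℕ}
    {G : FormalGroupLaw (unitBallRing K) m} {h : ℝ} {n : ℕ}
    (f : (Fin n → StandardGroup p G h) → K) : (Fin n → Fin m → K) → K :=
  fun x => if hx : ∀ i, x i ∈ levelDisc p K m h then f (fun i => ⟨x i, hx i⟩) else 0

/-- `𝒪^la(𝒢(h)ⁿ, K)`: the functions on the open subset `𝒢(h)ⁿ` of `(K^m)ⁿ` which near every point
are given by a convergent power series. -/
def laCochains (p : ℕ) {K : Type*} [NontriviallyNormedField K] [IsUltrametricDist K] {m : ℕ}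
    (G : FormalGroupLaw (unitBallRing K) m) (h : ℝ) (n : ℕ) :
    Submodule K ((Fin n → StandardGroup p G h) → K) where
  carrier := {f | AnalyticOnNhd K (extendByZero f) {x | ∀ i, x i ∈ levelDisc p K m h}}
  add_mem' := by
    intro f g hf hg
    have e : extendByZero (f + g) = extendByZero f + extendByZero g := by
      funext x
      by_cases hx : ∀ i, x i ∈ levelDisc p K m h <;> simp [extendByZero, hx]
    simp only [Set.mem_ofPred_eq] at hf hg ⊢
    rw [e]
    exact hf.add hg
  zero_mem' := by
    have e : extendByZero (0 : (Fin n → StandardGroup p G h) → K) = fun _ => 0 := by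
      funext x
      simp [extendByZero]
    simp only [Set.mem_ofPred_eq]
    rw [e]
    exact analyticOnNhd_const
  smul_mem' := by
    intro c f hf
    have e : extendByZero (c • f) = fun x => c * extendByZero f x := by
      funext x
      by_cases hx : ∀ i, x i ∈ levelDisc p K m h <;> simp [extendByZero, hx]
    simp only [Set.mem_ofPred_eq] at hf ⊢
    rw [e]
    exact analyticOnNhd_const.mul hf

/-- Locally analytic `n`-cocycles. -/
def laCocycles (p : ℕ) {K : Type*} [NontriviallyNormedField K] [IsUltrametricDist K] {m : ℕ}
    (G : FormalGroupLaw (unitBallRing K) m) (h : ℝ) (n : ℕ) :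
    Submodule K ((Fin n → StandardGroup p G h) → K) :=
  laCochains p G h n ⊓ LinearMap.ker (cochainDifferential (StandardGroup p G h) K n)

/-- Coboundaries of locally analytic `(n-1)`-cochains. -/
def laCoboundaries (p : ℕ) {K : Type*} [NontriviallyNormedField K] [IsUltrametricDist K] {m : ℕ}
    (G : FormalGroupLaw (unitBallRing K) m) (h : ℝ) :
    (n : ℕ) → Submodule K ((Fin n → StandardGroup p G h) → K)
  | 0 => ⊥
  | n + 1 => (laCochains p G h n).map (cochainDifferential (StandardGroup p G h) K n)

/-- `Hⁿ_la(𝒢(h), K)`: locally analytic cocycles modulo coboundaries. -/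
abbrev LACohomology (p : ℕ) {K : Type*} [NontriviallyNormedField K] [IsUltrametricDist K] {m : ℕ}
    (G : FormalGroupLaw (unitBallRing K) m) (h : ℝ) (n : ℕ) : Type _ :=
  CocyclesModCoboundaries (laCocycles p G h n) (laCoboundaries p G h n)

/-! ### Differentiating cochains -/

/-- Differentiation of cochains at the identity: `f` is sent to the alternating form
`(v_1, …, v_n) ↦ ∑_σ sgn(σ) Dⁿf(0)(ι_1 v_{σ(1)}, …, ι_n v_{σ(n)})`, where `Dⁿf(0)` is the `n`-th
derivative and `ι_a : K^m → (K^m)ⁿ` is the inclusion of the `a`-th factor. Thus the coefficient of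
`t_1^{(j_1)} ⋯ t_n^{(j_n)}` in the power series of `f` at `0` contributes that multiple of
`dt^{(j_1)} ∧ ⋯ ∧ dt^{(j_n)}`, all other coefficients contribute nothing, and
`f_1(x_1) ⋯ f_n(x_n)` is sent to `df_1 ∧ ⋯ ∧ df_n`; for `n = 0` it is the identity of `K`. -/
def differentiateCochain {p : ℕ} {K : Type*} [NontriviallyNormedField K] [IsUltrametricDist K]
    {m : ℕ} {G : FormalGroupLaw (unitBallRing K) m} {h : ℝ} {n : ℕ}
    (f : (Fin n → StandardGroup p G h) → K) : (Fin m → K) [⋀^Fin n]→ₗ[K] K :=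
  MultilinearMap.alternatization
    ((iteratedFDeriv K n (extendByZero f) 0).toMultilinearMap.compLinearMap
      (fun a => LinearMap.single K (fun _ : Fin n => Fin m → K) a))

end

open scoped NNReal ENNReal Topology
open Filter
set_option linter.unusedSectionVars false
universe u


/-! ### Composition of power series over an ultrametric field -/

section UltrametricPowerSeries

variable {𝕜 E F G : Type*} [NontriviallyNormedField 𝕜]
  [NormedAddCommGroup E] [NormedSpace 𝕜 E] [NormedAddCommGroup F] [NormedSpace 𝕜 F]
  [NormedAddCommGroup G] [NormedSpace 𝕜 G]

/-! Call a cochain rigid if one power series represents it on the whole polydisc. The comparison is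
proved for rigid cochains by a double complex and then transferred to locally analytic cochains.

The double complex consists of the alternating `q`-forms on the Lie algebra with values in the rigid
functions of `k` group variables. For `k ≥ 1` it carries `formD`, the Chevalley–Eilenberg
differential for the action on the first variable by (minus) right invariant vector fields; the
other differential, `formDelta`, is the group coboundary without its first summand. Setting the
first variable to `1` contracts `formDelta` (`formEvalOne_formDelta`). In the invariant frame
`formD` is the exterior derivative in the first variable (`formD_pullForm`), so a Poincaré lemma
makes it exact in positive degree (`exists_formD_eq`), and its kernel in degree zero consists of the
functions independent of the first variable (`eq_formTail_of_formD_eq_zero`). The two edges are the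
Lie algebra complex (forms with constant values) and the group complex (functions), and zigzags
identify their cohomologies.

The Poincaré lemma requires dividing the part of degree `j` in the first variable by `j + c`. As
`‖1/n‖ ≤ n` in `K` (`norm_inv_natCast_le_of_padic`), this costs a factor linear in the degree, which
does not change the radius of convergence. Everything else (composition, inversion of the frame)
also keeps the radius, because the ultrametric inequality bounds sums over compositions or subsets
by their largest term.

That the isomorphism is `Φ_s` is seen by following `formEval`, which differentiates the group
variables at the identity one after another. By `formEval_formDelta` and
`formEval_formEvalOne_formDelta` it changes along each step of a zigzag only by a Lie coboundary,
and on functions it is `Φ_s` up to a nonzero scalar (`exists_formEval_eq`).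

For the transfer, `Φ_s` depends only on the germ at the identity, and a locally analytic cochain
becomes rigid on `𝒢(h')` for some `h' ≥ h`. This gives compatibility with cocycles and coboundaries;
surjectivity is immediate, since rigid cochains of level `h` are locally analytic. For injectivity,
a cocycle killed in Lie algebra cohomology is on `𝒢(h')` the coboundary of a rigid cochain.
Extending that cochain by zero and subtracting its coboundary leaves a cocycle vanishing on a
subgroup of finite index. The prism homotopy along a retraction onto the subgroup, averaged over the
cosets, writes such a cocycle as a locally analytic coboundary (`cochainDifferential_averagedPrism`,
`averagedPrism_mem_laCochains`). -/

theorem ContinuousMultilinearMap.norm_sum_le_of_ultrametric [IsUltrametricDist G] {n : ℕ}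
    {ι : Type*} (s : Finset ι) (f : ι → E [×n]→L[𝕜] G) {C : ℝ} (hC : 0 ≤ C)
    (h : ∀ i ∈ s, ‖f i‖ ≤ C) : ‖∑ i ∈ s, f i‖ ≤ C := by
  refine ContinuousMultilinearMap.opNorm_le_bound hC fun v => ?_
  rw [sum_apply]
  refine IsUltrametricDist.norm_sum_le_of_forall_le_of_nonneg (by positivity) fun i hi => ?_
  exact (f i).le_of_opNorm_le (h i hi) v

theorem FormalMultilinearSeries.norm_compAlongComposition_mul_pow_le
    (q : FormalMultilinearSeries 𝕜 F G) (p : FormalMultilinearSeries 𝕜 E F) {r r' : ℝ≥0}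
    (hr : ∀ i, ‖p i‖ * r ^ i ≤ r') {C : ℝ} (hC : ∀ k, ‖q k‖ * r' ^ k ≤ C) {n : ℕ}
    (c : Composition n) : ‖q.compAlongComposition p c‖ * r ^ n ≤ C := by
  have h1 : (r : ℝ) ^ n = ∏ i : Fin c.length, (r : ℝ) ^ c.blocksFun i := by
    rw [Finset.prod_pow_eq_pow_sum, c.sum_blocksFun]
  calc ‖q.compAlongComposition p c‖ * r ^ n
      ≤ (‖q c.length‖ * ∏ i, ‖p (c.blocksFun i)‖) * r ^ n := by
        gcongr
        exact FormalMultilinearSeries.compAlongComposition_norm q p c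
    _ = ‖q c.length‖ * ∏ i, (‖p (c.blocksFun i)‖ * r ^ c.blocksFun i) := by
        rw [h1, mul_assoc, Finset.prod_mul_distrib]
    _ ≤ ‖q c.length‖ * ∏ i : Fin c.length, (r' : ℝ) := by
        gcongr with i
        exact hr _
    _ = ‖q c.length‖ * r' ^ c.length := by simp
    _ ≤ C := hC _

/-- The `n`-th coefficient of the composite is a sum over the compositions of `n`; ultrametrically
it is bounded by its largest term, so counting compositions costs no radius. The hypothesis `H` says
that on each smaller ball the coefficients of `f` are dominated by a radius still inside the domain
of `g`. -/
theorem HasFPowerSeriesOnBall.comp_of_ultrametric [CompleteSpace G] [IsUltrametricDist G]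
    {g : F → G} {f : E → F} {q : FormalMultilinearSeries 𝕜 F G}
    {p : FormalMultilinearSeries 𝕜 E F} {R R' : ℝ≥0∞}
    (hg : HasFPowerSeriesOnBall g q 0 R') (hf : HasFPowerSeriesOnBall f p 0 R) (hf0 : f 0 = 0)
    (hmap : ∀ y ∈ Metric.eball (0 : E) R, f y ∈ Metric.eball (0 : F) R')
    (H : ∀ r : ℝ≥0, (r : ℝ≥0∞) < R → ∃ r' : ℝ≥0, (r' : ℝ≥0∞) < R' ∧ ∀ i, ‖p i‖ * r ^ i ≤ r') :
    HasFPowerSeriesOnBall (g ∘ f) (q.comp p) 0 R := by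
  have key : ∀ r : ℝ≥0, (r : ℝ≥0∞) < R → ∃ C > 0, ∀ n, ∀ c : Composition n,
      ‖q.compAlongComposition p c‖ * r ^ n ≤ C := by
    intro r hr
    obtain ⟨r', hr', hi⟩ := H r hr
    obtain ⟨C, hC0, hC⟩ := q.norm_mul_pow_le_of_lt_radius (hr'.trans_le hg.r_le)
    exact ⟨C, hC0, fun n c => q.norm_compAlongComposition_mul_pow_le p hi hC c⟩
  refine ⟨?_, hf.r_pos, ?_⟩
  · refine ENNReal.le_of_forall_nnreal_lt fun r hr => ?_
    obtain ⟨C, hC0, hC⟩ := key r hr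
    refine FormalMultilinearSeries.le_radius_of_bound _ C fun n => ?_
    rcases eq_or_ne ((r : ℝ) ^ n) 0 with h0 | h0
    · rw [h0, mul_zero]; exact hC0.le
    have hpos : 0 < (r : ℝ) ^ n := lt_of_le_of_ne (by positivity) h0.symm
    rw [← le_div_iff₀ hpos]
    exact ContinuousMultilinearMap.norm_sum_le_of_ultrametric _ _ (by positivity) fun c _ =>
      (le_div_iff₀ hpos).mpr (hC n c)
  · intro y hy
    rw [zero_add]
    have A : Tendsto (fun n ↦ (n, ∑ a ∈ Finset.Ico 1 n, p a fun _ ↦ y))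
        atTop (atTop ×ˢ 𝓝 (f y)) := by
      refine Tendsto.prodMk tendsto_id ?_
      -- The constant term is `f 0 = 0`, so the sums may start at `1`, the range used in
      -- `comp_partialSum`.
      have L : ∀ᶠ n in atTop, (∑ a ∈ Finset.range n, p a fun _b ↦ y)
          = ∑ a ∈ Finset.Ico 1 n, p a fun _b ↦ y := by
        rw [eventually_atTop]
        refine ⟨1, fun n hn => ?_⟩
        rw [Finset.range_eq_Ico, Finset.sum_eq_sum_Ico_succ_bot hn, hf.coeff_zero fun _i => y,
          hf0, zero_add]
      have h1 := (hf.hasSum hy).tendsto_sum_nat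
      rw [zero_add] at h1
      exact Tendsto.congr' L h1
    have B : Tendsto (fun n => q.partialSum n (∑ a ∈ Finset.Ico 1 n, p a fun _b ↦ y)) atTop
        (𝓝 (g (f y))) := by
      have h2 : Tendsto (fun z : ℕ × F => q.partialSum z.1 z.2) (atTop ×ˢ 𝓝 (f y))
          (𝓝 (g (f y))) := by
        simpa only [zero_add] using hg.tendsto_partialSum_prod (hmap y hy)
      simpa only [Function.comp_def] using h2.comp A
    have C : Tendsto (fun n => ∑ i ∈ FormalMultilinearSeries.compPartialSumTarget 0 n n,
        q.compAlongComposition p i.2 fun _j => y) atTop (𝓝 (g (f y))) := by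
      simpa [FormalMultilinearSeries.comp_partialSum] using B
    have D : HasSum (fun i : Σ n, Composition n => q.compAlongComposition p i.2 fun _j => y)
        (g (f y)) := by
      have hs : Summable
          (fun i : Σ n, Composition n => q.compAlongComposition p i.2 fun _j => y) := by
        -- Terms tending to zero suffice: they decay geometrically in `n`, and each `n` has finitely
        -- many compositions.
        refine NonarchimedeanAddGroup.summable_of_tendsto_cofinite_zero ?_
        have hy' : ‖y‖ₑ < R := by simpa using hy
        obtain ⟨r, hyr, hr⟩ := ENNReal.lt_iff_exists_nnreal_btwn.mp hy'
        obtain ⟨C, hC0, hC⟩ := key r hr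
        have hyr' : ‖y‖ < r := by
          rw [← ofReal_norm, ENNReal.ofReal_lt_coe_iff (norm_nonneg _)] at hyr
          exact hyr
        have hr0 : (0 : ℝ) < r := (norm_nonneg y).trans_lt hyr'
        refine squeeze_zero_norm (a := fun i : Σ n, Composition n => C * (‖y‖ / r) ^ i.1) ?_ ?_
        · rintro ⟨n, c⟩
          calc ‖(q.compAlongComposition p c) fun _j : Fin n => y‖
              ≤ ‖q.compAlongComposition p c‖ * ∏ _j : Fin n, ‖y‖ :=
                ContinuousMultilinearMap.le_opNorm _ _
            _ = (‖q.compAlongComposition p c‖ * r ^ n) * (‖y‖ / r) ^ n := by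
                rw [Finset.prod_const, Finset.card_fin, div_pow]
                field_simp
            _ ≤ C * (‖y‖ / r) ^ n := by
                gcongr
                exact hC n c
        · have h3 : Tendsto (fun i : Σ n, Composition n => i.1) cofinite atTop := by
            rw [← Nat.cofinite_eq_atTop]
            refine Filter.Tendsto.cofinite_of_finite_preimage_singleton fun n => ?_
            have : (fun i : Σ n, Composition n => i.1) ⁻¹' {n} = Set.range (Sigma.mk n) := by
              ext ⟨k, c⟩
              constructor
              · intro h
                obtain rfl : k = n := by simpa using h
                exact ⟨c, rfl⟩
              · rintro ⟨d, hd⟩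
                obtain rfl : n = k := congrArg Sigma.fst hd
                rfl
            rw [this]
            exact Set.finite_range _
          have h4 := (tendsto_pow_atTop_nhds_zero_of_lt_one (by positivity)
            ((div_lt_one hr0).mpr hyr')).const_mul C
          rw [mul_zero] at h4
          exact h4.comp h3
      exact tendsto_nhds_unique (hs.hasSum.comp
        FormalMultilinearSeries.compPartialSumTarget_tendsto_atTop) C ▸ hs.hasSum
    have E' : HasSum (fun n => (q.comp p) n fun _j => y) (g (f y)) := by
      refine D.sigma fun n => ?_
      simp only [FormalMultilinearSeries.compAlongComposition_apply, FormalMultilinearSeries.comp,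
        sum_apply]
      exact hasSum_fintype _
    exact E'

end UltrametricPowerSeries


/-! ### Euler operators on power series -/

section WeightedSeries

variable {𝕜 E F : Type*} [NontriviallyNormedField 𝕜]
  [NormedAddCommGroup E] [NormedSpace 𝕜 E] [NormedAddCommGroup F] [NormedSpace 𝕜 F]

/-- Strictly inside the radius the terms decay geometrically, which absorbs a factor linear in the
degree. -/
theorem FormalMultilinearSeries.radius_le_of_norm_le_mul {p q : FormalMultilinearSeries 𝕜 E F}
    {A : ℝ} (h : ∀ k, ‖q k‖ ≤ A * (k + 1) * ‖p k‖) : p.radius ≤ q.radius := by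
  refine ENNReal.le_of_forall_nnreal_lt fun r hr => ?_
  obtain ⟨a, ha, C, hC0, hC⟩ := p.norm_mul_pow_le_mul_pow_of_lt_radius hr
  have hA : ∀ k, ‖q k‖ ≤ |A| * (k + 1) * ‖p k‖ := fun k =>
    (h k).trans (by gcongr; exact le_abs_self A)
  refine FormalMultilinearSeries.le_radius_of_tendsto (l := 0) _ ?_
  refine squeeze_zero (fun n => by positivity)
    (g := fun n : ℕ => |A| * C * ((n : ℝ) * a ^ n + a ^ n)) (fun n => ?_) ?_
  · calc ‖q n‖ * (r : ℝ) ^ n ≤ (|A| * (n + 1) * ‖p n‖) * r ^ n := by gcongr; exact hA n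
      _ = |A| * (n + 1) * (‖p n‖ * r ^ n) := by ring
      _ ≤ |A| * (n + 1) * (C * a ^ n) := mul_le_mul_of_nonneg_left (hC n) (by positivity)
      _ = |A| * C * ((n : ℝ) * a ^ n + a ^ n) := by ring
  · have h1 := tendsto_self_mul_const_pow_of_lt_one ha.1.le ha.2
    have h2 := tendsto_pow_atTop_nhds_zero_of_lt_one ha.1.le ha.2
    simpa using (h1.add h2).const_mul (|A| * C)

/-- The summand of `p` of degree `#S` along the image of the projection `P`. -/
noncomputable def ContinuousMultilinearMap.projPart {k : ℕ} (P : E →L[𝕜] E) (f : E [×k]→L[𝕜] F)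
    (S : Finset (Fin k)) : E [×k]→L[𝕜] F :=
  f.compContinuousLinearMap fun i => if i ∈ S then P else 1 - P

/-- The part of degree `j` along the image of the projection `P` is multiplied by `a j`. -/
noncomputable def FormalMultilinearSeries.weight (P : E →L[𝕜] E) (a : ℕ → 𝕜)
    (p : FormalMultilinearSeries 𝕜 E F) : FormalMultilinearSeries 𝕜 E F :=
  fun k => ∑ S : Finset (Fin k), a S.card • (p k).projPart P S

theorem ContinuousMultilinearMap.projPart_apply {k : ℕ} (P : E →L[𝕜] E) (f : E [×k]→L[𝕜] F)
    (S : Finset (Fin k)) (v : Fin k → E) :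
    f.projPart P S v = f (S.piecewise (fun i => P (v i)) fun i => v i - P (v i)) := by
  rw [projPart, ContinuousMultilinearMap.compContinuousLinearMap_apply]
  congr 1
  funext i
  by_cases hi : i ∈ S <;> simp [hi]

theorem FormalMultilinearSeries.weight_apply (P : E →L[𝕜] E) (a : ℕ → 𝕜)
    (p : FormalMultilinearSeries 𝕜 E F) (k : ℕ) (v : Fin k → E) :
    p.weight P a k v = ∑ S : Finset (Fin k), a S.card • (p k).projPart P S v := by
  simp [weight, sum_apply]

theorem ContinuousMultilinearMap.norm_projPart_le {k : ℕ} {P : E →L[𝕜] E} (hP : ‖P‖ ≤ 1)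
    (hQ : ‖1 - P‖ ≤ 1) (f : E [×k]→L[𝕜] F) (S : Finset (Fin k)) : ‖f.projPart P S‖ ≤ ‖f‖ := by
  refine (f.norm_compContinuousLinearMap_le _).trans ?_
  refine mul_le_of_le_one_right (norm_nonneg _) (Finset.prod_le_one (fun _ _ => norm_nonneg _) ?_)
  intro i _
  by_cases hi : i ∈ S <;> simp [hi, hP, hQ]

/-- The sum over `S` is bounded by its largest term, and `#S ≤ k` makes the weight at most linear in
the degree. -/
theorem FormalMultilinearSeries.radius_le_radius_weight [IsUltrametricDist F] {P : E →L[𝕜] E}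
    (hP : ‖P‖ ≤ 1) (hQ : ‖1 - P‖ ≤ 1) {a : ℕ → 𝕜} {A : ℝ} (ha : ∀ j : ℕ, ‖a j‖ ≤ A * (j + 1))
    (p : FormalMultilinearSeries 𝕜 E F) : p.radius ≤ (p.weight P a).radius := by
  have hA : 0 ≤ A := by simpa using (norm_nonneg _).trans (ha 0)
  refine radius_le_of_norm_le_mul (A := A) fun k => ?_
  refine ContinuousMultilinearMap.norm_sum_le_of_ultrametric _ _ (by positivity) fun S _ => ?_
  rw [norm_smul]
  have h1 : (S.card : ℝ) ≤ k := by
    exact_mod_cast (Finset.card_le_univ S).trans (by simp)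
  calc ‖a S.card‖ * ‖(p k).projPart P S‖ ≤ (A * (S.card + 1)) * ‖p k‖ := by
        gcongr
        · exact ha _
        · exact ContinuousMultilinearMap.norm_projPart_le hP hQ _ _
    _ ≤ A * (k + 1) * ‖p k‖ := by gcongr

theorem ContinuousMultilinearMap.projPart_projPart {k : ℕ} {P : E →L[𝕜] E}
    (hPP : ∀ x, P (P x) = P x) (f : E [×k]→L[𝕜] F) (S T : Finset (Fin k)) :
    (f.projPart P T).projPart P S = if T = S then f.projPart P S else 0 := by
  ext v
  rw [projPart_apply, projPart_apply]
  split_ifs with h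
  · subst h
    rw [projPart_apply]
    congr 1
    funext i
    by_cases hi : i ∈ T <;> simp [hi, hPP]
  · obtain ⟨i, hi⟩ : ∃ i, ¬ (i ∈ T ↔ i ∈ S) := by
      by_contra hc
      push Not at hc
      exact h (Finset.ext hc)
    rw [f.map_coord_zero i, zero_apply]
    by_cases hT : i ∈ T <;> by_cases hS : i ∈ S <;> simp_all

theorem FormalMultilinearSeries.weight_weight {P : E →L[𝕜] E}
    (hPP : ∀ x, P (P x) = P x) (a b : ℕ → 𝕜) (p : FormalMultilinearSeries 𝕜 E F) :
    (p.weight P a).weight P b = p.weight P fun j => b j * a j := by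
  funext k
  ext v
  rw [weight_apply, weight_apply]
  refine Finset.sum_congr rfl fun S _ => ?_
  have : ((p.weight P a) k).projPart P S v = ∑ T : Finset (Fin k),
      a T.card • (((p k).projPart P T).projPart P S) v := by
    rw [ContinuousMultilinearMap.projPart_apply, weight_apply]
    simp_rw [ContinuousMultilinearMap.projPart_apply P _ S]
  rw [this, Finset.sum_eq_single S]
  · rw [ContinuousMultilinearMap.projPart_projPart hPP, if_pos rfl, smul_smul]
  · intro T _ hT
    rw [ContinuousMultilinearMap.projPart_projPart hPP, if_neg hT]
    simp
  · simp

theorem FormalMultilinearSeries.weight_one (P : E →L[𝕜] E) (p : FormalMultilinearSeries 𝕜 E F) :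
    p.weight P (fun _ => 1) = p := by
  funext k
  ext v
  rw [weight_apply]
  simp_rw [one_smul, ContinuousMultilinearMap.projPart_apply]
  have := (p k).toMultilinearMap.map_add_univ (fun i => P (v i)) (fun i => v i - P (v i))
  simp only [ContinuousMultilinearMap.coe_coe] at this
  rw [← this]
  congr 1
  funext i
  simp

/-- Scaling only the `P`-component separates the parts by their power of `t`. -/
theorem ContinuousMultilinearMap.projPart_line {P : E →L[𝕜] E}
    (hPP : ∀ x, P (P x) = P x) {k : ℕ} (f : E [×k]→L[𝕜] F) (w : E) (t : 𝕜) (S : Finset (Fin k)) :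
    f.projPart P S (fun _ => w - P w + t • P w) = t ^ S.card • f.projPart P S (fun _ => w) := by
  rw [projPart_apply, projPart_apply]
  have h1 : P (w - P w + t • P w) = t • P w := by simp [hPP]
  rw [h1]
  have h2 := f.toMultilinearMap.map_piecewise_smul (fun _ => t)
    (S.piecewise (fun _ => P w) fun _ => w - P w) S
  simp only [ContinuousMultilinearMap.coe_coe, Finset.prod_const] at h2
  rw [← h2]
  congr 1
  funext i
  by_cases hi : i ∈ S <;> simp [hi]

/-- The coefficient of degree `k` of the derivative depends only on `p (k + 1)`. Discarding all
other terms leaves a polynomial map whose derivative is known, and both sides are read off from it.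
-/
theorem FormalMultilinearSeries.derivSeries_apply_const
    (p : FormalMultilinearSeries 𝕜 E F) (k : ℕ) (w h : E) :
    p.derivSeries k (fun _ => w) h =
      ∑ i : Fin (k + 1), p (k + 1) (Function.update (fun _ => w) i h) := by
  classical
  let p' : FormalMultilinearSeries 𝕜 E F := fun n => if n = k + 1 then p n else 0
  let f' : E → F := fun x => p (k + 1) fun _ => x
  have hp' : ∀ n, n ≠ k + 1 → p' n = 0 := fun n hn => if_neg hn
  have h1 : p.derivSeries k = p'.derivSeries k := by
    have : p' (1 + k) = p (1 + k) := if_pos (add_comm 1 k)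
    simp only [FormalMultilinearSeries.derivSeries, ContinuousLinearMap.compFormalMultilinearSeries,
      FormalMultilinearSeries.changeOriginSeries, FormalMultilinearSeries.changeOriginSeriesTerm,
      this]
  have hf' : HasFPowerSeriesOnBall f' p' 0 ⊤ := by
    refine ⟨?_, ENNReal.coe_lt_top, fun {y} _ => ?_⟩
    · rw [p'.radius_eq_top_of_forall_image_add_eq_zero (k + 2) fun n => hp' _ (by omega)]
    · rw [zero_add]
      have : p' (k + 1) = p (k + 1) := if_pos rfl
      convert hasSum_single (k + 1) fun n hn => ?_
      · rw [this]
      · rw [hp' n hn]; rfl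
  have h2 : HasSum (fun n => p'.derivSeries n fun _ => w) (p'.derivSeries k fun _ => w) :=
    hasSum_single k fun n hn => by
      rw [p'.derivSeries_eq_zero (hp' (n + 1) (by omega))]; rfl
  have h3 : HasFDerivAt f' (((p (k + 1)).linearDeriv fun _ => w).comp
      (ContinuousLinearMap.pi fun _ => ContinuousLinearMap.id 𝕜 E)) w :=
    ((p (k + 1)).hasFDerivAt fun _ => w).comp w
      (ContinuousLinearMap.pi fun _ : Fin (k + 1) => ContinuousLinearMap.id 𝕜 E).hasFDerivAt
  have hu : insert (0 : E) Set.univ = Set.univ := Set.insert_eq_of_mem (Set.mem_univ _)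
  have h4 : HasSum (fun n => p'.derivSeries n fun _ => w)
      (((p (k + 1)).linearDeriv fun _ => w).comp
        (ContinuousLinearMap.pi fun _ => ContinuousLinearMap.id 𝕜 E)) :=
    ((hasFPowerSeriesWithinOnBall_univ (f := f')).mpr hf').hasSum_derivSeries_of_hasFDerivWithinAt
      (y := w) ENNReal.coe_lt_top (by simp)
      (by rw [hu, zero_add, hasFDerivWithinAt_univ]; exact h3)
      (by rw [hu]; exact uniqueDiffOn_univ)
  rw [h1, h2.unique h4]
  simp [ContinuousMultilinearMap.linearDeriv_apply]

theorem HasFPowerSeriesOnBall.hasSum_fderiv [CompleteSpace F] {f : E → F}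
    {p : FormalMultilinearSeries 𝕜 E F} {R : ℝ≥0∞} (hf : HasFPowerSeriesOnBall f p 0 R) {w : E}
    (hw : w ∈ Metric.eball (0 : E) R) (h : E) :
    HasSum (fun k => ∑ i : Fin (k + 1), p (k + 1) (Function.update (fun _ => w) i h))
      (fderiv 𝕜 f w h) := by
  have h1 := (hf.fderiv.hasSum hw).mapL (ContinuousLinearMap.apply 𝕜 F h)
  simp only [zero_add, ContinuousLinearMap.apply_apply] at h1
  simpa only [FormalMultilinearSeries.derivSeries_apply_const] using h1

/-- Expand every argument as `P + (1 - P)`: the part belonging to `S` occurs once for each `i ∈ S`,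
hence `#S` times. -/
theorem FormalMultilinearSeries.sum_update_eq_weight {P : E →L[𝕜] E}
    (hPP : ∀ x, P (P x) = P x) (p : FormalMultilinearSeries 𝕜 E F) (k : ℕ) (w : E) :
    ∑ i : Fin k, p k (Function.update (fun _ => w) i (P w)) =
      p.weight P (fun j => (j : 𝕜)) k (fun _ => w) := by
  rw [weight_apply]
  have h1 : ∀ i : Fin k, p k (Function.update (fun _ => w) i (P w)) =
      ∑ S : Finset (Fin k), if i ∈ S then (p k).projPart P S (fun _ => w) else 0 := by
    intro i
    conv_lhs => rw [← p.weight_one P]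
    rw [weight_apply]
    refine Finset.sum_congr rfl fun S _ => ?_
    rw [one_smul, ContinuousMultilinearMap.projPart_apply]
    split_ifs with hi
    · rw [ContinuousMultilinearMap.projPart_apply]
      congr 1
      funext j
      by_cases hj : j ∈ S
      · rcases eq_or_ne j i with rfl | hji
        · simp [hj, hPP]
        · simp [hj, hji]
      · have hji : j ≠ i := fun h => hj (h ▸ hi)
        simp [hj, hji]
    · exact (p k).map_coord_zero i (by simp [hi, hPP])
  simp_rw [h1]
  rw [Finset.sum_comm]
  refine Finset.sum_congr rfl fun S _ => ?_
  rw [Finset.sum_ite_mem, Finset.univ_inter, Finset.sum_const, Nat.cast_smul_eq_nsmul]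

/-- Euler's identity for the partial Euler field `w ↦ P w`, with no loss of radius. -/
theorem HasFPowerSeriesOnBall.fderiv_proj [CompleteSpace F] [IsUltrametricDist F] {f : E → F}
    {p : FormalMultilinearSeries 𝕜 E F} {R : ℝ≥0∞} (hf : HasFPowerSeriesOnBall f p 0 R)
    {P : E →L[𝕜] E} (hP : ‖P‖ ≤ 1) (hQ : ‖1 - P‖ ≤ 1) (hPP : ∀ x, P (P x) = P x) :
    HasFPowerSeriesOnBall (fun w => fderiv 𝕜 f w (P w)) (p.weight P fun j => (j : 𝕜)) 0 R := by
  refine ⟨hf.r_le.trans (p.radius_le_radius_weight hP hQ (A := 1) fun j => ?_),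
    hf.r_pos, fun {w} hw => ?_⟩
  · refine (Nat.norm_cast_le j).trans ?_
    rw [norm_one]
    linarith
  · rw [zero_add, ← hasSum_nat_add_iff' 1]
    have h0 : p.weight P (fun j => (j : 𝕜)) 0 (fun _ => w) = 0 := by
      rw [← FormalMultilinearSeries.sum_update_eq_weight hPP]
      simp
    simpa [h0, ← FormalMultilinearSeries.sum_update_eq_weight hPP] using
      hf.hasSum_fderiv hw (P w)

/-- Division of the part of degree `j` along the image of `P` by `j + c`. -/
theorem HasFPowerSeriesOnBall.exists_euler_inverse [CompleteSpace F] [IsUltrametricDist F]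
    (hnat : ∀ n : ℕ, n ≠ 0 → (n : 𝕜) ≠ 0 ∧ ‖(n : 𝕜)⁻¹‖ ≤ n) {f : E → F}
    {p : FormalMultilinearSeries 𝕜 E F} {R : ℝ≥0∞} (hf : HasFPowerSeriesOnBall f p 0 R)
    {P : E →L[𝕜] E} (hP : ‖P‖ ≤ 1) (hQ : ‖1 - P‖ ≤ 1) (hPP : ∀ x, P (P x) = P x)
    {c : ℕ} (hc : c ≠ 0) :
    ∃ (g : E → F) (q : FormalMultilinearSeries 𝕜 E F), HasFPowerSeriesOnBall g q 0 R ∧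
      ∀ w ∈ Metric.eball (0 : E) R, fderiv 𝕜 g w (P w) + (c : 𝕜) • g w = f w := by
  set q := p.weight P fun j => ((j + c : ℕ) : 𝕜)⁻¹ with hq
  have hrad : p.radius ≤ q.radius := by
    -- The bound is `‖(j + c)⁻¹‖ ≤ j + c ≤ (c + 1)(j + 1)`.
    refine p.radius_le_radius_weight hP hQ (A := c + 1) fun j => ?_
    refine (hnat (j + c) (by omega)).2.trans ?_
    push_cast
    nlinarith [(Nat.cast_nonneg j : (0 : ℝ) ≤ j), (Nat.cast_nonneg c : (0 : ℝ) ≤ c)]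
  have hg : HasFPowerSeriesOnBall q.sum q 0 R :=
    (q.hasFPowerSeriesOnBall (hf.r_pos.trans_le (hf.r_le.trans hrad))).mono hf.r_pos
      (hf.r_le.trans hrad)
  refine ⟨q.sum, q, hg, fun w hw => ?_⟩
  have h1 := (hg.fderiv_proj hP hQ hPP).hasSum hw
  have h2 := (hg.hasSum hw).const_smul (c : 𝕜)
  have h3 := h1.add h2
  simp only [zero_add] at h3
  refine (h3.unique ?_)
  have h4 := hf.hasSum hw
  rw [zero_add] at h4
  convert h4 using 2 with k
  rw [hq, FormalMultilinearSeries.weight_weight hPP]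
  conv_rhs => rw [← p.weight_one P]
  simp only [FormalMultilinearSeries.weight_apply]
  rw [Finset.smul_sum, ← Finset.sum_add_distrib]
  refine Finset.sum_congr rfl fun S _ => ?_
  rw [smul_smul, ← add_smul]
  congr 1
  have := (hnat (S.card + c) (by omega)).1
  push_cast at this ⊢
  field_simp

/-- The operator multiplies the part of degree `j` along `P` by `j + c`, which is nonzero for `j >
0`; hence only the part of degree `0` survives. The case `c = 0` describes closed functions, the
case `c > 0` serves for injectivity. -/
theorem HasFPowerSeriesOnBall.eq_of_euler_eq_zero [CharZero 𝕜] [CompleteSpace F]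
    [IsUltrametricDist F] {f : E → F}
    {p : FormalMultilinearSeries 𝕜 E F} {R : ℝ≥0∞} (hf : HasFPowerSeriesOnBall f p 0 R)
    {P : E →L[𝕜] E} (hP : ‖P‖ ≤ 1) (hQ : ‖1 - P‖ ≤ 1) (hPP : ∀ x, P (P x) = P x) (c : ℕ)
    (h : ∀ w ∈ Metric.eball (0 : E) R, fderiv 𝕜 f w (P w) + (c : 𝕜) • f w = 0) {w : E}
    (hw : w ∈ Metric.eball (0 : E) R) : f w = f (w - P w) := by
  have hz : HasFPowerSeriesOnBall (0 : E → F)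
      (p.weight P (fun j => (j : 𝕜)) + (c : 𝕜) • p) 0 R :=
    ((hf.fderiv_proj hP hQ hPP).add (hf.const_smul (c := (c : 𝕜)))).congr fun w hw => by
      simpa using h w hw
  have h0 : ∀ k (y : E), ∑ S : Finset (Fin k),
      ((S.card + c : ℕ) : 𝕜) • (p k).projPart P S (fun _ => y) = 0 := by
    intro k y
    have := hz.hasFPowerSeriesAt.apply_eq_zero k y
    rw [FormalMultilinearSeries.add_apply, FormalMultilinearSeries.smul_apply,
      add_apply, smul_apply] at this
    conv at this => enter [1, 2, 2]; rw [← p.weight_one P]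
    rw [FormalMultilinearSeries.weight_apply, FormalMultilinearSeries.weight_apply,
      Finset.smul_sum, ← Finset.sum_add_distrib] at this
    rw [← this]
    refine Finset.sum_congr rfl fun S _ => ?_
    rw [smul_smul, ← add_smul]
    push_cast
    ring_nf
  have h1 : ∀ k, ∀ j, j ≠ 0 → ∑ S : Finset (Fin k) with S.card = j,
      (p k).projPart P S (fun _ => w) = 0 := by
    intro k j hj
    rw [← Module.forall_dual_apply_eq_zero_iff 𝕜]
    intro φ
    -- Along the line `w - P w + t • P w`, and after applying a functional, `h0` is a polynomial in
    -- `t` vanishing identically; its coefficient at `t ^ j` isolates the parts with `#S = j`.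
    have hpoly : (∑ S : Finset (Fin k), Polynomial.C (((S.card + c : ℕ) : 𝕜) *
        φ ((p k).projPart P S fun _ => w)) * Polynomial.X ^ S.card : Polynomial 𝕜) = 0 := by
      refine Polynomial.funext fun t => ?_
      have h2 := congrArg φ (h0 k (w - P w + t • P w))
      have h3 : ∀ S : Finset (Fin k), (p k).projPart P S (fun _ => w - P w + t • P w) =
          t ^ S.card • (p k).projPart P S (fun _ => w) := fun S => by
        have h4 := ContinuousMultilinearMap.projPart_line hPP (p k) w t S
        exact h4
      simp only [h3, map_sum, map_smul, smul_eq_mul, map_zero] at h2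
      simp only [Polynomial.eval_finsetSum, Polynomial.eval_mul, Polynomial.eval_C,
        Polynomial.eval_pow, Polynomial.eval_X, Polynomial.eval_zero]
      rw [← h2]
      exact Finset.sum_congr rfl fun S _ => by ring
    have hcoef := congrArg (fun q : Polynomial 𝕜 => q.coeff j) hpoly
    simp only [Polynomial.finsetSum_coeff, Polynomial.coeff_C_mul_X_pow,
      Polynomial.coeff_zero] at hcoef
    rw [map_sum, Finset.sum_filter]
    have hne : ((j + c : ℕ) : 𝕜) ≠ 0 := Nat.cast_ne_zero.mpr (by omega)
    refine (mul_eq_zero.mp (?_ : ((j + c : ℕ) : 𝕜) * _ = 0)).resolve_left hne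
    refine Eq.trans ?_ hcoef
    rw [Finset.mul_sum]
    refine Finset.sum_congr rfl fun S _ => ?_
    by_cases hS : S.card = j
    · simp [hS]
    · rw [if_neg hS, if_neg (Ne.symm hS), mul_zero]
  have h2 : ∀ k, p k (fun _ => w) = p k (fun _ => w - P w) := by
    intro k
    conv_lhs => rw [← p.weight_one P]
    rw [FormalMultilinearSeries.weight_apply]
    have : ∑ S : Finset (Fin k), (1 : 𝕜) • (p k).projPart P S (fun _ => w) =
        ∑ j ∈ Finset.range (k + 1), ∑ S : Finset (Fin k) with S.card = j,
          (p k).projPart P S (fun _ => w) := by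
      rw [Finset.sum_fiberwise_of_maps_to]
      · simp
      · intro S _
        rw [Finset.mem_range, Nat.lt_succ_iff]
        exact (Finset.card_le_univ S).trans (by simp)
    rw [this, Finset.sum_eq_single 0 (fun j _ hj => h1 k j hj) (by simp)]
    have h3 : (Finset.univ.filter fun S : Finset (Fin k) => S.card = 0) = {∅} := by
      ext S; simp
    rw [h3, Finset.sum_singleton, ContinuousMultilinearMap.projPart_apply]
    simp
  have hw' : w - P w ∈ Metric.eball (0 : E) R := by
    have h4 : ‖(1 - P) w‖ ≤ ‖w‖ := by
      simpa using ((1 - P).le_opNorm w).trans (mul_le_of_le_one_left (norm_nonneg _) hQ)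
    have h5 : ‖(1 - P) w‖ₑ ≤ ‖w‖ₑ := enorm_le_iff_norm_le.mpr h4
    rw [mem_eball_zero_iff] at hw ⊢
    exact lt_of_le_of_lt (by simpa using h5) hw
  have h5 := hf.hasSum hw
  have h6 := hf.hasSum hw'
  simp only [zero_add, h2] at h5 h6
  exact h5.unique h6

end WeightedSeries


/-! ### Rigid functions and contractive maps -/

section UltrametricInstances

variable {𝕜 E F : Type*} [NontriviallyNormedField 𝕜]
  [NormedAddCommGroup E] [NormedSpace 𝕜 E] [NormedAddCommGroup F] [NormedSpace 𝕜 F]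
  [IsUltrametricDist F]

instance ContinuousMultilinearMap.instIsUltrametricDist {n : ℕ} :
    IsUltrametricDist (E [×n]→L[𝕜] F) :=
  IsUltrametricDist.isUltrametricDist_of_isNonarchimedean_norm fun f g =>
    ContinuousMultilinearMap.opNorm_le_bound (le_max_of_le_left (norm_nonneg _)) fun v => by
      refine (IsUltrametricDist.norm_add_le_max (f v) (g v)).trans (max_le ?_ ?_)
      · exact f.le_of_opNorm_le (le_max_left _ _) v
      · exact g.le_of_opNorm_le (le_max_right _ _) v

instance ContinuousLinearMap.instIsUltrametricDist : IsUltrametricDist (E →L[𝕜] F) :=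
  IsUltrametricDist.isUltrametricDist_of_isNonarchimedean_norm fun f g =>
    ContinuousLinearMap.opNorm_le_bound _ (le_max_of_le_left (norm_nonneg _)) fun v => by
      refine (IsUltrametricDist.norm_add_le_max (f v) (g v)).trans (max_le ?_ ?_)
      · exact f.le_of_opNorm_le (le_max_left _ _) v
      · exact g.le_of_opNorm_le (le_max_right _ _) v

/-- The derivative is a sum over subsets of arguments; the ultrametric inequality removes the usual
factor `k + 1`. -/
theorem FormalMultilinearSeries.norm_derivSeries_le (p : FormalMultilinearSeries 𝕜 E F) (k : ℕ) :
    ‖p.derivSeries k‖ ≤ ‖p (k + 1)‖ := by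
  refine (ContinuousLinearMap.norm_compContinuousMultilinearMap_le _ _).trans ?_
  refine (mul_le_of_le_one_left (norm_nonneg _)
    (ContinuousLinearMap.opNorm_le_bound _ zero_le_one (by simp))).trans ?_
  refine ContinuousMultilinearMap.norm_sum_le_of_ultrametric _ _ (norm_nonneg _) fun s _ => ?_
  rw [norm_changeOriginSeriesTerm, add_comm]

end UltrametricInstances

section Rigid

variable {𝕜 E F G H : Type*} [NontriviallyNormedField 𝕜]
  [NormedAddCommGroup E] [NormedSpace 𝕜 E] [NormedAddCommGroup F] [NormedSpace 𝕜 F]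
  [NormedAddCommGroup G] [NormedSpace 𝕜 G] [NormedAddCommGroup H] [NormedSpace 𝕜 H]
  {R : ℝ≥0∞}

variable (𝕜) in
/-- `f` is given by one convergent power series on the ball of radius `R` around the origin. -/
def IsRigid (R : ℝ≥0∞) (f : E → F) : Prop :=
  ∃ p : FormalMultilinearSeries 𝕜 E F, HasFPowerSeriesOnBall f p 0 R

variable (𝕜) in
/-- `f` is given on the ball of radius `R` by a power series without constant term whose
coefficients have norm at most one. -/
def IsContractive (R : ℝ≥0∞) (f : E → F) : Prop :=
  ∃ p : FormalMultilinearSeries 𝕜 E F, HasFPowerSeriesOnBall f p 0 R ∧ p 0 = 0 ∧ ∀ i, ‖p i‖ ≤ 1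

namespace IsRigid

theorem congr {f g : E → F} (hf : IsRigid 𝕜 R f) (h : Set.EqOn f g (Metric.eball 0 R)) :
    IsRigid 𝕜 R g :=
  let ⟨p, hp⟩ := hf
  ⟨p, hp.congr h⟩

theorem pos {f : E → F} (hf : IsRigid 𝕜 R f) : 0 < R :=
  let ⟨_, hp⟩ := hf
  hp.r_pos

theorem const (hR : 0 < R) (c : F) : IsRigid 𝕜 R fun _ : E => c :=
  ⟨_, (hasFPowerSeriesOnBall_const (c := c) (e := (0 : E))).mono hR le_top⟩

theorem add {f g : E → F} (hf : IsRigid 𝕜 R f) (hg : IsRigid 𝕜 R g) :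
    IsRigid 𝕜 R fun x => f x + g x :=
  let ⟨_, hp⟩ := hf
  let ⟨_, hq⟩ := hg
  ⟨_, hp.add hq⟩

theorem sub {f g : E → F} (hf : IsRigid 𝕜 R f) (hg : IsRigid 𝕜 R g) :
    IsRigid 𝕜 R fun x => f x - g x :=
  let ⟨_, hp⟩ := hf
  let ⟨_, hq⟩ := hg
  ⟨_, hp.sub hq⟩

theorem const_smul {f : E → F} (hf : IsRigid 𝕜 R f) (c : 𝕜) : IsRigid 𝕜 R fun x => c • f x :=
  let ⟨_, hp⟩ := hf
  ⟨_, hp.const_smul (c := c)⟩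

theorem sum {ι : Type*} (s : Finset ι) {f : ι → E → F} (hR : 0 < R)
    (hf : ∀ i ∈ s, IsRigid 𝕜 R (f i)) : IsRigid 𝕜 R fun x => ∑ i ∈ s, f i x := by
  classical
  induction s using Finset.induction_on with
  | empty => simpa using const hR 0
  | insert a s ha ih =>
    simp only [Finset.sum_insert ha]
    exact (hf _ (Finset.mem_insert_self _ _)).add
      (ih fun i hi => hf i (Finset.mem_insert_of_mem hi))

theorem clm (hR : 0 < R) (L : E →L[𝕜] F) : IsRigid 𝕜 R L :=
  ⟨_, (L.hasFPowerSeriesOnBall 0).mono hR le_top⟩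

theorem clm_comp {f : E → F} (hf : IsRigid 𝕜 R f) (L : F →L[𝕜] G) :
    IsRigid 𝕜 R fun x => L (f x) :=
  let ⟨_, hp⟩ := hf
  ⟨_, L.comp_hasFPowerSeriesOnBall hp⟩

theorem fderiv [CompleteSpace F] {f : E → F} (hf : IsRigid 𝕜 R f) : IsRigid 𝕜 R (fderiv 𝕜 f) :=
  let ⟨_, hp⟩ := hf
  ⟨_, hp.fderiv⟩

theorem pi {ι : Type*} [Fintype ι] (hR : 0 < R) {f : ι → E → F}
    (hf : ∀ i, IsRigid 𝕜 R (f i)) : IsRigid 𝕜 R fun x i => f i x := by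
  choose p hp using hf
  exact ⟨_, (hasFPowerSeriesOnBall_pi_iff hR).mpr hp⟩

theorem prodMk {f : E → F} {g : E → G} (hf : IsRigid 𝕜 R f) (hg : IsRigid 𝕜 R g) :
    IsRigid 𝕜 R fun x => (f x, g x) := by
  obtain ⟨_, hp⟩ := hf
  obtain ⟨_, hq⟩ := hg
  have := hp.prod hq
  rw [min_self] at this
  exact ⟨_, this⟩

/-- A linear left inverse of `φ` is continuous, its source being finite-dimensional; so rigidity may
be tested on finitely many coordinates. -/
theorem of_injective [CompleteSpace 𝕜] {ι : Type*} [Fintype ι] {f : E → F} (φ : F →ₗ[𝕜] (ι → 𝕜))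
    (hφ : Function.Injective φ) (hf : IsRigid 𝕜 R fun x => φ (f x)) : IsRigid 𝕜 R f := by
  obtain ⟨ψ, hψ⟩ := φ.exists_leftInverse_of_injective (LinearMap.ker_eq_bot.mpr hφ)
  refine (hf.clm_comp (LinearMap.toContinuousLinearMap ψ)).congr fun x _ => ?_
  exact LinearMap.congr_fun hψ (f x)

theorem analyticOnNhd [CompleteSpace F] {f : E → F} (hf : IsRigid 𝕜 R f) :
    AnalyticOnNhd 𝕜 f (Metric.eball 0 R) :=
  let ⟨_, hp⟩ := hf
  hp.analyticOnNhd

theorem differentiableAt [CompleteSpace F] {f : E → F} (hf : IsRigid 𝕜 R f) {x : E}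
    (hx : x ∈ Metric.eball 0 R) : DifferentiableAt 𝕜 f x :=
  (hf.analyticOnNhd x hx).differentiableAt

theorem comp_entire [CompleteSpace G] [IsUltrametricDist G] {g : F → G} {f : E → F}
    (hg : IsRigid 𝕜 ⊤ g) (hf : IsRigid 𝕜 R f) (hf0 : f 0 = 0) :
    IsRigid 𝕜 R fun x => g (f x) := by
  obtain ⟨q, hq⟩ := hg
  obtain ⟨p, hp⟩ := hf
  refine ⟨_, hq.comp_of_ultrametric hp hf0 (fun _ _ => by simp) fun r hr => ?_⟩
  obtain ⟨C, hC, h⟩ := p.norm_mul_pow_le_of_lt_radius (hr.trans_le hp.r_le)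
  exact ⟨⟨C, hC.le⟩, ENNReal.coe_lt_top, h⟩

/-- A bilinear map is entire, so it can be composed with any rigid pair vanishing at the origin; the
constants `f 0`, `g 0` are split off to reach that case. -/
theorem bilinear [CompleteSpace H] [IsUltrametricDist H] (b : F →L[𝕜] G →L[𝕜] H) {f : E → F}
    {g : E → G} (hf : IsRigid 𝕜 R f) (hg : IsRigid 𝕜 R g) : IsRigid 𝕜 R fun x => b (f x) (g x) := by
  have hR := hf.pos
  have h1 : IsRigid 𝕜 R fun x => (f x - f 0, g x - g 0) :=
    (hf.sub (const hR _)).prodMk (hg.sub (const hR _))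
  have h2 : IsRigid 𝕜 R fun x => b (f x - f 0) (g x - g 0) :=
    comp_entire (g := fun y : F × G => b y.1 y.2) ⟨_, b.hasFPowerSeriesOnBall_bilinear 0⟩ h1
      (by simp)
  have h3 := (hf.clm_comp (b.flip (g 0))).add (hg.clm_comp (b (f 0)))
  refine ((h2.add h3).sub (const hR (b (f 0) (g 0)))).congr fun x _ => ?_
  simp only [map_sub, ContinuousLinearMap.flip_apply, sub_apply]
  abel

end IsRigid

theorem HasSum.norm_le_of_ultrametric [IsUltrametricDist F] {ι : Type*} {f : ι → F} {a : F}
    (hf : HasSum f a) {C : ℝ} (hC : 0 ≤ C) (h : ∀ i, ‖f i‖ ≤ C) : ‖a‖ ≤ C :=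
  (isClosed_le continuous_norm continuous_const).mem_of_tendsto hf
    (Eventually.of_forall fun _ =>
      IsUltrametricDist.norm_sum_le_of_forall_le_of_nonneg hC fun i _ => h i)

theorem norm_lt_one_of_mem_eball (hR : R ≤ 1) {x : E} (hx : x ∈ Metric.eball (0 : E) R) :
    ‖x‖ < 1 := by
  rw [mem_eball_zero_iff] at hx
  have := hx.trans_le hR
  rwa [← ofReal_norm, ENNReal.ofReal_lt_one] at this

theorem mem_eball_of_norm_le {x : E} {y : F} (hx : x ∈ Metric.eball (0 : E) R) (h : ‖y‖ ≤ ‖x‖) :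
    y ∈ Metric.eball (0 : F) R := by
  rw [mem_eball_zero_iff] at hx ⊢
  exact (enorm_le_iff_norm_le.mpr h).trans_lt hx

namespace IsContractive

theorem isRigid {f : E → F} (hf : IsContractive 𝕜 R f) : IsRigid 𝕜 R f :=
  let ⟨p, hp, _⟩ := hf
  ⟨p, hp⟩

theorem apply_zero {f : E → F} (hf : IsContractive 𝕜 R f) : f 0 = 0 := by
  obtain ⟨p, hp, h0, _⟩ := hf
  rw [← hp.coeff_zero fun _ => 0, h0]
  simp

theorem clm (hR : 0 < R) (L : E →L[𝕜] F) (hL : ‖L‖ ≤ 1) : IsContractive 𝕜 R L := by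
  refine ⟨_, (L.hasFPowerSeriesOnBall 0).mono hR le_top, ?_, fun i => ?_⟩
  · ext; simp
  · match i with
    | 0 => simp
    | 1 => simpa using hL
    | n + 2 => simp

theorem congr {f g : E → F} (hf : IsContractive 𝕜 R f) (h : Set.EqOn f g (Metric.eball 0 R)) :
    IsContractive 𝕜 R g :=
  let ⟨p, hp, hp'⟩ := hf
  ⟨p, hp.congr h, hp'⟩

theorem norm_apply_le [IsUltrametricDist F] (hR : R ≤ 1) {f : E → F} (hf : IsContractive 𝕜 R f)
    {x : E} (hx : x ∈ Metric.eball 0 R) : ‖f x‖ ≤ ‖x‖ := by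
  obtain ⟨p, hp, h0, h1⟩ := hf
  have h := hp.hasSum hx
  rw [zero_add] at h
  refine h.norm_le_of_ultrametric (norm_nonneg _) fun i => ?_
  rcases i with _ | i
  · rw [h0]; simp
  · refine ((p (i + 1)).le_of_opNorm_le (h1 _) _).trans ?_
    rw [one_mul, Finset.prod_const, Finset.card_fin, pow_succ]
    exact mul_le_of_le_one_left (norm_nonneg _)
      (pow_le_one₀ (norm_nonneg _) (norm_lt_one_of_mem_eball hR hx).le)

theorem mapsTo [IsUltrametricDist F] (hR : R ≤ 1) {f : E → F} (hf : IsContractive 𝕜 R f)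
    {x : E} (hx : x ∈ Metric.eball 0 R) : f x ∈ Metric.eball 0 R :=
  mem_eball_of_norm_le hx (hf.norm_apply_le hR hx)

theorem norm_mul_pow_le {p : FormalMultilinearSeries 𝕜 E F} (h0 : p 0 = 0) (h1 : ∀ i, ‖p i‖ ≤ 1)
    {r : ℝ≥0} (hr : r ≤ 1) (i : ℕ) : ‖p i‖ * r ^ i ≤ r := by
  rcases i with _ | i
  · rw [h0]; simp
  · calc ‖p (i + 1)‖ * (r : ℝ) ^ (i + 1) ≤ 1 * (r : ℝ) ^ (i + 1) := by gcongr; exact h1 _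
      _ ≤ r := by
        rw [one_mul, pow_succ]
        exact mul_le_of_le_one_left r.2 (pow_le_one₀ r.2 (by exact_mod_cast hr))

end IsContractive

/-- For a contractive `f` and `r ≤ 1` every `‖p i‖ r ^ i` is at most `r`, so the composition theorem
applies with `r' = r`. -/
theorem IsRigid.comp [CompleteSpace G] [IsUltrametricDist F] [IsUltrametricDist G] {g : F → G}
    {f : E → F} (hg : IsRigid 𝕜 R g) (hR : R ≤ 1) (hf : IsContractive 𝕜 R f) :
    IsRigid 𝕜 R fun x => g (f x) := by
  have hf' := hf
  obtain ⟨q, hq⟩ := hg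
  obtain ⟨p, hp, h0, h1⟩ := hf
  exact ⟨_, hq.comp_of_ultrametric hp hf'.apply_zero (fun _ => hf'.mapsTo hR) fun r hr =>
    ⟨r, hr, IsContractive.norm_mul_pow_le h0 h1 (by exact_mod_cast (hr.trans_le hR).le)⟩⟩

theorem IsContractive.comp [CompleteSpace G] [IsUltrametricDist F] [IsUltrametricDist G]
    {g : F → G} {f : E → F} (hg : IsContractive 𝕜 R g) (hR : R ≤ 1) (hf : IsContractive 𝕜 R f) :
    IsContractive 𝕜 R fun x => g (f x) := by
  have hf' := hf
  obtain ⟨q, hq, g0, g1⟩ := hg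
  obtain ⟨p, hp, h0, h1⟩ := hf
  refine ⟨_, hq.comp_of_ultrametric hp hf'.apply_zero (fun _ => hf'.mapsTo hR) fun r hr =>
    ⟨r, hr, IsContractive.norm_mul_pow_le h0 h1 (by exact_mod_cast (hr.trans_le hR).le)⟩, ?_, ?_⟩
  · ext v
    rw [FormalMultilinearSeries.comp_coeff_zero q p v Fin.elim0, g0]
    rfl
  · intro n
    refine ContinuousMultilinearMap.norm_sum_le_of_ultrametric _ _ zero_le_one fun c _ => ?_
    simpa using q.norm_compAlongComposition_mul_pow_le p (r := 1) (r' := 1) (by simpa using h1)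
      (by simpa using g1) c

theorem IsContractive.pi {ι : Type*} [Fintype ι] (hR : 0 < R) {f : ι → E → F}
    (hf : ∀ i, IsContractive 𝕜 R (f i)) : IsContractive 𝕜 R fun x i => f i x := by
  choose p hp h0 h1 using hf
  refine ⟨_, (hasFPowerSeriesOnBall_pi_iff hR).mpr hp, ?_, fun n => ?_⟩
  · ext v i
    simp [FormalMultilinearSeries.pi, h0]
  · refine ContinuousMultilinearMap.opNorm_le_bound zero_le_one fun v => ?_
    refine (pi_norm_le_iff_of_nonneg (by positivity)).mpr fun i => ?_
    exact (p i n).le_of_opNorm_le (h1 i n) v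

theorem IsContractive.fderiv_sub [CompleteSpace F] [IsUltrametricDist F] {f : E → F}
    (hf : IsContractive 𝕜 R f) :
    IsContractive 𝕜 R fun x => fderiv 𝕜 f x - fderiv 𝕜 f 0 := by
  obtain ⟨p, hp, h0, h1⟩ := hf
  have hd := hp.fderiv
  have hc := (hasFPowerSeriesOnBall_const (𝕜 := 𝕜) (c := fderiv 𝕜 f 0) (e := (0 : E))).mono
    hp.r_pos le_top
  refine ⟨_, hd.sub hc, ?_, fun i => ?_⟩
  · ext v w
    have := hd.coeff_zero v
    simp [this]
  · rcases i with _ | i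
    · refine ContinuousMultilinearMap.opNorm_le_bound zero_le_one fun v => ?_
      have := hd.coeff_zero v
      simp [this]
    · have : (p.derivSeries - constFormalMultilinearSeries 𝕜 E (fderiv 𝕜 f 0)) (i + 1) =
          p.derivSeries (i + 1) := by simp
      rw [this]
      exact (p.norm_derivSeries_le _).trans (h1 _)

end Rigid

/-! ### Lipschitz estimate for series without linear term -/

section QuadraticRemainder

variable {𝕜 E F : Type*} [NontriviallyNormedField 𝕜]
  [NormedAddCommGroup E] [NormedSpace 𝕜 E] [NormedAddCommGroup F] [NormedSpace 𝕜 F]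
  [IsUltrametricDist F] {R : ℝ≥0∞}

/-- Replace the arguments `y` by `x` one at a time; the ultrametric inequality keeps only the
largest of the `n + 1` steps. -/
theorem ContinuousMultilinearMap.norm_sub_le_of_ultrametric {n : ℕ} (f : E [×n + 1]→L[𝕜] F)
    (x y : E) : ‖f (fun _ => x) - f (fun _ => y)‖ ≤ ‖f‖ * (max ‖x‖ ‖y‖) ^ n * ‖x - y‖ := by
  let u : ℕ → Fin (n + 1) → E := fun j i => if (i : ℕ) < j then x else y
  have h0 : f (fun _ => x) - f (fun _ => y) =
      ∑ j ∈ Finset.range (n + 1), (f (u (j + 1)) - f (u j)) := by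
    rw [Finset.sum_range_sub (fun j => f (u j))]
    congr 2
    funext i
    simp [u, i.2]
  rw [h0]
  refine IsUltrametricDist.norm_sum_le_of_forall_le_of_nonneg (by positivity) fun j hj => ?_
  have hj' : j < n + 1 := Finset.mem_range.mp hj
  set J : Fin (n + 1) := ⟨j, hj'⟩
  have h1 : u (j + 1) = Function.update (u j) J x := by
    funext i
    rcases eq_or_ne i J with rfl | hi
    · simp [u, J]
    · have : (i : ℕ) ≠ j := fun h => hi (Fin.ext h)
      rw [Function.update_of_ne hi]
      simp only [u]
      congr 1
      simp only [eq_iff_iff]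
      omega
  have h2 : u j = Function.update (u j) J y := by
    conv_lhs => rw [← Function.update_eq_self J (u j)]
    simp [u, J]
  conv_lhs => rw [h1]; enter [1, 2]; rw [h2]
  rw [← f.map_update_sub]
  refine (f.le_opNorm _).trans ?_
  rw [mul_assoc]
  refine mul_le_mul_of_nonneg_left ?_ (norm_nonneg _)
  rw [← Finset.mul_prod_erase _ _ (Finset.mem_univ J), Function.update_self, mul_comm]
  refine mul_le_mul_of_nonneg_right ?_ (norm_nonneg _)
  refine (Finset.prod_le_prod (g := fun _ => max ‖x‖ ‖y‖) (fun _ _ => norm_nonneg _)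
    fun i hi => ?_).trans (by simp)
  rw [Function.update_of_ne (Finset.ne_of_mem_erase hi)]
  simp only [u]
  split_ifs
  · exact le_max_left _ _
  · exact le_max_right _ _

/-- Terms of degree at least two have Lipschitz constant at most `max ‖x‖ ‖y‖ < 1`. Applied to `G(x,
y) - x - y`, this makes translations isometric and yields inverses. -/
theorem HasFPowerSeriesOnBall.norm_sub_le_of_coeff_one_eq_zero (hR : R ≤ 1) {f : E → F}
    {p : FormalMultilinearSeries 𝕜 E F} (hp : HasFPowerSeriesOnBall f p 0 R)
    (h1 : p 1 = 0) (hle : ∀ i, ‖p i‖ ≤ 1) {x y : E}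
    (hx : x ∈ Metric.eball 0 R) (hy : y ∈ Metric.eball 0 R) :
    ‖f x - f y‖ ≤ max ‖x‖ ‖y‖ * ‖x - y‖ := by
  have hs := (hp.hasSum hx).sub (hp.hasSum hy)
  simp only [zero_add] at hs
  have hm : max ‖x‖ ‖y‖ ≤ 1 :=
    max_le (norm_lt_one_of_mem_eball hR hx).le (norm_lt_one_of_mem_eball hR hy).le
  refine hs.norm_le_of_ultrametric (by positivity) fun i => ?_
  match i with
  | 0 =>
    rw [Subsingleton.elim (fun _ : Fin 0 => x) fun _ => y, sub_self, norm_zero]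
    positivity
  | 1 =>
    rw [h1]
    simp only [zero_apply, sub_self, norm_zero]
    positivity
  | n + 2 =>
    refine ((p (n + 2)).norm_sub_le_of_ultrametric x y).trans ?_
    refine mul_le_mul_of_nonneg_right ?_ (norm_nonneg _)
    rw [pow_succ]
    have h2 : ‖p (n + 2)‖ * max ‖x‖ ‖y‖ ^ n ≤ 1 :=
      mul_le_one₀ (hle _) (by positivity) (pow_le_one₀ (by positivity) hm)
    rw [← mul_assoc]
    exact mul_le_of_le_one_left (by positivity) h2

end QuadraticRemainder


/-! ### Evaluation and substitution of formal power series -/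

section Substitution

/-- The discrete topology on the coefficients makes the coefficient map continuous, so `eval₂` is
available; the value is an ordinary sum that does not mention this auxiliary topology. -/
theorem MvPowerSeries.hasSum_eval_of_discrete {σ A T : Type*} [CommRing A] [CommRing T]
    [Algebra A T] [UniformSpace T] [IsUniformAddGroup T] [CompleteSpace T] [T2Space T]
    [IsTopologicalRing T] [IsLinearTopology T T] {b : σ → T} (hb : HasEval b)
    (F : MvPowerSeries σ A) :
    HasSum (fun d : σ →₀ ℕ => algebraMap A T (coeff d F) * d.prod fun s e => b s ^ e)
      (letI : UniformSpace A := ⊥; eval₂ (algebraMap A T) b F) := by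
  let : UniformSpace A := ⊥
  have : DiscreteUniformity A := ⟨rfl⟩
  exact hasSum_eval₂ (φ := algebraMap A T) continuous_of_discreteTopology hb F

theorem MvPowerSeries.tsum_eval_subst {σ τ A T : Type*} [Finite σ] [CommRing A] [CommRing T]
    [Algebra A T] [UniformSpace T] [IsUniformAddGroup T] [CompleteSpace T] [T2Space T]
    [IsTopologicalRing T] [IsLinearTopology T T] {b : τ → T} (hb : HasEval b)
    (F : MvPowerSeries σ A) (a : σ → MvPowerSeries τ A) (ha : ∀ s, constantCoeff (a s) = 0)
    (hab : HasEval fun s => ∑' d : τ →₀ ℕ, algebraMap A T (coeff d (a s)) *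
      d.prod fun s e => b s ^ e) :
    ∑' d : τ →₀ ℕ, algebraMap A T (coeff d (subst a F)) * (d.prod fun s e => b s ^ e) =
      ∑' d : σ →₀ ℕ, algebraMap A T (coeff d F) * d.prod fun s e =>
        (∑' d : τ →₀ ℕ, algebraMap A T (coeff d (a s)) * d.prod fun s e => b s ^ e) ^ e := by
  have ha' : HasSubst a := hasSubst_of_constantCoeff_zero ha
  have h0 : ∀ s, ∑' d : τ →₀ ℕ, algebraMap A T (coeff d (a s)) * (d.prod fun s e => b s ^ e) =
      (letI : UniformSpace A := ⊥; eval₂ (algebraMap A T) b (a s)) := fun s =>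
    (hasSum_eval_of_discrete hb (a s)).tsum_eq
  simp only [h0] at hab ⊢
  rw [(hasSum_eval_of_discrete hb _).tsum_eq, (hasSum_eval_of_discrete hab _).tsum_eq]
  let : UniformSpace A := ⊥
  have : DiscreteUniformity A := ⟨rfl⟩
  exact eval₂_subst ha' hb F

variable {K : Type*} [NontriviallyNormedField K] [IsUltrametricDist K]

theorem mem_unitBallRing_iff {x : K} : x ∈ unitBallRing K ↔ ‖x‖ ≤ 1 := Iff.rfl

/-- The open balls around zero are ideals of the valuation ring. -/
instance : IsLinearTopology (unitBallRing K) (unitBallRing K) := by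
  refine IsLinearTopology.mk_of_hasBasis (unitBallRing K) (ι := {r : ℝ // 0 < r})
    (p := fun _ => True)
    (s := fun r => ({ carrier := {x | ‖(x : K)‖ < r.1}
                      add_mem' := fun {x y} hx hy =>
                        (IsUltrametricDist.norm_add_le_max (x : K) y).trans_lt (max_lt hx hy)
                      zero_mem' := by simpa using r.2
                      smul_mem' := fun c x hx => by
                        have hc : ‖(c : K)‖ ≤ 1 := mem_unitBallRing_iff.mp c.2
                        have hx' : ‖(x : K)‖ < r.1 := hx
                        show ‖((c * x : unitBallRing K) : K)‖ < r.1
                        rw [Subring.coe_mul, norm_mul]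
                        exact (mul_le_of_le_one_left (norm_nonneg _) hc).trans_lt hx'
                      : Submodule (unitBallRing K) (unitBallRing K)})) ?_
  refine (Metric.nhds_basis_ball (x := (0 : unitBallRing K))).to_hasBasis
    (fun r hr => ⟨⟨r, hr⟩, trivial, fun x hx => ?_⟩) fun r _ => ⟨r.1, r.2, fun x hx => ?_⟩
  · rw [mem_ball_zero_iff]
    exact hx
  · rw [mem_ball_zero_iff] at hx
    exact hx

instance [CompleteSpace K] : CompleteSpace (unitBallRing K) :=
  (show IsClosed ((unitBallRing K : Subring K) : Set K) from
    isClosed_le continuous_norm continuous_const).completeSpace_coe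

theorem coe_tsum_unitBallRing {ι : Type*} {f : ι → unitBallRing K} (hf : Summable f) :
    ((∑' i, f i : unitBallRing K) : K) = ∑' i, (f i : K) :=
  (hf.hasSum.map (unitBallRing K).subtype continuous_subtype_val).tsum_eq.symm

theorem hasEval_unitBallRing {σ : Type*} [Finite σ] {b : σ → unitBallRing K}
    (hb : ∀ s, ‖(b s : K)‖ < 1) : MvPowerSeries.HasEval b where
  hpow s := by
    rw [IsTopologicallyNilpotent, tendsto_subtype_rng]
    simpa using tendsto_pow_atTop_nhds_zero_of_norm_lt_one (hb s)
  tendsto_zero := by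
    rw [Filter.cofinite_eq_bot]
    exact tendsto_bot

theorem evalSeries_eq_coe [CompleteSpace K] {σ : Type*} [Finite σ]
    (F : MvPowerSeries σ (unitBallRing K))
    {b : σ → unitBallRing K} (hb : ∀ s, ‖(b s : K)‖ < 1) :
    evalSeries F (fun s => (b s : K)) = ((∑' d : σ →₀ ℕ, algebraMap (unitBallRing K)
      (unitBallRing K) (MvPowerSeries.coeff d F) * d.prod fun s e => b s ^ e :
        unitBallRing K) : K) := by
  rw [coe_tsum_unitBallRing
    (MvPowerSeries.hasSum_eval_of_discrete (hasEval_unitBallRing hb) F).summable]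
  refine tsum_congr fun d => ?_
  rw [Subring.coe_mul, Finsupp.prod, Finsupp.prod, SubmonoidClass.coe_finsetProd]
  rfl

theorem norm_evalSeries_lt_one {σ : Type*} [Finite σ] {F : MvPowerSeries σ (unitBallRing K)}
    (hF : MvPowerSeries.constantCoeff F = 0) {z : σ → K} (hz : ∀ s, ‖z s‖ < 1) :
    ‖evalSeries F z‖ < 1 := by
  have := Fintype.ofFinite σ
  exact (norm_evalSeries_le F hF (norm_nonneg z)
    ((pi_norm_le_iff_of_nonneg zero_le_one).mpr fun s => (hz s).le) (norm_le_pi_norm z)).trans_lt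
    ((pi_norm_lt_iff one_pos).mpr hz)

/-- Arguments of norm less than one are topologically nilpotent in the valuation ring, which is
complete with a linear topology, so `eval₂_subst` applies there. This turns the formal associativity
of `G` into associativity of points. -/
theorem evalSeries_subst [CompleteSpace K] {σ τ : Type*} [Finite σ] [Finite τ]
    (F : MvPowerSeries σ (unitBallRing K)) {a : σ → MvPowerSeries τ (unitBallRing K)}
    (ha : ∀ s, MvPowerSeries.constantCoeff (a s) = 0) {b : τ → K} (hb : ∀ t, ‖b t‖ < 1) :
    evalSeries (MvPowerSeries.subst a F) b = evalSeries F fun s => evalSeries (a s) b := by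
  lift b to τ → unitBallRing K using fun t => (hb t).le
  rw [evalSeries_eq_coe _ hb]
  have h1 : ∀ s, evalSeries (a s) (fun t => (b t : K)) = _ := fun s => evalSeries_eq_coe (a s) hb
  have h2 : ∀ s, ‖((∑' d : τ →₀ ℕ, algebraMap (unitBallRing K) (unitBallRing K)
      (MvPowerSeries.coeff d (a s)) * d.prod fun s e => b s ^ e : unitBallRing K) : K)‖ < 1 :=
    fun s => by
      rw [← h1]
      exact norm_evalSeries_lt_one (ha s) hb
  simp only [h1]
  rw [evalSeries_eq_coe F h2, MvPowerSeries.tsum_eval_subst (hasEval_unitBallRing hb) F a ha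
    (hasEval_unitBallRing h2)]

theorem evalSeries_X {σ : Type*} (s : σ) (z : σ → K) :
    evalSeries (MvPowerSeries.X s : MvPowerSeries σ (unitBallRing K)) z = z s := by
  classical
  rw [evalSeries, tsum_eq_single (Finsupp.single s 1)]
  · simp [MvPowerSeries.coeff_X]
  · intro d hd
    simp [MvPowerSeries.coeff_X, hd]

end Substitution

/-! ### Formal power series as analytic functions -/

section EvalSeries

variable {K : Type*} [NontriviallyNormedField K] [IsUltrametricDist K]

omit [IsUltrametricDist K] in
theorem Finsupp.exists_word {σ : Type*} (d : σ →₀ ℕ) {k : ℕ} (hk : d.degree = k) :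
    ∃ w : Fin k → σ, ∀ z : σ → K, ∏ i, z (w i) = d.prod fun s e => z s ^ e := by
  have h : d.toMultiset.toList.length = k := by
    rw [Multiset.length_toList, Finsupp.card_toMultiset, ← hk]
    rfl
  subst h
  refine ⟨d.toMultiset.toList.get, fun z => ?_⟩
  have h1 : (d.toMultiset.map z).prod = d.prod fun s e => z s ^ e := by
    rw [Finsupp.toMultiset_apply, Finsupp.sum, Finsupp.prod, ← Multiset.coe_mapAddMonoidHom,
      map_sum, Multiset.prod_sum]
    simp [Multiset.map_nsmul, Multiset.prod_nsmul]
  rw [← h1, ← Multiset.prod_toList, ← List.prod_ofFn]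
  conv_rhs => rw [← Multiset.coe_toList d.toMultiset, Multiset.map_coe, Multiset.prod_toList,
    Multiset.prod_coe]
  congr 1
  conv_rhs => rw [← List.ofFn_get d.toMultiset.toList, List.map_ofFn]
  rfl

/-- Group the monomials by degree. A monomial of degree `k` is the diagonal of a `k`-linear map of
norm at most one and the coefficients are integral, so each homogeneous part has norm at most one.
The diagonal values are recorded so that low degrees can be read off. -/
theorem exists_hasFPowerSeriesOnBall_evalSeries [CompleteSpace K] {σ : Type*} [Fintype σ]
    (F : MvPowerSeries σ (unitBallRing K)) :
    ∃ p : FormalMultilinearSeries K (σ → K) K, HasFPowerSeriesOnBall (evalSeries F) p 0 1 ∧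
      (∀ k, ‖p k‖ ≤ 1) ∧ ∀ k z, p k (fun _ => z) =
        ∑ d ∈ (Finsupp.finite_of_degree_eq (σ := σ) k).toFinset,
          ((MvPowerSeries.coeff d F : unitBallRing K) : K) * d.prod fun s e => z s ^ e := by
  classical
  have hex : ∀ (d : σ →₀ ℕ) (k : ℕ), ∃ f : (σ → K) [×k]→L[K] K, ‖f‖ ≤ 1 ∧
      (d.degree = k → ∀ z, f (fun _ => z) = d.prod fun s e => z s ^ e) := by
    intro d k
    by_cases hd : d.degree = k
    · obtain ⟨w, hw⟩ := Finsupp.exists_word (K := K) d hd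
      refine ⟨(ContinuousMultilinearMap.mkPiAlgebra K (Fin k) K).compContinuousLinearMap
        fun i => ContinuousLinearMap.proj (w i), ?_, fun _ z => ?_⟩
      · refine (ContinuousMultilinearMap.norm_compContinuousLinearMap_le _ _).trans ?_
        refine mul_le_one₀ (by simp) (by positivity) (Finset.prod_le_one (by simp) fun i _ => ?_)
        refine ContinuousLinearMap.opNorm_le_bound _ zero_le_one fun z => ?_
        rw [one_mul]
        exact norm_le_pi_norm z _
      · simpa using hw z
    · exact ⟨0, by simp, fun h => absurd h hd⟩
  choose f hf1 hf using hex
  let p : FormalMultilinearSeries K (σ → K) K := fun k =>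
    ∑ d ∈ (Finsupp.finite_of_degree_eq (σ := σ) k).toFinset,
      ((MvPowerSeries.coeff d F : unitBallRing K) : K) • f d k
  have hp1 : ∀ k, ‖p k‖ ≤ 1 := fun k =>
    ContinuousMultilinearMap.norm_sum_le_of_ultrametric _ _ zero_le_one fun d _ => by
      rw [norm_smul]
      exact mul_le_one₀ (mem_unitBallRing_iff.mp (MvPowerSeries.coeff d F).2) (norm_nonneg _) (hf1 d k)
  have hp : ∀ k z, p k (fun _ => z) =
        ∑ d ∈ (Finsupp.finite_of_degree_eq (σ := σ) k).toFinset,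
          ((MvPowerSeries.coeff d F : unitBallRing K) : K) * d.prod fun s e => z s ^ e := by
    intro k z
    simp only [p, sum_apply, smul_apply, smul_eq_mul]
    refine Finset.sum_congr rfl fun d hd => ?_
    rw [hf d k (by simpa using hd)]
  refine ⟨p, ⟨?_, one_pos, fun {z} hz => ?_⟩, hp1, hp⟩
  · refine FormalMultilinearSeries.le_radius_of_bound p (r := 1) 1 fun n => ?_
    simpa using hp1 n
  · have hz' : ∀ s, ‖z s‖ < 1 := fun s =>
      (norm_le_pi_norm z s).trans_lt (norm_lt_one_of_mem_eball le_rfl hz)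
    rw [zero_add]
    have hs : HasSum (fun d : σ →₀ ℕ => ((MvPowerSeries.coeff d F : unitBallRing K) : K) *
        d.prod fun s e => z s ^ e) (evalSeries F z) := by
      refine Summable.hasSum ?_
      lift z to σ → unitBallRing K using fun t => (hz' t).le
      convert ((MvPowerSeries.hasSum_eval_of_discrete (hasEval_unitBallRing hz') F).map
        (unitBallRing K).subtype continuous_subtype_val).summable using 2 with d
      rw [Function.comp_apply, map_mul, Finsupp.prod, Finsupp.prod, map_prod]
      rfl
    have h1 := (Equiv.sigmaFiberEquiv (Finsupp.degree : (σ →₀ ℕ) → ℕ)).hasSum_iff.mpr hs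
    refine h1.sigma fun k => ?_
    rw [hp]
    let : Fintype {d : σ →₀ ℕ // d.degree = k} := (Finsupp.finite_of_degree_eq k).fintype
    rw [Finset.sum_subtype (p := fun d : σ →₀ ℕ => d.degree = k) _ (by simp)]
    exact hasSum_fintype _

end EvalSeries


/-! ### The formal group law as an analytic map, and its terms of low degree -/

section MulMap

variable {K : Type*} [NontriviallyNormedField K] [IsUltrametricDist K] {m : ℕ}

/-- Multiplication of points by the formal group law. -/
noncomputable def FormalGroupLaw.mulMap (G : FormalGroupLaw (unitBallRing K) m)
    (z : (Fin m → K) × (Fin m → K)) : Fin m → K :=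
  fun j => evalSeries (G.series j) (Sum.elim z.1 z.2)

/-- The bilinear part of the formal group law. -/
noncomputable def FormalGroupLaw.bilin (G : FormalGroupLaw (unitBallRing K) m) :
    (Fin m → K) →ₗ[K] (Fin m → K) →ₗ[K] (Fin m → K) :=
  LinearMap.mk₂ K (fun x y j => ∑ l, ∑ k, x l * y k * (G.structureConst l k j : K))
    (fun x x' y => by ext j; simp [add_mul, Finset.sum_add_distrib])
    (fun c x y => by ext j; simp [Finset.mul_sum, mul_assoc])
    (fun x y y' => by ext j; simp [mul_add, add_mul, Finset.sum_add_distrib])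
    (fun c x y => by ext j; simp [Finset.mul_sum]; refine Finset.sum_congr rfl fun _ _ =>
      Finset.sum_congr rfl fun _ _ => by ring)

theorem FormalGroupLaw.bilin_apply (G : FormalGroupLaw (unitBallRing K) m) (x y : Fin m → K)
    (j : Fin m) : G.bilin x y j = ∑ l, ∑ k, x l * y k * (G.structureConst l k j : K) := rfl

theorem FormalGroupLaw.bracket_eq (G : FormalGroupLaw (unitBallRing K) m) (x y : Fin m → K) :
    G.bracket x y = G.bilin x y - G.bilin y x := by
  ext j
  rw [Pi.sub_apply, bilin_apply, bilin_apply, Finset.sum_comm (f := fun l k => y l * _ * _),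
    ← Finset.sum_sub_distrib]
  refine Finset.sum_congr rfl fun l _ => ?_
  rw [← Finset.sum_sub_distrib]
  refine Finset.sum_congr rfl fun k _ => ?_
  rw [map_sub, mul_sub, mul_comm (y k) (x l)]
  rfl

variable (K m) in
/-- The pair of points `z`, as a family indexed by a sum type. -/
noncomputable def sumElimCLM : (Fin m → K) × (Fin m → K) →L[K] (Fin m ⊕ Fin m → K) :=
  ContinuousLinearMap.pi (Sum.elim
    (fun i => (ContinuousLinearMap.proj i).comp (ContinuousLinearMap.fst K _ _))
    fun i => (ContinuousLinearMap.proj i).comp (ContinuousLinearMap.snd K _ _))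

omit [IsUltrametricDist K] in
theorem sumElimCLM_apply (z : (Fin m → K) × (Fin m → K)) :
    sumElimCLM K m z = Sum.elim z.1 z.2 := by
  ext (i | i) <;> rfl

omit [IsUltrametricDist K] in
theorem norm_sumElimCLM_le : ‖sumElimCLM K m‖ ≤ 1 := by
  refine ContinuousLinearMap.opNorm_le_bound _ zero_le_one fun z => ?_
  rw [one_mul, sumElimCLM_apply]
  refine (pi_norm_le_iff_of_nonneg (norm_nonneg _)).mpr ?_
  rintro (i | i)
  · exact (norm_le_pi_norm z.1 i).trans (norm_fst_le z)
  · exact (norm_le_pi_norm z.2 i).trans (norm_snd_le z)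

theorem Finsupp.exists_eq_single_add_single {σ : Type*} {d : σ →₀ ℕ} (hd : d.degree = 2) :
    ∃ a b, d = Finsupp.single a 1 + Finsupp.single b 1 := by
  classical
  have h1 : Multiset.card d.toMultiset = 2 := by
    rw [Finsupp.card_toMultiset, ← hd]; rfl
  obtain ⟨a, b, hab⟩ := Multiset.card_eq_two.mp h1
  refine ⟨a, b, ?_⟩
  rw [← Finsupp.toMultiset_toFinsupp d, hab,
    show ({a, b} : Multiset σ) = {a} + {b} from rfl, map_add,
    Multiset.toFinsupp_singleton, Multiset.toFinsupp_singleton]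

theorem FormalGroupLaw.exists_hasFPowerSeriesOnBall_mulMap [CompleteSpace K]
    (G : FormalGroupLaw (unitBallRing K) m) {R : ℝ≥0∞} (h0 : 0 < R) (hR : R ≤ 1) :
    ∃ p : FormalMultilinearSeries K ((Fin m → K) × (Fin m → K)) (Fin m → K),
      HasFPowerSeriesOnBall G.mulMap p 0 R ∧ p 0 = 0 ∧ (∀ i, ‖p i‖ ≤ 1) ∧
      (∀ z, p 1 (fun _ => z) = z.1 + z.2) ∧ ∀ z, p 2 (fun _ => z) = G.bilin z.1 z.2 := by
  classical
  choose q hq q1 qd using fun j => exists_hasFPowerSeriesOnBall_evalSeries (G.series j)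
  have hq' : ∀ j, HasFPowerSeriesOnBall (evalSeries (G.series j) ∘ sumElimCLM K m)
      ((q j).compContinuousLinearMap (sumElimCLM K m)) 0 R := fun j => by
    refine (HasFPowerSeriesOnBall.compContinuousLinearMap (r := 1) ?_).mono h0 (hR.trans ?_)
    · simpa using hq j
    · rw [ENNReal.le_div_iff_mul_le (by simp) (by simp)]
      rw [one_mul, ← ofReal_norm]
      exact ENNReal.ofReal_le_one.mpr norm_sumElimCLM_le
  have hpi := (hasFPowerSeriesOnBall_pi_iff h0).mpr hq'
  have happ : ∀ k z j, FormalMultilinearSeries.pi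
      (fun j => (q j).compContinuousLinearMap (sumElimCLM K m)) k (fun _ => z) j =
      q j k (fun _ => Sum.elim z.1 z.2) := fun k z j => by
    rw [← sumElimCLM_apply]
    rfl
  refine ⟨_, hpi.congr fun z _ => ?_, ?_, fun k => ?_, fun z => ?_, fun z => ?_⟩
  · ext j
    simp [mulMap, sumElimCLM_apply]
  · ext v j
    rw [Subsingleton.elim v fun _ => 0, happ, qd]
    have : (Finsupp.finite_of_degree_eq (σ := Fin m ⊕ Fin m) 0).toFinset = {0} := by
      ext d; simp [Finsupp.degree_eq_zero_iff]
    rw [this]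
    simp [G.constantCoeff_series]
  · refine ContinuousMultilinearMap.opNorm_le_bound zero_le_one fun v => ?_
    refine (pi_norm_le_iff_of_nonneg (by positivity)).mpr fun j => ?_
    refine ContinuousMultilinearMap.le_of_opNorm_le (C := 1) (f :=
      (q j k).compContinuousLinearMap fun _ => sumElimCLM K m) ?_ v
    refine (ContinuousMultilinearMap.norm_compContinuousLinearMap_le _ _).trans ?_
    exact mul_le_one₀ (q1 j k) (by positivity)
      (Finset.prod_le_one (fun _ _ => norm_nonneg _) fun _ _ => norm_sumElimCLM_le)
  · ext j
    rw [happ, qd, ← Finset.sum_of_injOn (s := Finset.univ)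
      (f := fun a => ((MvPowerSeries.coeff (Finsupp.single a 1) (G.series j) : unitBallRing K) : K)
        * Sum.elim z.1 z.2 a) (fun a => Finsupp.single a 1)]
    · rw [Fintype.sum_sum_type]
      simp [G.coeff_X, G.coeff_Y, apply_ite (Subtype.val : unitBallRing K → K)]
    · intro a _ b _ hab
      exact (Finsupp.single_left_inj one_ne_zero).mp hab
    · intro a _
      simp
    · intro d hd hd'
      have : d ∈ Set.range fun a : Fin m ⊕ Fin m => Finsupp.single a 1 := by
        rw [Finsupp.range_single_one]
        simpa using hd
      exact absurd (by simpa using this) hd'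
    · intro a _
      simp
  · ext j
    -- Of the monomials of degree two only the mixed ones `X_l Y_k` have a nonzero coefficient.
    rw [happ, qd, ← Finset.sum_of_injOn (s := Finset.univ)
      (f := fun a : Fin m × Fin m => ((G.structureConst a.1 a.2 j : unitBallRing K) : K)
        * (z.1 a.1 * z.2 a.2))
      (fun a => Finsupp.single (Sum.inl a.1) 1 + Finsupp.single (Sum.inr a.2) 1)]
    · rw [Fintype.sum_prod_type, bilin_apply]
      exact Finset.sum_congr rfl fun _ _ => Finset.sum_congr rfl fun _ _ => mul_comm _ _
    · rintro ⟨a, b⟩ _ ⟨a', b'⟩ _ hab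
      have h1 := DFunLike.congr_fun hab (Sum.inl a)
      have h2 := DFunLike.congr_fun hab (Sum.inr b)
      simp [Finsupp.single_apply] at h1 h2
      rw [Prod.mk.injEq]
      exact ⟨(h1).symm, (h2).symm⟩
    · intro a _
      simp
    · intro d hd hd'
      obtain ⟨a, b, rfl⟩ := Finsupp.exists_eq_single_add_single
        (show d.degree = 2 by simpa using hd)
      rcases a with a | a <;> rcases b with b | b
      · simp [G.coeff_XX]
      · exact absurd ⟨(a, b), by simp, rfl⟩ hd'
      · exact absurd ⟨(b, a), by simp, add_comm _ _⟩ hd'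
      · simp [G.coeff_YY]
    · rintro ⟨a, b⟩ _
      rw [structureConst, Finsupp.prod_add_index' (by simp) (by simp [pow_add])]
      simp

end MulMap


/-! ### Translations are isometries; neutral element and inverses -/

section MulMapEstimates

variable {K : Type*} [NontriviallyNormedField K] [IsUltrametricDist K] [CompleteSpace K] {m : ℕ}
  (G : FormalGroupLaw (unitBallRing K) m)

namespace FormalGroupLaw

theorem isContractive_mulMap {R : ℝ≥0∞} (h0 : 0 < R) (hR : R ≤ 1) :
    IsContractive K R G.mulMap := by
  obtain ⟨p, hp, hp0, hp1, -⟩ := G.exists_hasFPowerSeriesOnBall_mulMap h0 hR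
  exact ⟨p, hp, hp0, hp1⟩

theorem mulMap_zero : G.mulMap 0 = 0 := (G.isContractive_mulMap one_pos le_rfl).apply_zero

/-- Subtracting the addition map removes exactly the linear term of `G`, so the quadratic estimate
applies to what is left. -/
theorem norm_mulMap_sub_sub_le {z w : (Fin m → K) × (Fin m → K)} (hz : ‖z‖ < 1) (hw : ‖w‖ < 1) :
    ‖G.mulMap z - G.mulMap w - ((z.1 - w.1) + (z.2 - w.2))‖ ≤ max ‖z‖ ‖w‖ * ‖z - w‖ := by
  obtain ⟨p, hp, hp0, hp1, hp2, -⟩ := G.exists_hasFPowerSeriesOnBall_mulMap one_pos le_rfl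
  let L : (Fin m → K) × (Fin m → K) →L[K] (Fin m → K) :=
    ContinuousLinearMap.fst K _ _ + ContinuousLinearMap.snd K _ _
  have hL := (L.hasFPowerSeriesOnBall 0).mono one_pos le_top
  have hmem : ∀ {z : (Fin m → K) × (Fin m → K)}, ‖z‖ < 1 → z ∈ Metric.eball 0 1 := fun {z} hz => by
    rw [mem_eball_zero_iff, ← ofReal_norm]
    exact ENNReal.ofReal_lt_one.mpr hz
  have h1 : p 1 = L.fpowerSeries 0 1 := by
    ext1 v
    have hv : v = fun _ => v 0 := by
      funext i
      rw [Subsingleton.elim i 0]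
    rw [hv, hp2]
    rfl
  have key := (hp.sub hL).norm_sub_le_of_coeff_one_eq_zero le_rfl ?_ ?_ (hmem hz) (hmem hw)
  · have e : ∀ z, (G.mulMap - ⇑L) z = G.mulMap z - (z.1 + z.2) := fun _ => rfl
    rw [e, e] at key
    rwa [show G.mulMap z - G.mulMap w - (z.1 - w.1 + (z.2 - w.2)) =
      G.mulMap z - (z.1 + z.2) - (G.mulMap w - (w.1 + w.2)) by abel]
  · exact sub_eq_zero.mpr h1
  · intro i
    change ‖p i - L.fpowerSeries 0 i‖ ≤ 1
    match i with
    | 0 =>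
      have : L.fpowerSeries 0 0 = 0 := by ext; simp
      rw [hp0, this]
      simp
    | 1 => rw [h1]; simp
    | n + 2 => simpa using hp1 (n + 2)

theorem mulMap_assoc {x y z : Fin m → K} (hx : ‖x‖ < 1) (hy : ‖y‖ < 1) (hz : ‖z‖ < 1) :
    G.mulMap (G.mulMap (x, y), z) = G.mulMap (x, G.mulMap (y, z)) := by
  funext j
  have hb : ∀ s, ‖(Sum.elim x (Sum.elim y z) : Fin m ⊕ Fin m ⊕ Fin m → K) s‖ < 1 := by
    rintro (s | s | s)
    · exact (norm_le_pi_norm x s).trans_lt hx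
    · exact (norm_le_pi_norm y s).trans_lt hy
    · exact (norm_le_pi_norm z s).trans_lt hz
  have h := congrArg (fun F => evalSeries F (Sum.elim x (Sum.elim y z))) (G.assoc j)
  simp only at h
  have c1 : ∀ s : Fin m ⊕ Fin m, MvPowerSeries.constantCoeff
      (Sum.elim (fun a => MvPowerSeries.X (Sum.inl a))
        (fun a => MvPowerSeries.X (Sum.inr (Sum.inl a))) s :
        MvPowerSeries (Fin m ⊕ Fin m ⊕ Fin m) (unitBallRing K)) = 0 := by
    rintro (s | s) <;> simp
  have c2 : ∀ s : Fin m ⊕ Fin m, MvPowerSeries.constantCoeff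
      (Sum.elim (fun a => MvPowerSeries.X (Sum.inr (Sum.inl a)))
        (fun a => MvPowerSeries.X (Sum.inr (Sum.inr a))) s :
        MvPowerSeries (Fin m ⊕ Fin m ⊕ Fin m) (unitBallRing K)) = 0 := by
    rintro (s | s) <;> simp
  rw [evalSeries_subst _ ?_ hb, evalSeries_subst _ ?_ hb] at h
  · have e1 : (fun s => evalSeries ((Sum.elim
        (fun i => MvPowerSeries.subst
          (Sum.elim (fun a => MvPowerSeries.X (Sum.inl a))
            (fun a => MvPowerSeries.X (Sum.inr (Sum.inl a)))) (G.series i))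
        (fun i => MvPowerSeries.X (Sum.inr (Sum.inr i))) s :
          MvPowerSeries (Fin m ⊕ Fin m ⊕ Fin m) (unitBallRing K))) (Sum.elim x (Sum.elim y z))) =
        Sum.elim (G.mulMap (x, y)) z := by
      funext s
      rcases s with s | s
      · simp only [Sum.elim_inl]
        rw [evalSeries_subst _ c1 hb, mulMap]
        congr 1
        funext t
        rcases t with t | t <;> simp [evalSeries_X]
      · simp [evalSeries_X]
    have e2 : (fun s => evalSeries ((Sum.elim
        (fun i => MvPowerSeries.X (Sum.inl i))
        (fun i => MvPowerSeries.subst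
          (Sum.elim (fun a => MvPowerSeries.X (Sum.inr (Sum.inl a)))
            (fun a => MvPowerSeries.X (Sum.inr (Sum.inr a)))) (G.series i)) s :
          MvPowerSeries (Fin m ⊕ Fin m ⊕ Fin m) (unitBallRing K))) (Sum.elim x (Sum.elim y z))) =
        Sum.elim x (G.mulMap (y, z)) := by
      funext s
      rcases s with s | s
      · simp [evalSeries_X]
      · simp only [Sum.elim_inr]
        rw [evalSeries_subst _ c2 hb, mulMap]
        congr 1
        funext t
        rcases t with t | t <;> simp [evalSeries_X]
    rw [e1, e2] at h
    exact h
  · rintro (s | s)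
    · simp
    · exact MvPowerSeries.constantCoeff_subst_eq_zero
        (MvPowerSeries.hasSubst_of_constantCoeff_zero c2) c2 (G.constantCoeff_series s)
  · rintro (s | s)
    · exact MvPowerSeries.constantCoeff_subst_eq_zero
        (MvPowerSeries.hasSubst_of_constantCoeff_zero c1) c1 (G.constantCoeff_series s)
    · simp

theorem norm_mulMap_le {z : (Fin m → K) × (Fin m → K)} (hz : ‖z‖ < 1) : ‖G.mulMap z‖ ≤ ‖z‖ := by
  refine (G.isContractive_mulMap one_pos le_rfl).norm_apply_le le_rfl ?_
  rw [mem_eball_zero_iff, ← ofReal_norm]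
  exact ENNReal.ofReal_lt_one.mpr hz

omit [CompleteSpace K] in
theorem norm_eq_of_norm_sub_lt {x y : Fin m → K} (h : ‖x - y‖ < ‖y‖) : ‖x‖ = ‖y‖ := by
  have := IsUltrametricDist.norm_add_eq_max_of_norm_ne_norm (x := x - y) (y := y) h.ne
  rwa [sub_add_cancel, max_eq_right h.le] at this

/-- The difference of the images is `y - y'` up to an error of strictly smaller norm. -/
theorem norm_mulMap_left_sub {x y y' : Fin m → K} (hx : ‖x‖ < 1) (hy : ‖y‖ < 1) (hy' : ‖y'‖ < 1) :
    ‖G.mulMap (x, y) - G.mulMap (x, y')‖ = ‖y - y'‖ := by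
  rcases eq_or_ne y y' with rfl | hne
  · simp
  refine norm_eq_of_norm_sub_lt ?_
  have h := G.norm_mulMap_sub_sub_le (z := (x, y)) (w := (x, y')) (max_lt hx hy) (max_lt hx hy')
  simp only [Prod.mk_sub_mk, sub_self, zero_add] at h
  refine h.trans_lt ?_
  rw [Prod.norm_mk 0, norm_zero, max_eq_right (norm_nonneg _)]
  exact mul_lt_of_lt_one_left (norm_pos_iff.mpr (sub_ne_zero.mpr hne))
    (max_lt (max_lt hx hy) (max_lt hx hy'))

theorem norm_mulMap_right_sub {x x' y : Fin m → K} (hx : ‖x‖ < 1) (hx' : ‖x'‖ < 1) (hy : ‖y‖ < 1) :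
    ‖G.mulMap (x, y) - G.mulMap (x', y)‖ = ‖x - x'‖ := by
  rcases eq_or_ne x x' with rfl | hne
  · simp
  refine norm_eq_of_norm_sub_lt ?_
  have h := G.norm_mulMap_sub_sub_le (z := (x, y)) (w := (x', y)) (max_lt hx hy) (max_lt hx' hy)
  simp only [Prod.mk_sub_mk, sub_self, add_zero] at h
  refine h.trans_lt ?_
  rw [Prod.norm_mk _ 0, norm_zero, max_eq_left (norm_nonneg _)]
  exact mul_lt_of_lt_one_left (norm_pos_iff.mpr (sub_ne_zero.mpr hne))
    (max_lt (max_lt hx hy) (max_lt hx' hy))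

/-- The axioms do not postulate `G(X, 0) = X`. Associativity and `G(0, 0) = 0` give `G(G(x, 0), 0) =
G(x, 0)`, and right translation by `0` is injective. -/
theorem mulMap_right_zero {x : Fin m → K} (hx : ‖x‖ < 1) : G.mulMap (x, 0) = x := by
  have h0 : ‖(0 : Fin m → K)‖ < 1 := by simp
  have h1 : ‖G.mulMap (x, 0)‖ < 1 :=
    (G.norm_mulMap_le (max_lt hx h0)).trans_lt (max_lt hx h0)
  have h2 := G.norm_mulMap_right_sub h1 hx h0
  rw [G.mulMap_assoc hx h0 h0, show G.mulMap (0, 0) = 0 from G.mulMap_zero, sub_self,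
    norm_zero] at h2
  exact sub_eq_zero.mp (norm_eq_zero.mp h2.symm)

/-- The inverse is the fixed point of `y ↦ y - G(x, y)`, which contracts the ball `‖y‖ ≤ ‖x‖` with
ratio `‖x‖`. -/
theorem exists_mulMap_eq_zero {x : Fin m → K} (hx : ‖x‖ < 1) :
    ∃ y : Fin m → K, ‖y‖ ≤ ‖x‖ ∧ G.mulMap (x, y) = 0 := by
  let T : (Fin m → K) → (Fin m → K) := fun y => y - G.mulMap (x, y)
  let s : Set (Fin m → K) := {y | ‖y‖ ≤ ‖x‖}
  have hs : IsComplete s := (isClosed_le continuous_norm continuous_const).isComplete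
  have hxy : ∀ {y}, y ∈ s → ‖(x, y)‖ = ‖x‖ := fun {y} hy => max_eq_left hy
  have hT : Set.MapsTo T s s := fun y hy => by
    have hy' : ‖(x, y)‖ < 1 := (hxy hy).trans_lt hx
    have h := IsUltrametricDist.norm_add_le_max y (-G.mulMap (x, y))
    rw [norm_neg, ← sub_eq_add_neg] at h
    refine h.trans (max_le hy ?_)
    exact (G.norm_mulMap_le hy').trans (hxy hy).le
  have hc : ContractingWith ⟨‖x‖, norm_nonneg x⟩ (hT.restrict T s s) := by
    refine ⟨hx, LipschitzWith.of_dist_le_mul fun a b => ?_⟩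
    have ha := hxy a.2
    have hb := hxy b.2
    have h := G.norm_mulMap_sub_sub_le (ha.trans_lt hx) (hb.trans_lt hx)
    rw [ha, hb, max_self] at h
    simp only [Prod.mk_sub_mk, sub_self, zero_add] at h
    rw [Prod.norm_mk 0, norm_zero, max_eq_right (norm_nonneg _), norm_sub_rev] at h
    simp only [Subtype.dist_eq, Set.MapsTo.val_restrict_apply, dist_eq_norm, T]
    rwa [show (a : Fin m → K) - G.mulMap (x, a) - (b - G.mulMap (x, b)) =
      a - b - (G.mulMap (x, a) - G.mulMap (x, b)) by abel]
  obtain ⟨y, hy, hfix, -⟩ := hc.exists_fixedPoint' hs hT (x := 0)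
    (by simp [s]) (edist_ne_top _ _)
  refine ⟨y, hy, ?_⟩
  have : y - G.mulMap (x, y) = y := hfix
  simpa using this

end FormalGroupLaw

end MulMapEstimates

/-! ### The group structure on the polydisc -/

section LevelRadius

/-- The radius `p^{-h}` of the polydisc underlying the standard group of level `h`. -/
noncomputable def levelRadius (p : ℕ) (h : ℝ) : ℝ≥0∞ := ENNReal.ofReal ((p : ℝ) ^ (-h))

variable {p : ℕ} [hp : Fact p.Prime] {K : Type*} [NontriviallyNormedField K] {m : ℕ} {h : ℝ}

theorem levelRadius_pos : 0 < levelRadius p h :=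
  ENNReal.ofReal_pos.mpr (Real.rpow_pos_of_pos (by exact_mod_cast hp.out.pos) _)

theorem levelRadius_le_one [hh : Fact (0 ≤ h)] : levelRadius p h ≤ 1 :=
  ENNReal.ofReal_le_one.mpr (Real.rpow_le_one_of_one_le_of_nonpos
    (by exact_mod_cast hp.out.one_le) (neg_nonpos.mpr hh.out))

/-- For `h ≥ 0` integrality of the coordinates is automatic, so the disc is just an open ball. -/
theorem mem_levelDisc_iff [hh : Fact (0 ≤ h)] {z : Fin m → K} :
    z ∈ levelDisc p K m h ↔ z ∈ Metric.eball 0 (levelRadius p h) := by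
  have h1 : z ∈ Metric.eball 0 (levelRadius p h) ↔ ‖z‖ < (p : ℝ) ^ (-h) := by
    rw [mem_eball_zero_iff, levelRadius, ← ofReal_norm,
      ENNReal.ofReal_lt_ofReal_iff_of_nonneg (norm_nonneg _)]
  refine ⟨fun hz => h1.mpr hz.2, fun hz => ⟨fun j => ?_, h1.mp hz⟩⟩
  exact (norm_le_pi_norm z j).trans (norm_lt_one_of_mem_eball levelRadius_le_one hz).le

theorem mem_eball_pi_iff {k : ℕ} {R : ℝ≥0∞} (hR : 0 < R) {E : Type*} [NormedAddCommGroup E]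
    {x : Fin k → E} :
    x ∈ Metric.eball 0 R ↔ ∀ i, x i ∈ Metric.eball 0 R := by
  simp only [Metric.mem_eball, edist_pi_def, Pi.zero_apply]
  rw [Finset.sup_lt_iff (by simpa using hR)]
  simp

end LevelRadius

namespace StandardGroup

variable {p : ℕ} {K : Type*} [NontriviallyNormedField K] [IsUltrametricDist K]
  {m : ℕ} {G : FormalGroupLaw (unitBallRing K) m} {h : ℝ}

theorem mul_val (x y : StandardGroup p G h) : (x * y).val = G.mulMap (x.val, y.val) := rfl

variable [Fact p.Prime] [Fact (0 ≤ h)]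

theorem val_mem_eball (x : StandardGroup p G h) :
    x.val ∈ Metric.eball 0 (levelRadius p h) := mem_levelDisc_iff.mp x.mem

theorem norm_val_lt_one (x : StandardGroup p G h) : ‖x.val‖ < 1 :=
  norm_lt_one_of_mem_eball levelRadius_le_one x.val_mem_eball

noncomputable instance : One (StandardGroup p G h) :=
  ⟨0, mem_levelDisc_iff.mpr (by simpa using levelRadius_pos)⟩

@[simp]
theorem one_val : (1 : StandardGroup p G h).val = 0 := rfl

variable [CompleteSpace K]

noncomputable instance : Inv (StandardGroup p G h) where
  inv x := ⟨(G.exists_mulMap_eq_zero x.norm_val_lt_one).choose, mem_levelDisc_iff.mpr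
    (mem_eball_of_norm_le x.val_mem_eball
      (G.exists_mulMap_eq_zero x.norm_val_lt_one).choose_spec.1)⟩

noncomputable instance : Group (StandardGroup p G h) :=
  Group.ofRightAxioms
    (fun x y z => StandardGroup.ext
      (G.mulMap_assoc x.norm_val_lt_one y.norm_val_lt_one z.norm_val_lt_one))
    (fun x => StandardGroup.ext (G.mulMap_right_zero x.norm_val_lt_one))
    (fun x => StandardGroup.ext (G.exists_mulMap_eq_zero x.norm_val_lt_one).choose_spec.2)

theorem norm_inv_val_le (x : StandardGroup p G h) : ‖(x⁻¹).val‖ ≤ ‖x.val‖ :=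
  (G.exists_mulMap_eq_zero x.norm_val_lt_one).choose_spec.1

theorem norm_inv_mul_val (x y : StandardGroup p G h) : ‖(x⁻¹ * y).val‖ = ‖y.val - x.val‖ := by
  have h1 := G.norm_mulMap_left_sub x.norm_val_lt_one (x⁻¹ * y).norm_val_lt_one
    (1 : StandardGroup p G h).norm_val_lt_one
  rw [← mul_val, ← mul_val, mul_inv_cancel_left, mul_one, one_val, sub_zero] at h1
  exact h1.symm

end StandardGroup


instance Prod.instIsUltrametricDist {X Y : Type*} [PseudoMetricSpace X] [PseudoMetricSpace Y]
    [IsUltrametricDist X] [IsUltrametricDist Y] : IsUltrametricDist (X × Y) where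
  dist_triangle_max a b c := by
    simp only [Prod.dist_eq]
    refine max_le ((dist_triangle_max a.1 b.1 c.1).trans ?_)
      ((dist_triangle_max a.2 b.2 c.2).trans ?_)
    · exact max_le_max (le_max_left _ _) (le_max_left _ _)
    · exact max_le_max (le_max_right _ _) (le_max_right _ _)

/-! ### Rigid cochains and the pieces of the group coboundary -/

noncomputable section RigidCochains

variable {p : ℕ} {K : Type*} [NontriviallyNormedField K] [IsUltrametricDist K]
  {m : ℕ} {G : FormalGroupLaw (unitBallRing K) m} {h : ℝ}

theorem extendByZero_add {k : ℕ} (f g : (Fin k → StandardGroup p G h) → K) :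
    extendByZero (f + g) = extendByZero f + extendByZero g := by
  funext x
  by_cases hx : ∀ i, x i ∈ levelDisc p K m h <;> simp [extendByZero, hx]

theorem extendByZero_smul {k : ℕ} (c : K) (f : (Fin k → StandardGroup p G h) → K) :
    extendByZero (c • f) = c • extendByZero f := by
  funext x
  by_cases hx : ∀ i, x i ∈ levelDisc p K m h <;> simp [extendByZero, hx]

theorem extendByZero_zero {k : ℕ} :
    extendByZero (0 : (Fin k → StandardGroup p G h) → K) = fun _ => 0 := by
  funext x
  simp [extendByZero]

/-- The coordinates of a tuple of points. -/
def tupleVal {k : ℕ} (x : Fin k → StandardGroup p G h) : Fin k → Fin m → K := fun i => (x i).val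

theorem extendByZero_tupleVal {k : ℕ} (f : (Fin k → StandardGroup p G h) → K)
    (x : Fin k → StandardGroup p G h) : extendByZero f (tupleVal x) = f x :=
  dif_pos fun i => (x i).mem

theorem tupleVal_cons {k : ℕ} (z : StandardGroup p G h) (x : Fin k → StandardGroup p G h) :
    tupleVal (Fin.cons z x : Fin (k + 1) → StandardGroup p G h) = Fin.cons z.val (tupleVal x) := by
  funext i
  refine Fin.cases ?_ (fun i => ?_) i <;> rfl

variable [Fact p.Prime] [Fact (0 ≤ h)]

theorem tupleVal_mem {k : ℕ} (x : Fin k → StandardGroup p G h) :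
    tupleVal x ∈ Metric.eball 0 (levelRadius p h) :=
  (mem_eball_pi_iff levelRadius_pos).mpr fun i => (x i).val_mem_eball

theorem exists_tupleVal_eq {k : ℕ} {w : Fin k → Fin m → K}
    (hw : w ∈ Metric.eball 0 (levelRadius p h)) :
    ∃ x : Fin k → StandardGroup p G h, tupleVal x = w :=
  ⟨fun i => ⟨w i, mem_levelDisc_iff.mpr ((mem_eball_pi_iff levelRadius_pos).mp hw i)⟩, rfl⟩

variable (p G h) in
/-- The functions on `𝒢(h)ᵏ` given by one power series converging on the whole polydisc. -/
def rigidCochains (k : ℕ) : Submodule K ((Fin k → StandardGroup p G h) → K) where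
  carrier := {f | IsRigid K (levelRadius p h) (extendByZero f)}
  add_mem' {f g} hf hg := by
    rw [Set.mem_ofPred_eq, extendByZero_add]
    exact hf.add hg
  zero_mem' := by
    rw [Set.mem_ofPred_eq, extendByZero_zero]
    exact IsRigid.const levelRadius_pos 0
  smul_mem' c f hf := by
    rw [Set.mem_ofPred_eq, extendByZero_smul]
    exact hf.const_smul c

theorem isRigid_of_mem {k : ℕ} {f : (Fin k → StandardGroup p G h) → K}
    (hf : f ∈ rigidCochains p G h k) : IsRigid K (levelRadius p h) (extendByZero f) := hf

theorem mem_rigidCochains_of_isRigid {k : ℕ} {f : (Fin k → StandardGroup p G h) → K}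
    {F : (Fin k → Fin m → K) → K} (hF : IsRigid K (levelRadius p h) F)
    (hx : ∀ x, f x = F (tupleVal x)) : f ∈ rigidCochains p G h k := by
  refine hF.congr fun w hw => ?_
  obtain ⟨x, rfl⟩ := exists_tupleVal_eq (G := G) hw
  rw [extendByZero_tupleVal, hx]

theorem extendByZero_eqOn {k : ℕ} {f : (Fin k → StandardGroup p G h) → K}
    {F : (Fin k → Fin m → K) → K} (hx : ∀ x, f x = F (tupleVal x)) :
    Set.EqOn (extendByZero f) F (Metric.eball 0 (levelRadius p h)) := fun w hw => by
  obtain ⟨x, rfl⟩ := exists_tupleVal_eq (G := G) hw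
  rw [extendByZero_tupleVal, hx]

/-- The coordinates of `a x` are given by a contractive power series in those of `x`. -/
def IsContractivePoint {k : ℕ} (a : (Fin k → StandardGroup p G h) → StandardGroup p G h) : Prop :=
  ∃ A : (Fin k → Fin m → K) → Fin m → K, IsContractive K (levelRadius p h) A ∧
    ∀ x, (a x).val = A (tupleVal x)

theorem isContractivePoint_apply {k : ℕ} (i : Fin k) :
    IsContractivePoint fun x : Fin k → StandardGroup p G h => x i := by
  refine ⟨_, IsContractive.clm levelRadius_pos (ContinuousLinearMap.proj (R := K)
    (φ := fun _ : Fin k => Fin m → K) i) ?_, fun x => rfl⟩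
  refine ContinuousLinearMap.opNorm_le_bound _ zero_le_one fun x => ?_
  rw [one_mul]
  exact norm_le_pi_norm x i

theorem isContractivePoint_one {k : ℕ} :
    IsContractivePoint fun _ : Fin k → StandardGroup p G h => (1 : StandardGroup p G h) :=
  ⟨_, IsContractive.clm levelRadius_pos (0 : (Fin k → Fin m → K) →L[K] (Fin m → K)) (by simp),
    fun x => rfl⟩

theorem IsContractive.prodMk {E F F' : Type*} [NormedAddCommGroup E] [NormedSpace K E]
    [NormedAddCommGroup F] [NormedSpace K F] [NormedAddCommGroup F'] [NormedSpace K F']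
    {R : ℝ≥0∞} {f : E → F} {g : E → F'} (hf : IsContractive K R f) (hg : IsContractive K R g) :
    IsContractive K R fun x => (f x, g x) := by
  obtain ⟨q, hq, q0, q1⟩ := hf
  obtain ⟨r, hr, r0, r1⟩ := hg
  have := hq.prod hr
  rw [min_self] at this
  refine ⟨_, this, ?_, fun i => ?_⟩
  · ext v
    · simp [FormalMultilinearSeries.prod, q0]
    · simp [FormalMultilinearSeries.prod, r0]
  · rw [FormalMultilinearSeries.prod, ContinuousMultilinearMap.opNorm_prod]
    exact max_le (q1 i) (r1 i)

variable [CompleteSpace K]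

theorem IsContractivePoint.mul {k : ℕ}
    {a b : (Fin k → StandardGroup p G h) → StandardGroup p G h}
    (ha : IsContractivePoint a) (hb : IsContractivePoint b) :
    IsContractivePoint fun x => a x * b x := by
  obtain ⟨A, hA, ha⟩ := ha
  obtain ⟨B, hB, hb⟩ := hb
  refine ⟨_, (G.isContractive_mulMap levelRadius_pos levelRadius_le_one).comp levelRadius_le_one
    (hA.prodMk hB), fun x => ?_⟩
  rw [StandardGroup.mul_val, ha, hb]

theorem comp_mem_rigidCochains {k l : ℕ} {f : (Fin l → StandardGroup p G h) → K}
    (hf : f ∈ rigidCochains p G h l)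
    {φ : (Fin k → StandardGroup p G h) → Fin l → StandardGroup p G h}
    (hφ : ∀ i, IsContractivePoint fun x => φ x i) :
    (fun x => f (φ x)) ∈ rigidCochains p G h k := by
  choose A hA ha using hφ
  refine mem_rigidCochains_of_isRigid ((isRigid_of_mem hf).comp levelRadius_le_one
    (IsContractive.pi levelRadius_pos hA)) fun x => ?_
  rw [← extendByZero_tupleVal f]
  congr 1
  funext i
  exact ha i x

variable (p G h) in
/-- The space of rigid cochains, as a type. -/
def RigidCochain (k : ℕ) : Type _ := rigidCochains p G h k

namespace RigidCochain

instance (k : ℕ) : AddCommGroup (RigidCochain p G h k) :=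
  inferInstanceAs (AddCommGroup (rigidCochains p G h k))

instance (k : ℕ) : Module K (RigidCochain p G h k) :=
  inferInstanceAs (Module K (rigidCochains p G h k))

/-- The underlying function of a rigid cochain. -/
def val {k : ℕ} (f : RigidCochain p G h k) : (Fin k → StandardGroup p G h) → K := Subtype.val f

theorem mem {k : ℕ} (f : RigidCochain p G h k) : f.val ∈ rigidCochains p G h k := Subtype.property f

/-- A rigid cochain, from a function. -/
def mk {k : ℕ} (f : (Fin k → StandardGroup p G h) → K) (hf : f ∈ rigidCochains p G h k) :
    RigidCochain p G h k := Subtype.mk f hf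

theorem val_mk {k : ℕ} (f : (Fin k → StandardGroup p G h) → K)
    (hf : f ∈ rigidCochains p G h k) : (mk f hf).val = f := rfl

theorem val_add {k : ℕ} (f g : RigidCochain p G h k) : (f + g).val = f.val + g.val := rfl

theorem val_sub {k : ℕ} (f g : RigidCochain p G h k) : (f - g).val = f.val - g.val := rfl

theorem val_neg {k : ℕ} (f : RigidCochain p G h k) : (-f).val = -f.val := rfl

theorem val_smul {k : ℕ} (c : K) (f : RigidCochain p G h k) : (c • f).val = c • f.val := rfl

theorem val_zero {k : ℕ} : (0 : RigidCochain p G h k).val = 0 := rfl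

theorem val_injective {k : ℕ} : Function.Injective (val : RigidCochain p G h k → _) :=
  Subtype.val_injective

variable (p G h) in
/-- The underlying function, as a linear map. -/
def valHom (k : ℕ) : RigidCochain p G h k →ₗ[K] ((Fin k → StandardGroup p G h) → K) :=
  (rigidCochains p G h k).subtype

theorem valHom_apply {k : ℕ} (f : RigidCochain p G h k) : valHom p G h k f = f.val := rfl

end RigidCochain

theorem rigidCochains_ext {k : ℕ} {f g : RigidCochain p G h k} (h : ∀ x, f.val x = g.val x) :
    f = g := Subtype.ext (funext h)

/-- Pull-back of rigid cochains. -/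
def rigidPullback {k l : ℕ} (φ : (Fin k → StandardGroup p G h) → Fin l → StandardGroup p G h)
    (hφ : ∀ i, IsContractivePoint fun x => φ x i) :
    RigidCochain p G h l →ₗ[K] RigidCochain p G h k where
  toFun f := RigidCochain.mk (fun x => f.val (φ x)) (comp_mem_rigidCochains f.mem hφ)
  map_add' _ _ := rfl
  map_smul' _ _ := rfl

theorem isContractivePoint_contractNth {k : ℕ} (j : Fin (k + 1)) (i : Fin k) :
    IsContractivePoint fun x : Fin (k + 1) → StandardGroup p G h =>
      j.contractNth (· * ·) x i := by
  rcases lt_trichotomy (i : ℕ) j with hij | hij | hij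
  · simp only [Fin.contractNth_apply_of_lt _ _ _ _ hij]
    exact isContractivePoint_apply _
  · simp only [Fin.contractNth_apply_of_eq _ _ _ _ hij]
    exact (isContractivePoint_apply _).mul (isContractivePoint_apply _)
  · simp only [Fin.contractNth_apply_of_gt _ _ _ _ hij]
    exact isContractivePoint_apply _

variable (p G h) in
/-- Pull-back along the map multiplying two neighbouring entries (or dropping the last one). -/
def rigidContract (k : ℕ) (j : Fin (k + 1)) :
    RigidCochain p G h k →ₗ[K] RigidCochain p G h (k + 1) :=
  rigidPullback (fun x => j.contractNth (· * ·) x) (isContractivePoint_contractNth j)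

variable (p G h) in
/-- Pull-back along the map dropping the first entry. -/
def rigidTail (k : ℕ) : RigidCochain p G h k →ₗ[K] RigidCochain p G h (k + 1) :=
  rigidPullback Fin.tail fun i => isContractivePoint_apply i.succ

variable (p G h) in
/-- Evaluation of the first entry at the identity. -/
def rigidEvalOne (k : ℕ) : RigidCochain p G h (k + 1) →ₗ[K] RigidCochain p G h k :=
  rigidPullback (fun x => Fin.cons 1 x) fun i => by
    refine Fin.cases ?_ (fun i => ?_) i
    · exact isContractivePoint_one
    · exact isContractivePoint_apply i

variable (p G h) in
/-- The part `∑ (-1)^{j+1} f(…, x_j x_{j+1}, …)` of the coboundary. -/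
def rigidDelta (k : ℕ) : RigidCochain p G h k →ₗ[K] RigidCochain p G h (k + 1) :=
  ∑ j : Fin (k + 1), (-1 : K) ^ ((j : ℕ) + 1) • rigidContract p G h k j

variable (p G h) in
/-- The coboundary of rigid cochains. -/
def rigidCoboundary (k : ℕ) : RigidCochain p G h k →ₗ[K] RigidCochain p G h (k + 1) :=
  rigidTail p G h k + rigidDelta p G h k

theorem rigidContract_apply {k : ℕ} (j : Fin (k + 1)) (f : RigidCochain p G h k)
    (x : Fin (k + 1) → StandardGroup p G h) :
    (rigidContract p G h k j f).val x = f.val (j.contractNth (· * ·) x) := rfl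

theorem rigidTail_apply {k : ℕ} (f : RigidCochain p G h k)
    (x : Fin (k + 1) → StandardGroup p G h) : (rigidTail p G h k f).val x = f.val (Fin.tail x) := rfl

theorem rigidEvalOne_apply {k : ℕ} (f : RigidCochain p G h (k + 1))
    (x : Fin k → StandardGroup p G h) :
    (rigidEvalOne p G h k f).val x = f.val (Fin.cons 1 x) := rfl

theorem rigidDelta_apply {k : ℕ} (f : RigidCochain p G h k)
    (x : Fin (k + 1) → StandardGroup p G h) :
    (rigidDelta p G h k f).val x =
      ∑ j : Fin (k + 1), (-1) ^ ((j : ℕ) + 1) * f.val (j.contractNth (· * ·) x) := by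
  rw [rigidDelta, LinearMap.sum_apply, ← RigidCochain.valHom_apply, map_sum, Finset.sum_apply]
  rfl

theorem coe_rigidCoboundary {k : ℕ} (f : RigidCochain p G h k) :
    (rigidCoboundary p G h k f).val = cochainDifferential (StandardGroup p G h) K k f.val := by
  funext x
  have : (rigidCoboundary p G h k f).val x =
    (rigidTail p G h k f).val x + (rigidDelta p G h k f).val x := rfl
  rw [this, rigidDelta_apply]
  rfl

theorem Fin.contractNth_succ_cons {α : Type*} {k : ℕ} (op : α → α → α) (j : Fin (k + 1)) (z : α)
    (x : Fin (k + 1) → α) :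
    j.succ.contractNth op (Fin.cons z x : Fin (k + 2) → α) = Fin.cons z (j.contractNth op x) := by
  funext i
  refine Fin.cases ?_ (fun i => ?_) i
  · rw [Fin.contractNth_apply_of_lt _ _ _ _ (by simp)]
    rfl
  · rw [Fin.cons_succ]
    rcases lt_trichotomy (i : ℕ) j with hij | hij | hij
    · rw [Fin.contractNth_apply_of_lt _ _ _ _ hij, Fin.contractNth_apply_of_lt _ _ _ _ (by simpa)]
      rfl
    · rw [Fin.contractNth_apply_of_eq _ _ _ _ hij, Fin.contractNth_apply_of_eq _ _ _ _ (by simpa)]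
      rfl
    · rw [Fin.contractNth_apply_of_gt _ _ _ _ hij, Fin.contractNth_apply_of_gt _ _ _ _ (by simpa)]
      rfl

theorem Fin.contractNth_zero_cons {α : Type*} {k : ℕ} (op : α → α → α) (z : α)
    (x : Fin (k + 1) → α) :
    (0 : Fin (k + 2)).contractNth op (Fin.cons z x : Fin (k + 2) → α) =
      Fin.cons (op z (x 0)) (Fin.tail x) := by
  funext i
  refine Fin.cases ?_ (fun i => ?_) i
  · rw [Fin.contractNth_apply_of_eq _ _ _ _ (by simp)]
    rfl
  · rw [Fin.contractNth_apply_of_gt _ _ _ _ (by simp)]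
    rfl

/-- Evaluation of the first entry at the identity is a contracting homotopy. -/
theorem rigidEvalOne_rigidDelta {k : ℕ} (f : RigidCochain p G h (k + 1)) :
    rigidEvalOne p G h (k + 1) (rigidDelta p G h (k + 1) f) =
      -f - rigidDelta p G h k (rigidEvalOne p G h k f) := by
  refine rigidCochains_ext fun x => ?_
  change _ = -f.val x - (rigidDelta p G h k (rigidEvalOne p G h k f)).val x
  -- The summand `j = 0` multiplies the inserted `1` into `x 0` and gives `-f`; the others are the
  -- summands of the lower `rigidDelta`, with sign reversed by the index shift.
  rw [rigidEvalOne_apply, rigidDelta_apply, rigidDelta_apply, Fin.sum_univ_succ,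
    Fin.contractNth_zero_cons]
  simp only [Fin.contractNth_succ_cons, one_mul, Fin.cons_self_tail, rigidEvalOne_apply]
  rw [sub_eq_add_neg, ← Finset.sum_neg_distrib]
  congr 1
  · simp
  · refine Finset.sum_congr rfl fun j _ => ?_
    rw [Fin.val_succ, pow_succ _ ((j : ℕ) + 1)]
    ring

theorem rigidDelta_zero (f : RigidCochain p G h 0) :
    rigidDelta p G h 0 f = -rigidTail p G h 0 f := by
  refine rigidCochains_ext fun x => ?_
  change _ = -(rigidTail p G h 0 f).val x
  rw [rigidDelta_apply, rigidTail_apply]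
  simp [Subsingleton.elim _ (Fin.tail x)]

/-- For a function independent of the first variable, the leading term of the coboundary cancels the
summand `j = 0`; the rest only involves the remaining variables. -/
theorem rigidCoboundary_rigidTail {k : ℕ} (f : RigidCochain p G h k) :
    rigidCoboundary p G h (k + 1) (rigidTail p G h k f) =
      -rigidTail p G h (k + 1) (rigidDelta p G h k f) := by
  refine rigidCochains_ext fun x => ?_
  change (rigidTail p G h (k + 1) (rigidTail p G h k f)).val x +
    (rigidDelta p G h (k + 1) (rigidTail p G h k f)).val x = -(rigidDelta p G h k f).val (Fin.tail x)
  rw [rigidDelta_apply, rigidDelta_apply, Fin.sum_univ_succ, ← Finset.sum_neg_distrib, ← add_assoc]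
  rw [← Fin.cons_self_tail x]
  simp only [Fin.contractNth_succ_cons, Fin.contractNth_zero_cons, rigidTail_apply, Fin.tail_cons]
  rw [add_eq_right.mpr (by simp)]
  refine Finset.sum_congr rfl fun j _ => ?_
  rw [Fin.val_succ, pow_succ _ ((j : ℕ) + 1)]
  ring

end RigidCochains



/-- The differential agrees by definition with that of inhomogeneous cochains of the trivial
representation. -/
theorem cochainDifferential_cochainDifferential {M K : Type u} [Group M] [CommRing K] {n : ℕ}
    (f : (Fin n → M) → K) :
    cochainDifferential M K (n + 1) (cochainDifferential M K n f) = 0 := by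
  have h := groupCohomology.inhomogeneousCochains.d_comp_d (A := Rep.trivial K M K) (n := n)
  have h2 := congrArg (fun φ => φ.hom f) h
  have e : ∀ (n : ℕ) (f : (Fin n → M) → K),
      (inhomogeneousCochains.d (Rep.trivial K M K) n).hom f =
        cochainDifferential M K n f := fun n f => rfl
  rw [← e, ← e]
  exact h2

/-! ### Right invariant vector fields and the bilinear part of the group law -/

noncomputable section TangentAction

variable {K : Type*} [NontriviallyNormedField K] [IsUltrametricDist K] [CompleteSpace K]
  {m : ℕ} (G : FormalGroupLaw (unitBallRing K) m)

namespace FormalGroupLaw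

/-- The derivative at the identity of right translation by `y`. -/
def tangent (y : Fin m → K) : (Fin m → K) →L[K] (Fin m → K) :=
  (fderiv K G.mulMap (0, y)).comp (ContinuousLinearMap.inl K _ _)

theorem tangent_apply (y v : Fin m → K) : G.tangent y v = fderiv K G.mulMap (0, y) (v, 0) := rfl

theorem fderiv_mulMap_zero (z : (Fin m → K) × (Fin m → K)) :
    fderiv K G.mulMap 0 z = z.1 + z.2 := by
  obtain ⟨p, hp, -, -, hp1, -⟩ := G.exists_hasFPowerSeriesOnBall_mulMap one_pos le_rfl
  have h1 := hp.fderiv.coeff_zero fun _ => 0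
  have h2 := p.derivSeries_apply_const 0 0 z
  rw [← h1, Subsingleton.elim (fun _ : Fin 0 => (0 : (Fin m → K) × (Fin m → K))) fun _ => 0, h2]
  rw [← hp1, Finset.sum_eq_single (0 : Fin 1) (fun i _ hi => absurd (Fin.eq_zero i) hi) (by simp)]
  congr 1
  funext i
  obtain rfl : i = (0 : Fin 1) := Fin.eq_zero i
  exact Function.update_self ..

theorem tangent_zero : G.tangent 0 = 1 := by
  ext1 v
  rw [tangent_apply, show ((0, 0) : (Fin m → K) × (Fin m → K)) = 0 from rfl, fderiv_mulMap_zero]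
  simp

theorem fderiv_fderiv_mulMap_zero (a b : (Fin m → K) × (Fin m → K)) :
    fderiv K (fderiv K G.mulMap) 0 a b = G.bilin a.1 b.2 + G.bilin b.1 a.2 := by
  obtain ⟨p, hp, -, -, -, hp2⟩ := G.exists_hasFPowerSeriesOnBall_mulMap one_pos le_rfl
  have h1 : fderiv K (fderiv K G.mulMap) 0 a = p.derivSeries 1 fun _ => a := by
    rw [hp.fderiv.hasFPowerSeriesAt.fderiv_eq]
    rfl
  rw [h1, p.derivSeries_apply_const, Fin.sum_univ_two]
  have e0 : ∀ a b : (Fin m → K) × (Fin m → K),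
      Function.update (fun _ : Fin 2 => a) 0 b = ![b, a] := fun a b => by
    funext i; fin_cases i <;> rfl
  have e1 : ∀ a b : (Fin m → K) × (Fin m → K),
      Function.update (fun _ : Fin 2 => a) 1 b = ![a, b] := fun a b => by
    funext i; fin_cases i <;> rfl
  have e2 : ∀ a : (Fin m → K) × (Fin m → K), (fun _ : Fin 2 => a) = ![a, a] := fun a => by
    funext i; fin_cases i <;> rfl
  rw [e0, e1]
  have hq : ∀ a, p 2 ![a, a] = G.bilin a.1 a.2 := fun a => by rw [← e2, hp2]
  -- Polarisation: only the diagonal values of `p 2` are known, and they determine the symmetrised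
  -- value that the second derivative needs.
  have hadd : p 2 ![a + b, a + b] = p 2 ![a, a] + p 2 ![a, b] + (p 2 ![b, a] + p 2 ![b, b]) := by
    have u0 : ∀ x y z : (Fin m → K) × (Fin m → K), Function.update ![x, y] 0 z = ![z, y] :=
      fun x y z => by funext i; fin_cases i <;> rfl
    have u1 : ∀ x y z : (Fin m → K) × (Fin m → K), Function.update ![x, y] 1 z = ![x, z] :=
      fun x y z => by funext i; fin_cases i <;> rfl
    have h3 := (p 2).map_update_add ![a + b, a + b] 0 a b
    have h4 := (p 2).map_update_add ![a, a + b] 1 a b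
    have h5 := (p 2).map_update_add ![b, a + b] 1 a b
    rw [u0, u0, u0] at h3
    rw [u1, u1, u1] at h4 h5
    rw [h3, h4, h5]
  rw [hq, hq, hq] at hadd
  simp only [Prod.fst_add, Prod.snd_add, map_add, LinearMap.add_apply] at hadd
  rw [← sub_eq_zero] at hadd ⊢
  rw [← neg_eq_zero, ← hadd]
  abel

theorem isRigid_tangent {R : ℝ≥0∞} (h0 : 0 < R) (hR : R ≤ 1) : IsRigid K R G.tangent := by
  have h1 := (G.isContractive_mulMap h0 hR).isRigid.fderiv
  have h2 : IsContractive K R (ContinuousLinearMap.inr K (Fin m → K) (Fin m → K)) :=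
    IsContractive.clm h0 _ (ContinuousLinearMap.opNorm_le_bound _ zero_le_one fun v => by
      simp [Prod.norm_def])
  exact (h1.comp hR h2).clm_comp
    ((ContinuousLinearMap.compL K _ _ _).flip (ContinuousLinearMap.inl K _ _))

/-- To first order at the identity the invariant fields vary by the bilinear part of `G`, whose
antisymmetrisation is the Lie bracket. -/
theorem fderiv_tangent_zero (v w : Fin m → K) :
    fderiv K G.tangent 0 v w = G.bilin w v := by
  have h1 : DifferentiableAt K (fderiv K G.mulMap) ((0 : Fin m → K), (0 : Fin m → K)) :=
    (G.isContractive_mulMap one_pos le_rfl).isRigid.fderiv.differentiableAt (Metric.mem_eball_self one_pos)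
  have h2 : HasFDerivAt (fun y : Fin m → K => ((0 : Fin m → K), y))
      (ContinuousLinearMap.inr K (Fin m → K) (Fin m → K)) 0 :=
    (ContinuousLinearMap.inr K (Fin m → K) (Fin m → K)).hasFDerivAt
  have h3 := (((ContinuousLinearMap.compL K _ _ _).flip
    (ContinuousLinearMap.inl K (Fin m → K) (Fin m → K))).hasFDerivAt.comp 0
      (h1.hasFDerivAt.comp 0 h2))
  have h4 : HasFDerivAt G.tangent _ 0 := h3
  rw [h4.fderiv]
  change fderiv K (fderiv K G.mulMap) 0 (0, v) (w, 0) = _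
  rw [fderiv_fderiv_mulMap_zero]
  simp

end FormalGroupLaw

end TangentAction


/-! ### Differentiation of the first variable and Cartan's formula -/

noncomputable section PointDerivations


variable {p : ℕ} {K : Type*} [NontriviallyNormedField K] [IsUltrametricDist K]
  {m : ℕ} {G : FormalGroupLaw (unitBallRing K) m} {h : ℝ}

open Classical in
/-- A function on `𝒢(h)`, extended by zero to `K^m`. -/
def extendOne (φ : StandardGroup p G h → K) (z : Fin m → K) : K :=
  if hz : z ∈ levelDisc p K m h then φ ⟨z, hz⟩ else 0

theorem extendOne_val (φ : StandardGroup p G h → K) (z : StandardGroup p G h) :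
    extendOne φ z.val = φ z := dif_pos z.mem

/-- The derivative of `φ` at the identity in the direction `v`. -/
def derivOne (v : Fin m → K) (φ : StandardGroup p G h → K) : K := fderiv K (extendOne φ) 0 v

variable [Fact p.Prime] [Fact (0 ≤ h)]

theorem exists_val_eq {z : Fin m → K} (hz : z ∈ Metric.eball 0 (levelRadius p h)) :
    ∃ x : StandardGroup p G h, x.val = z := ⟨⟨z, mem_levelDisc_iff.mpr hz⟩, rfl⟩

theorem extendOne_eqOn {φ : StandardGroup p G h → K} {F : (Fin m → K) → K}
    (hF : ∀ z, φ z = F z.val) :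
    Set.EqOn (extendOne φ) F (Metric.eball 0 (levelRadius p h)) := fun z hz => by
  obtain ⟨x, rfl⟩ := exists_val_eq (G := G) hz
  rw [extendOne_val, hF]

theorem eball_mem_nhds {E : Type*} [NormedAddCommGroup E] {w : E}
    (hw : w ∈ Metric.eball 0 (levelRadius p h)) : Metric.eball 0 (levelRadius p h) ∈ 𝓝 w :=
  Metric.isOpen_eball.mem_nhds hw

theorem zero_mem_eball {E : Type*} [NormedAddCommGroup E] :
    (0 : E) ∈ Metric.eball 0 (levelRadius p h) := Metric.mem_eball_self levelRadius_pos

theorem derivOne_eq {φ : StandardGroup p G h → K} {F : (Fin m → K) → K}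
    (hF : ∀ z, φ z = F z.val) (v : Fin m → K) : derivOne v φ = fderiv K F 0 v := by
  have h1 : extendOne φ =ᶠ[𝓝 0] F :=
    (extendOne_eqOn hF).eventuallyEq_of_mem (eball_mem_nhds zero_mem_eball)
  rw [derivOne, h1.fderiv_eq]

variable [CompleteSpace K]

variable (K m) in
/-- `x ↦ (0, x)`. -/
def consZeroCLM (k : ℕ) : (Fin k → Fin m → K) →L[K] (Fin (k + 1) → Fin m → K) :=
  ContinuousLinearMap.pi (Fin.cases 0 fun i => ContinuousLinearMap.proj i)

theorem consZeroCLM_apply {k : ℕ} (x : Fin k → Fin m → K) :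
    consZeroCLM K m k x = Fin.cons 0 x := by
  funext i
  refine Fin.cases ?_ (fun i => ?_) i <;> rfl

theorem norm_consZeroCLM_le {k : ℕ} : ‖consZeroCLM K m k‖ ≤ 1 := by
  refine ContinuousLinearMap.opNorm_le_bound _ zero_le_one fun x => ?_
  rw [one_mul, consZeroCLM_apply]
  refine (pi_norm_le_iff_of_nonneg (norm_nonneg _)).mpr fun i => ?_
  refine Fin.cases ?_ (fun i => ?_) i
  · simp
  · exact norm_le_pi_norm x i

variable (K m) in
/-- The inclusion of the first factor. -/
def singleZeroCLM (k : ℕ) : (Fin m → K) →L[K] (Fin (k + 1) → Fin m → K) :=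
  ContinuousLinearMap.single K (fun _ : Fin (k + 1) => Fin m → K) 0

theorem singleZeroCLM_apply {k : ℕ} (z : Fin m → K) :
    singleZeroCLM K m k z = Fin.cons z 0 := by
  funext i
  refine Fin.cases ?_ (fun i => ?_) i
  · simp [singleZeroCLM]
  · simp [singleZeroCLM]

theorem cons_eq_add {k : ℕ} (z : Fin m → K) (x : Fin k → Fin m → K) :
    (Fin.cons z x : Fin (k + 1) → Fin m → K) = singleZeroCLM K m k z + consZeroCLM K m k x := by
  rw [singleZeroCLM_apply, consZeroCLM_apply]
  funext i
  refine Fin.cases ?_ (fun i => ?_) i <;> simp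

theorem hasFDerivAt_cons {k : ℕ} (z : Fin m → K) (x : Fin k → Fin m → K) :
    HasFDerivAt (fun z => (Fin.cons z x : Fin (k + 1) → Fin m → K)) (singleZeroCLM K m k) z := by
  simp only [cons_eq_add]
  exact (singleZeroCLM K m k).hasFDerivAt.add_const _

theorem cons_mem {k : ℕ} {z : Fin m → K} (hz : z ∈ Metric.eball 0 (levelRadius p h))
    {x : Fin k → Fin m → K} (hx : x ∈ Metric.eball 0 (levelRadius p h)) :
    (Fin.cons z x : Fin (k + 1) → Fin m → K) ∈ Metric.eball 0 (levelRadius p h) := by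
  rw [mem_eball_pi_iff levelRadius_pos] at hx ⊢
  refine Fin.cases ?_ (fun i => ?_)
  · exact hz
  · exact hx i

theorem extendOne_cons_eqOn {k : ℕ} (f : (Fin (k + 1) → StandardGroup p G h) → K)
    (x : Fin k → StandardGroup p G h) :
    Set.EqOn (extendOne fun z => f (Fin.cons z x))
      (fun z => extendByZero f (Fin.cons z (tupleVal x))) (Metric.eball 0 (levelRadius p h)) :=
  extendOne_eqOn fun z => by rw [← tupleVal_cons, extendByZero_tupleVal]

theorem analyticOnNhd_extendOne_cons {k : ℕ} {f : (Fin (k + 1) → StandardGroup p G h) → K}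
    (hf : f ∈ rigidCochains p G h (k + 1)) (x : Fin k → StandardGroup p G h) :
    AnalyticOnNhd K (extendOne fun z => f (Fin.cons z x)) (Metric.eball 0 (levelRadius p h)) := by
  refine AnalyticOnNhd.congr Metric.isOpen_eball
    (f := fun z => extendByZero f (Fin.cons z (tupleVal x))) ?_ (extendOne_cons_eqOn f x).symm
  simp only [cons_eq_add]
  refine AnalyticOnNhd.comp (isRigid_of_mem hf).analyticOnNhd (fun z _ => ?_) fun z hz => ?_
  · exact ((singleZeroCLM K m k).analyticAt _).add analyticAt_const
  · rw [← cons_eq_add]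
    exact cons_mem hz (tupleVal_mem x)

theorem derivOne_cons {k : ℕ} {f : (Fin (k + 1) → StandardGroup p G h) → K}
    (hf : f ∈ rigidCochains p G h (k + 1)) (x : Fin k → StandardGroup p G h) (v : Fin m → K) :
    derivOne v (fun z => f (Fin.cons z x)) =
      fderiv K (extendByZero f) (consZeroCLM K m k (tupleVal x)) (singleZeroCLM K m k v) := by
  rw [derivOne_eq (F := fun z => extendByZero f (Fin.cons z (tupleVal x)))
    fun z => by rw [← tupleVal_cons, extendByZero_tupleVal]]
  have h1 : DifferentiableAt K (extendByZero f) (Fin.cons 0 (tupleVal x)) :=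
    (isRigid_of_mem hf).differentiableAt (cons_mem zero_mem_eball (tupleVal_mem x))
  rw [consZeroCLM_apply]
  exact congrArg (fun L : (Fin m → K) →L[K] K => L v)
    (h1.hasFDerivAt.comp (0 : Fin m → K) (hasFDerivAt_cons 0 (tupleVal x))).fderiv

theorem derivOne_cons_mem {k : ℕ} {f : (Fin (k + 1) → StandardGroup p G h) → K}
    (hf : f ∈ rigidCochains p G h (k + 1)) (v : Fin m → K) :
    (fun x => derivOne v fun z => f (Fin.cons z x)) ∈ rigidCochains p G h k := by
  refine mem_rigidCochains_of_isRigid (((isRigid_of_mem hf).fderiv.comp levelRadius_le_one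
    (IsContractive.clm levelRadius_pos (consZeroCLM K m k) norm_consZeroCLM_le)).clm_comp
    (ContinuousLinearMap.apply K K (singleZeroCLM K m k v))) fun x => ?_
  rw [derivOne_cons hf]
  rfl

variable (p G h) in
/-- Differentiation of the first entry at the identity. -/
def rigidDeriv (k : ℕ) :
    (Fin m → K) →ₗ[K] RigidCochain p G h (k + 1) →ₗ[K] RigidCochain p G h k :=
  LinearMap.mk₂ K (fun v f => RigidCochain.mk _ (derivOne_cons_mem f.mem v))
    (fun v w f => rigidCochains_ext fun x => by
      change derivOne (v + w) _ = derivOne v _ + derivOne w _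
      exact map_add (fderiv K (extendOne fun z => f.val (Fin.cons z x)) 0) v w)
    (fun c v f => rigidCochains_ext fun x => by
      change derivOne (c • v) _ = c • derivOne v _
      exact map_smul (fderiv K (extendOne fun z => f.val (Fin.cons z x)) 0) c v)
    (fun v f g => rigidCochains_ext fun x => by
      change derivOne v (fun z => (f + g).val (Fin.cons z x)) =
        derivOne v (fun z => f.val (Fin.cons z x)) + derivOne v (fun z => g.val (Fin.cons z x))
      have hw := cons_mem (zero_mem_eball (p := p) (h := h) (E := Fin m → K)) (tupleVal_mem x)
      rw [derivOne_cons (f + g).mem, derivOne_cons f.mem, derivOne_cons g.mem, consZeroCLM_apply,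
        show (f + g).val = f.val + g.val from rfl, extendByZero_add,
        fderiv_add ((isRigid_of_mem f.mem).differentiableAt hw)
          ((isRigid_of_mem g.mem).differentiableAt hw)]
      rfl)
    (fun c v f => rigidCochains_ext fun x => by
      change derivOne v (fun z => (c • f).val (Fin.cons z x)) =
        c • derivOne v (fun z => f.val (Fin.cons z x))
      have hw := cons_mem (zero_mem_eball (p := p) (h := h) (E := Fin m → K)) (tupleVal_mem x)
      rw [derivOne_cons (c • f).mem, derivOne_cons f.mem, consZeroCLM_apply,
        show (c • f).val = c • f.val from rfl, extendByZero_smul,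
        fderiv_const_smul ((isRigid_of_mem f.mem).differentiableAt hw)]
      rfl)

theorem rigidDeriv_apply {k : ℕ} (v : Fin m → K) (f : RigidCochain p G h (k + 1))
    (x : Fin k → StandardGroup p G h) :
    (rigidDeriv p G h k v f).val x = derivOne v fun z => f.val (Fin.cons z x) := rfl

variable (p G h) in
/-- The action of the Lie algebra through the first entry, by right invariant vector fields. -/
def rigidLie (k : ℕ) :
    (Fin m → K) →ₗ[K] RigidCochain p G h (k + 1) →ₗ[K] RigidCochain p G h (k + 1) :=
  -(rigidDeriv p G h (k + 1)).compl₂ (rigidContract p G h (k + 1) 0)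

theorem rigidLie_apply {k : ℕ} (v : Fin m → K) (f : RigidCochain p G h (k + 1)) :
    rigidLie p G h k v f = -rigidDeriv p G h (k + 1) v (rigidContract p G h (k + 1) 0 f) := rfl

theorem rigidDeriv_rigidTail {k : ℕ} (v : Fin m → K) (f : RigidCochain p G h k) :
    rigidDeriv p G h k v (rigidTail p G h k f) = 0 := by
  refine rigidCochains_ext fun x => ?_
  refine (derivOne_eq (F := fun _ => f.val x) (fun z => rfl) v).trans ?_
  rw [fderiv_const_apply]
  rfl

theorem rigidDeriv_rigidContract_succ {k : ℕ} (v : Fin m → K) (f : RigidCochain p G h (k + 1))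
    (j : Fin (k + 1)) :
    rigidDeriv p G h (k + 1) v (rigidContract p G h (k + 1) j.succ f) =
      rigidContract p G h k j (rigidDeriv p G h k v f) := by
  refine rigidCochains_ext fun x => ?_
  rw [rigidDeriv_apply, rigidContract_apply, rigidDeriv_apply]
  simp only [rigidContract_apply, Fin.contractNth_succ_cons]

/-- Cartan's formula. -/
theorem rigidDeriv_rigidDelta {k : ℕ} (v : Fin m → K) (f : RigidCochain p G h (k + 1)) :
    rigidDeriv p G h (k + 1) v (rigidDelta p G h (k + 1) f) =
      rigidLie p G h k v f - rigidDelta p G h k (rigidDeriv p G h k v f) := by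
  rw [rigidDelta, LinearMap.sum_apply, map_sum, Fin.sum_univ_succ, rigidDelta,
    LinearMap.sum_apply, sub_eq_add_neg, ← Finset.sum_neg_distrib]
  congr 1
  -- The summand `j = 0`, which multiplies the first entry into the second, becomes the Lie action
  -- once it is differentiated.
  · simp [rigidLie_apply]
  · refine Finset.sum_congr rfl fun j _ => ?_
    rw [LinearMap.smul_apply, map_smul, rigidDeriv_rigidContract_succ, LinearMap.smul_apply,
      ← neg_smul, Fin.val_succ, pow_succ _ ((j : ℕ) + 1), mul_neg_one]

theorem rigidEvalOne_rigidLie {k : ℕ} (v : Fin m → K) (f : RigidCochain p G h (k + 1)) :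
    rigidEvalOne p G h k (rigidLie p G h k v f) = -rigidDeriv p G h k v f := by
  rw [rigidLie_apply, map_neg]
  congr 1
  refine rigidCochains_ext fun x => ?_
  rw [rigidEvalOne_apply, rigidDeriv_apply, rigidDeriv_apply]
  simp only [rigidContract_apply, Fin.contractNth_zero_cons, Fin.cons_zero, mul_one, Fin.tail_cons]

theorem rigidCoboundary_rigidCoboundary {k : ℕ} (f : RigidCochain p G h k) :
    rigidCoboundary p G h (k + 1) (rigidCoboundary p G h k f) = 0 := by
  refine RigidCochain.val_injective ?_
  rw [coe_rigidCoboundary, coe_rigidCoboundary, cochainDifferential_cochainDifferential]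
  rfl

/-- Expand `∂∂f = 0` with `∂ = tail + δ`: by `rigidCoboundary_rigidTail`, the coboundary of the tail
part cancels the tail of `δ f`, which leaves `δ δ f`. -/
theorem rigidDelta_rigidDelta {k : ℕ} (f : RigidCochain p G h k) :
    rigidDelta p G h (k + 1) (rigidDelta p G h k f) = 0 := by
  have h1 := rigidCoboundary_rigidCoboundary f
  rw [show rigidCoboundary p G h k f = rigidTail p G h k f + rigidDelta p G h k f from rfl,
    map_add, rigidCoboundary_rigidTail, rigidCoboundary, LinearMap.add_apply,
    neg_add_cancel_left] at h1
  exact h1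

/-- Cartan's formula for `f` and for `δ f`, together with `δ δ = 0`, identifies both sides with `δ`
applied to the derivative of `δ f`. -/
theorem rigidLie_rigidDelta {k : ℕ} (v : Fin m → K) (f : RigidCochain p G h (k + 1)) :
    rigidLie p G h (k + 1) v (rigidDelta p G h (k + 1) f) =
      rigidDelta p G h (k + 1) (rigidLie p G h k v f) := by
  have h1 := rigidDeriv_rigidDelta v (rigidDelta p G h (k + 1) f)
  have h2 := congrArg (rigidDelta p G h (k + 1)) (rigidDeriv_rigidDelta v f)
  rw [rigidDelta_rigidDelta, map_zero] at h1
  rw [map_sub, rigidDelta_rigidDelta, sub_zero] at h2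
  rw [← h2]
  exact (sub_eq_zero.mp h1.symm)

theorem rigidLie_rigidDelta_zero (v : Fin m → K) (f : RigidCochain p G h 0) :
    rigidLie p G h 0 v (rigidDelta p G h 0 f) = 0 := by
  have h1 := rigidDeriv_rigidDelta v (rigidDelta p G h 0 f)
  rw [rigidDelta_rigidDelta, map_zero, rigidDelta_zero, map_neg, map_neg, map_neg,
    rigidDeriv_rigidTail] at h1
  rw [rigidDelta_zero, map_neg]
  simpa using h1.symm

end PointDerivations


/-! ### Commutators of right invariant vector fields -/

noncomputable section Commutator

variable {p : ℕ} {K : Type*} [NontriviallyNormedField K] [IsUltrametricDist K]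
  {m : ℕ} {G : FormalGroupLaw (unitBallRing K) m} {h : ℝ} [Fact p.Prime] [Fact (0 ≤ h)]
  [CompleteSpace K]

theorem FormalGroupLaw.mulMap_zero_left (G : FormalGroupLaw (unitBallRing K) m) {x : Fin m → K}
    (hx : ‖x‖ < 1) : G.mulMap (0, x) = x := by
  have h0 : ‖(0 : Fin m → K)‖ < 1 := by simp
  have h1 : ‖G.mulMap (0, x)‖ < 1 :=
    (G.norm_mulMap_le (max_lt h0 hx)).trans_lt (max_lt h0 hx)
  have h2 := G.norm_mulMap_left_sub h0 h1 hx
  rw [← G.mulMap_assoc h0 h0 hx, show G.mulMap (0, 0) = 0 from G.mulMap_zero, sub_self,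
    norm_zero] at h2
  exact sub_eq_zero.mp (norm_eq_zero.mp h2.symm)

theorem FormalGroupLaw.hasFDerivAt_mulMap_left (G : FormalGroupLaw (unitBallRing K) m)
    {y : Fin m → K} (hy : ‖y‖ < 1) :
    HasFDerivAt (fun z => G.mulMap (z, y)) (G.tangent y) 0 := by
  have h1 : DifferentiableAt K G.mulMap (0, y) :=
    (G.isContractive_mulMap one_pos le_rfl).isRigid.differentiableAt (by
      rw [mem_eball_zero_iff, ← ofReal_norm]
      exact ENNReal.ofReal_lt_one.mpr (max_lt (by simp) hy))
  exact HasFDerivAt.comp (g := G.mulMap) (f := fun z : Fin m → K => (z, y)) (0 : Fin m → K)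
    h1.hasFDerivAt (hasFDerivAt_prodMk_left 0 y)

/-- Differentiate at the identity the invariance of the field under right translation by `y`. The
result is a second derivative of the translation plus the image of `G.bilin v w`; the second
derivative is symmetric and drops out of the antisymmetrisation. -/
theorem FormalGroupLaw.fderiv_tangent_tangent (G : FormalGroupLaw (unitBallRing K) m)
    {y : Fin m → K} (hy : ‖y‖ < 1) (v w : Fin m → K) :
    fderiv K G.tangent y (G.tangent y w) v - fderiv K G.tangent y (G.tangent y v) w =
      G.tangent y (G.bracket v w) := by
  have hball : ∀ {x : Fin m → K}, ‖x‖ < 1 → x ∈ Metric.eball 0 1 := fun {x} hx => by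
    rw [mem_eball_zero_iff, ← ofReal_norm]
    exact ENNReal.ofReal_lt_one.mpr hx
  have h0 : ‖(0 : Fin m → K)‖ < 1 := by simp
  have hT : ∀ {x : Fin m → K}, ‖x‖ < 1 → HasFDerivAt G.tangent (fderiv K G.tangent x) x :=
    fun {x} hx => ((G.isRigid_tangent one_pos le_rfl).differentiableAt (hball hx)).hasFDerivAt
  set r : (Fin m → K) → (Fin m → K) := fun z => G.mulMap (z, y) with hr
  have hrA : ∀ {x : Fin m → K}, ‖x‖ < 1 → AnalyticAt K r x := fun {x} hx => by
    refine AnalyticAt.comp (g := G.mulMap) (f := fun z => (z, y)) ?_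
      (analyticAt_id.prod analyticAt_const)
    refine (G.isContractive_mulMap one_pos le_rfl).isRigid.analyticOnNhd _ ?_
    rw [mem_eball_zero_iff, ← ofReal_norm]
    exact ENNReal.ofReal_lt_one.mpr (max_lt hx hy)
  have key : ∀ v w : Fin m → K, fderiv K G.tangent y (G.tangent y w) v =
      fderiv K (fderiv K r) 0 w v + G.tangent y (G.bilin v w) := by
    intro v w
    have e1 : HasFDerivAt (fun z' => G.tangent (G.mulMap (z', y)) v)
        (((fderiv K G.tangent y).comp (G.tangent y)).flip v) 0 := by
      have h1 : HasFDerivAt G.tangent (fderiv K G.tangent y) (G.mulMap (0, y)) := by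
        rw [G.mulMap_zero_left hy]
        exact hT hy
      have h2 := h1.comp (0 : Fin m → K) (G.hasFDerivAt_mulMap_left hy)
      simpa using h2.clm_apply (hasFDerivAt_const v 0)
    have e2 : HasFDerivAt (fun z' => fderiv K r z' (G.tangent z' v)) _ 0 :=
      (hrA h0).fderiv.differentiableAt.hasFDerivAt.clm_apply
        ((hT h0).clm_apply (hasFDerivAt_const v 0))
    -- Right invariance of the field of `v`: translation by `y` carries its value at `z'` to its
    -- value at `z' y`, by associativity and the chain rule.
    have e3 : (fun z' => G.tangent (G.mulMap (z', y)) v) =ᶠ[𝓝 0]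
        fun z' => fderiv K r z' (G.tangent z' v) := by
      filter_upwards [Metric.isOpen_eball.mem_nhds (hball h0)] with z' hz'
      have hz := norm_lt_one_of_mem_eball le_rfl hz'
      have hzy : ‖G.mulMap (z', y)‖ < 1 :=
        (G.norm_mulMap_le (max_lt hz hy)).trans_lt (max_lt hz hy)
      have h3 := G.hasFDerivAt_mulMap_left hzy
      have h4 : HasFDerivAt r (fderiv K r z') (G.mulMap (0, z')) := by
        rw [G.mulMap_zero_left hz]
        exact (hrA hz).differentiableAt.hasFDerivAt
      have h5 := h4.comp (0 : Fin m → K) (G.hasFDerivAt_mulMap_left hz)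
      have h6 : (r ∘ fun z => G.mulMap (z, z')) =ᶠ[𝓝 0]
          fun z => G.mulMap (z, G.mulMap (z', y)) := by
        filter_upwards [Metric.isOpen_eball.mem_nhds (hball h0)] with z hz0
        exact G.mulMap_assoc (norm_lt_one_of_mem_eball le_rfl hz0) hz hy
      have h7 := h3.unique (h5.congr_of_eventuallyEq h6.symm)
      rw [h7]
      rfl
    have h8 := congrArg (fun L : (Fin m → K) →L[K] (Fin m → K) => L w)
      (e1.unique (e2.congr_of_eventuallyEq e3))
    have hr0 : fderiv K r 0 = G.tangent y := (G.hasFDerivAt_mulMap_left hy).fderiv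
    simpa [G.tangent_zero, G.fderiv_tangent_zero, hr0, add_comm] using h8
  have hsymm : fderiv K (fderiv K r) 0 v w = fderiv K (fderiv K r) 0 w v :=
    ((hrA h0).contDiffAt (n := ⊤)).isSymmSndFDerivAt_of_omega v w
  rw [key, key, hsymm, G.bracket_eq, map_sub]
  abel

theorem derivOne_mul_right {φ : StandardGroup p G h → K} {F : (Fin m → K) → K}
    (hF : ∀ z, φ z = F z.val) (z : StandardGroup p G h) (hd : DifferentiableAt K F z.val)
    (w : Fin m → K) :
    derivOne w (fun z' => φ (z' * z)) = fderiv K F z.val (G.tangent z.val w) := by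
  rw [derivOne_eq (F := fun y => F (G.mulMap (y, z.val))) fun z' => by
    rw [hF, StandardGroup.mul_val]]
  have h1 := G.hasFDerivAt_mulMap_left z.norm_val_lt_one
  have h2 : HasFDerivAt F (fderiv K F z.val) (G.mulMap (0, z.val)) := by
    rw [G.mulMap_zero_left z.norm_val_lt_one]
    exact hd.hasFDerivAt
  exact congrArg (fun L : (Fin m → K) →L[K] K => L w) (h2.comp (0 : Fin m → K) h1).fderiv

theorem rigidLie_val {k : ℕ} (v : Fin m → K) (f : RigidCochain p G h (k + 1))
    (x : Fin (k + 1) → StandardGroup p G h) : (rigidLie p G h k v f).val x =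
      -derivOne v fun z => f.val (Fin.cons (z * x 0) (Fin.tail x)) := by
  rw [rigidLie_apply, RigidCochain.val_neg, Pi.neg_apply, rigidDeriv_apply]
  simp only [rigidContract_apply, Fin.contractNth_zero_cons]

theorem rigidLie_eq_fderiv {k : ℕ} (v : Fin m → K) (f : RigidCochain p G h (k + 1))
    (x : Fin (k + 1) → StandardGroup p G h) : (rigidLie p G h k v f).val x =
      -fderiv K (extendByZero f.val) (tupleVal x)
        (singleZeroCLM K m k (G.tangent (x 0).val v)) := by
  have hx : (Fin.cons (x 0).val (tupleVal (Fin.tail x)) : Fin (k + 1) → Fin m → K) = tupleVal x :=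
    by rw [← tupleVal_cons, Fin.cons_self_tail]
  have h1 : DifferentiableAt K (extendByZero f.val)
      (Fin.cons (x 0).val (tupleVal (Fin.tail x))) := by
    rw [hx]
    exact (isRigid_of_mem f.mem).differentiableAt (tupleVal_mem x)
  have h2 := h1.hasFDerivAt.comp (x 0).val (hasFDerivAt_cons (x 0).val (tupleVal (Fin.tail x)))
  rw [rigidLie_val, derivOne_mul_right (φ := fun z => f.val (Fin.cons z (Fin.tail x)))
    (F := fun z => extendByZero f.val (Fin.cons z (tupleVal (Fin.tail x)))) (fun z => by
      rw [← tupleVal_cons, extendByZero_tupleVal]) (x 0) h2.differentiableAt]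
  have h3 : fderiv K (fun z => extendByZero f.val (Fin.cons z (tupleVal (Fin.tail x)))) (x 0).val =
    _ := h2.fderiv
  rw [h3, hx]
  rfl

theorem derivOne_derivOne_mul {φ : StandardGroup p G h → K}
    (hφ : AnalyticOnNhd K (extendOne φ) (Metric.eball 0 (levelRadius p h))) (v w : Fin m → K) :
    derivOne v (fun z => derivOne w fun z' => φ (z' * z)) =
      fderiv K (fderiv K (extendOne φ)) 0 v w + fderiv K (extendOne φ) 0 (G.bilin w v) := by
  rw [derivOne_eq (F := fun y => fderiv K (extendOne φ) y (G.tangent y w)) fun z =>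
    derivOne_mul_right (fun z => (extendOne_val φ z).symm) z
      (hφ _ z.val_mem_eball).differentiableAt w]
  have h0 : (0 : Fin m → K) ∈ Metric.eball 0 (levelRadius p h) := zero_mem_eball
  have h1 : HasFDerivAt (fderiv K (extendOne φ)) (fderiv K (fderiv K (extendOne φ)) 0) 0 :=
    (hφ 0 h0).fderiv.differentiableAt.hasFDerivAt
  have h2 : HasFDerivAt G.tangent (fderiv K G.tangent 0) 0 :=
    ((G.isRigid_tangent levelRadius_pos levelRadius_le_one).differentiableAt h0).hasFDerivAt
  have h3 := h1.clm_apply (h2.clm_apply (hasFDerivAt_const w 0))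
  rw [h3.fderiv]
  simp [G.tangent_zero, G.fderiv_tangent_zero, add_comm]

/-- The symmetric second derivatives cancel and the first-order variation of the invariant fields
leaves the bracket. The minus sign in `rigidLie` makes it appear with sign `+`. -/
theorem rigidDeriv_rigidLie_sub {k : ℕ} (v w : Fin m → K) (f : RigidCochain p G h (k + 1)) :
    rigidDeriv p G h k v (rigidLie p G h k w f) - rigidDeriv p G h k w (rigidLie p G h k v f) =
      rigidDeriv p G h k (G.bracket v w) f := by
  refine rigidCochains_ext fun x => ?_
  rw [RigidCochain.val_sub, Pi.sub_apply, rigidDeriv_apply, rigidDeriv_apply, rigidDeriv_apply]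
  set φ : StandardGroup p G h → K := fun z => f.val (Fin.cons z x) with hφ
  have hA : AnalyticOnNhd K (extendOne φ) (Metric.eball 0 (levelRadius p h)) :=
    analyticOnNhd_extendOne_cons f.mem x
  have e : ∀ v w : Fin m → K, derivOne v (fun z => (rigidLie p G h k w f).val (Fin.cons z x)) =
      -(fderiv K (fderiv K (extendOne φ)) 0 v w + fderiv K (extendOne φ) 0 (G.bilin w v)) := by
    intro v w
    rw [← derivOne_derivOne_mul hA]
    simp only [rigidLie_val, Fin.cons_zero, Fin.tail_cons]
    have : extendOne (fun z => -derivOne w fun z' => φ (z' * z)) =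
        -extendOne (fun z => derivOne w fun z' => φ (z' * z)) := by
      funext z
      by_cases hz : z ∈ levelDisc p K m h <;> simp [extendOne, hz]
    rw [derivOne, this, fderiv_neg]
    rfl
  have hsymm : fderiv K (fderiv K (extendOne φ)) 0 v w = fderiv K (fderiv K (extendOne φ)) 0 w v :=
    ((hA 0 zero_mem_eball).contDiffAt (n := ⊤)).isSymmSndFDerivAt_of_omega v w
  rw [e, e, hsymm, G.bracket_eq, derivOne, map_sub]
  ring

end Commutator


/-! ### Exterior calculus for alternating maps with values in modules -/

noncomputable section AlternatingAlgebra

namespace AlternatingMap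

variable {R V N N' N'' : Type*} [CommRing R] [AddCommGroup V] [Module R V] [AddCommGroup N]
  [Module R N] [AddCommGroup N'] [Module R N'] [AddCommGroup N''] [Module R N'']

/-- The linear map `v ↦ A v ∘ β` attached to a bilinear map `A` and a form `β`. -/
def actLM (A : V →ₗ[R] N →ₗ[R] N') (q : ℕ) :
    (V [⋀^Fin q]→ₗ[R] N) →ₗ[R] V →ₗ[R] V [⋀^Fin q]→ₗ[R] N' :=
  (LinearMap.mk₂ R (fun v β => (A v).compAlternatingMap β)
    (fun v w β => by ext; simp) (fun c v β => by ext; simp)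
    (fun v β γ => by ext; simp) (fun c v β => by ext; simp)).flip

/-- The alternation of `v ↦ A v ∘ β`. -/
def wedge (A : V →ₗ[R] N →ₗ[R] N') (q : ℕ) :
    (V [⋀^Fin q]→ₗ[R] N) →ₗ[R] V [⋀^Fin (q + 1)]→ₗ[R] N' :=
  alternatizeUncurryFinLM ∘ₗ actLM A q

theorem wedge_eq (A : V →ₗ[R] N →ₗ[R] N') {q : ℕ} (β : V [⋀^Fin q]→ₗ[R] N) :
    wedge A q β = alternatizeUncurryFin (actLM A q β) := rfl

theorem wedge_apply (A : V →ₗ[R] N →ₗ[R] N') {q : ℕ} (β : V [⋀^Fin q]→ₗ[R] N)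
    (v : Fin (q + 1) → V) :
    wedge A q β v = ∑ i : Fin (q + 1), (-1) ^ (i : ℕ) • A (v i) (β (i.removeNth v)) := by
  rw [wedge_eq, alternatizeUncurryFin_apply]
  rfl

theorem compAlternatingMap_alternatizeUncurryFin (L : N →ₗ[R] N') {q : ℕ}
    (f : V →ₗ[R] V [⋀^Fin q]→ₗ[R] N) :
    L.compAlternatingMap (alternatizeUncurryFin f) =
      alternatizeUncurryFin (LinearMap.compAlternatingMapₗ R L ∘ₗ f) := by
  ext v
  simp [alternatizeUncurryFin_apply, map_sum]

theorem compAlternatingMap_wedge {A : V →ₗ[R] N →ₗ[R] N'} {N₁ : Type*} [AddCommGroup N₁]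
    [Module R N₁] {A' : V →ₗ[R] N₁ →ₗ[R] N''} {L : N' →ₗ[R] N''} {L' : N →ₗ[R] N₁}
    (hL : ∀ v x, L (A v x) = A' v (L' x)) {q : ℕ} (β : V [⋀^Fin q]→ₗ[R] N) :
    L.compAlternatingMap (wedge A q β) = wedge A' q (L'.compAlternatingMap β) := by
  ext v
  simp [wedge_apply, map_sum, hL]

/-- A double alternation kills symmetric maps, in particular `Θ + Θ.flip`. -/
theorem alternatizeUncurryFin_flip {q : ℕ} (Θ : V →ₗ[R] V →ₗ[R] V [⋀^Fin q]→ₗ[R] N) :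
    alternatizeUncurryFin (alternatizeUncurryFinLM ∘ₗ Θ.flip) =
      -alternatizeUncurryFin (alternatizeUncurryFinLM ∘ₗ Θ) := by
  rw [← add_eq_zero_iff_eq_neg, ← alternatizeUncurryFin_add, ← LinearMap.comp_add]
  exact alternatizeUncurryFin_alternatizeUncurryFinLM_comp_of_symmetric fun x y => add_comm _ _

theorem alternatizeUncurryFin_congr_of_antisymm {q : ℕ}
    {Θ Θ' : V →ₗ[R] V →ₗ[R] V [⋀^Fin q]→ₗ[R] N}
    (h : ∀ v w, Θ v w - Θ w v = Θ' v w - Θ' w v) :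
    alternatizeUncurryFin (alternatizeUncurryFinLM ∘ₗ Θ) =
      alternatizeUncurryFin (alternatizeUncurryFinLM ∘ₗ Θ') := by
  have h1 := alternatizeUncurryFin_alternatizeUncurryFinLM_comp_of_symmetric (f := Θ - Θ')
    fun v w => by
      rw [LinearMap.sub_apply, LinearMap.sub_apply, LinearMap.sub_apply, LinearMap.sub_apply,
        sub_eq_sub_iff_sub_eq_sub, h]
  rw [LinearMap.comp_sub, ← alternatizeUncurryFinLM_apply, map_sub, sub_eq_zero] at h1
  exact h1

/-- Separate the term in which `u` is fed to `f` from those in which it enters the form; moving `u`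
past one argument gives the sign. -/
theorem curryLeft_alternatizeUncurryFin {q : ℕ} (f : V →ₗ[R] V [⋀^Fin (q + 1)]→ₗ[R] N) (u : V) :
    (alternatizeUncurryFin f).curryLeft u =
      f u - alternatizeUncurryFin ((curryLeftLinearMap ∘ₗ f).flip u) := by
  ext v
  rw [curryLeft_apply_apply, alternatizeUncurryFin_apply, Fin.sum_univ_succ, sub_apply,
    sub_eq_add_neg, alternatizeUncurryFin_apply, ← Finset.sum_neg_distrib]
  congr 1
  · simp [Matrix.vecCons]
  · refine Finset.sum_congr rfl fun i _ => ?_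
    rw [Fin.val_succ, pow_succ, mul_neg_one, neg_smul]
    congr 2
    change f _ _ = f (v i) (Matrix.vecCons u (i.removeNth v))
    congr 1
    funext j
    refine Fin.cases ?_ (fun j => ?_) j
    · rfl
    · simp [Fin.removeNth, Matrix.vecCons]

theorem curryLeft_alternatizeUncurryFin_zero (f : V →ₗ[R] V [⋀^Fin 0]→ₗ[R] N) (u : V) :
    (alternatizeUncurryFin f).curryLeft u = f u := by
  ext v
  rw [curryLeft_apply_apply, alternatizeUncurryFin_apply]
  simp [Matrix.vecCons]

theorem wedge_alternatizeUncurryFin (D : V →ₗ[R] N →ₗ[R] N') {q : ℕ}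
    (φ : V →ₗ[R] V [⋀^Fin q]→ₗ[R] N) :
    wedge D (q + 1) (alternatizeUncurryFin φ) = -alternatizeUncurryFin (wedge D q ∘ₗ φ) := by
  have h1 := alternatizeUncurryFin_flip (actLM D q ∘ₗ φ)
  rw [← LinearMap.comp_assoc] at h1
  refine Eq.trans ?_ h1
  rw [wedge_eq]
  congr 1
  refine LinearMap.ext fun v => ?_
  exact compAlternatingMap_alternatizeUncurryFin _ _

theorem alternatizeUncurryFin_compr₂_wedge (D : V →ₗ[R] N →ₗ[R] N') {q : ℕ}
    (Θ : V →ₗ[R] V →ₗ[R] V [⋀^Fin q]→ₗ[R] N) :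
    alternatizeUncurryFin (alternatizeUncurryFinLM ∘ₗ Θ.compr₂ (wedge D q)) =
      wedge D (q + 2) (alternatizeUncurryFin (alternatizeUncurryFinLM ∘ₗ Θ)) := by
  rw [wedge_alternatizeUncurryFin, ← alternatizeUncurryFinLM_apply,
    ← alternatizeUncurryFinLM_apply (f := wedge D (q + 1) ∘ₗ _), ← map_neg]
  congr 1
  refine LinearMap.ext fun v => ?_
  change alternatizeUncurryFin (wedge D q ∘ₗ Θ v) =
    -wedge D (q + 1) (alternatizeUncurryFin (Θ v))
  rw [wedge_alternatizeUncurryFin, neg_neg]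

/-- The Chevalley–Eilenberg differential with trivial coefficients of the bracket
`B v w - B w v`. -/
def bracketDifferential (B : V →ₗ[R] V →ₗ[R] V) :
    (q : ℕ) → (V [⋀^Fin q]→ₗ[R] N) →ₗ[R] V [⋀^Fin (q + 1)]→ₗ[R] N
  | 0 => 0
  | _ + 1 =>
    { toFun := fun β =>
        -alternatizeUncurryFin (alternatizeUncurryFinLM ∘ₗ B.compr₂ (curryLeft β))
      map_add' := fun β γ => by
        rw [← neg_add, ← alternatizeUncurryFin_add, ← LinearMap.comp_add]
        rfl
      map_smul' := fun c β => by
        rw [RingHom.id_apply, smul_neg, ← alternatizeUncurryFin_smul, ← LinearMap.comp_smul]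
        rfl }

theorem bracketDifferential_zero (B : V →ₗ[R] V →ₗ[R] V) (β : V [⋀^Fin 0]→ₗ[R] N) :
    bracketDifferential B 0 β = 0 := rfl

theorem bracketDifferential_succ (B : V →ₗ[R] V →ₗ[R] V) {q : ℕ}
    (β : V [⋀^Fin (q + 1)]→ₗ[R] N) : bracketDifferential B (q + 1) β =
      -alternatizeUncurryFin (alternatizeUncurryFinLM ∘ₗ B.compr₂ (curryLeft β)) := rfl

theorem compAlternatingMap_bracketDifferential (B : V →ₗ[R] V →ₗ[R] V) (L : N →ₗ[R] N') {q : ℕ}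
    (β : V [⋀^Fin q]→ₗ[R] N) :
    L.compAlternatingMap (bracketDifferential B q β) =
      bracketDifferential B q (L.compAlternatingMap β) := by
  cases q with
  | zero => simp [bracketDifferential_zero]
  | succ q =>
    rw [bracketDifferential_succ, bracketDifferential_succ, ← LinearMap.compAlternatingMapₗ_apply R,
      map_neg, LinearMap.compAlternatingMapₗ_apply, compAlternatingMap_alternatizeUncurryFin]
    congr 2
    refine LinearMap.ext fun v => ?_
    exact compAlternatingMap_alternatizeUncurryFin _ _

/-- The double alternation sees only the antisymmetric part of `D v ∘ E w`, which by `hDE` may be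
replaced by `D (B v w)`. The identity `D u ∘ β = ι_u (D ∧ β) + D ∧ ι_u β` with `u = B v w` splits
this into the two bracket terms. -/
theorem wedge_wedge (B : V →ₗ[R] V →ₗ[R] V) {D : V →ₗ[R] N →ₗ[R] N'} {E : V →ₗ[R] N →ₗ[R] N}
    (hDE : ∀ v w x, D v (E w x) - D w (E v x) = D (B v w) x - D (B w v) x) {q : ℕ}
    (β : V [⋀^Fin q]→ₗ[R] N) : wedge D (q + 1) (wedge E q β) =
      -bracketDifferential B (q + 1) (wedge D q β) - wedge D (q + 1) (bracketDifferential B q β) := by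
  have h1 : wedge D (q + 1) (wedge E q β) =
      alternatizeUncurryFin (alternatizeUncurryFinLM ∘ₗ B.compr₂ (actLM D q β)) := by
    rw [← alternatizeUncurryFin_congr_of_antisymm (Θ := (actLM D q ∘ₗ actLM E q β).flip)]
    · rw [wedge_eq]
      congr 1
      refine LinearMap.ext fun v => ?_
      exact compAlternatingMap_alternatizeUncurryFin _ _
    · intro v w
      ext x
      exact hDE v w (β x)
  rw [h1, bracketDifferential_succ, neg_neg]
  cases q with
  | zero =>
    rw [bracketDifferential_zero (N := N), LinearMap.map_zero, sub_zero]
    congr 3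
    exact LinearMap.ext fun u => (curryLeft_alternatizeUncurryFin_zero _ u).symm
  | succ q =>
    rw [bracketDifferential_succ, map_neg, sub_neg_eq_add, ← alternatizeUncurryFin_compr₂_wedge,
      ← alternatizeUncurryFin_add, ← LinearMap.comp_add]
    congr 2
    refine LinearMap.ext₂ fun v w => ?_
    change actLM D (q + 1) β (B v w) = (wedge D (q + 1) β).curryLeft (B v w) +
      wedge D q (β.curryLeft (B v w))
    rw [wedge_eq, curryLeft_alternatizeUncurryFin]
    exact (sub_add_cancel _ _).symm

/-- The alternation itself turns `B` into its commutator. In this explicit form the differential can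
be compared with `lieDifferential` and with the exterior derivative evaluated on vector fields. -/
theorem bracketDifferential_apply (B : V →ₗ[R] V →ₗ[R] V) {q : ℕ}
    (β : V [⋀^Fin (q + 1)]→ₗ[R] N) (v : Fin (q + 2) → V) :
    bracketDifferential B (q + 1) β v = -∑ i : Fin (q + 1), ∑ j ≥ i, (-1 : ℤ) ^ (i + j : ℕ) •
      β (Fin.cons (B (v i.castSucc) (v j.succ) - B (v j.succ) (v i.castSucc))
        (j.removeNth (i.castSucc.removeNth v))) := by
  rw [bracketDifferential_succ, neg_apply,
    alternatizeUncurryFin_alternatizeUncurryFinLM_comp_apply]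
  congr 1
  refine Finset.sum_congr rfl fun i _ => Finset.sum_congr rfl fun j _ => ?_
  congr 1
  change _ = (β.curryLeft (_ - _)) _
  rw [map_sub]
  rfl

end AlternatingMap

theorem lieDifferential_eq_bracketDifferential {K : Type*} [NontriviallyNormedField K]
    [IsUltrametricDist K] {m : ℕ} (G : FormalGroupLaw (unitBallRing K) m) {n : ℕ}
    (ω : (Fin m → K) [⋀^Fin n]→ₗ[K] K) :
    lieDifferential G K n ω = ⇑(AlternatingMap.bracketDifferential G.bilin n ω) := by
  cases n with
  | zero => rfl
  | succ n =>
    funext v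
    rw [AlternatingMap.bracketDifferential_apply]
    change ∑ s : Fin (n + 2), ∑ r : Fin (n + 1), _ = _
    rw [Finset.sum_comm, ← Finset.sum_neg_distrib]
    refine Finset.sum_congr rfl fun r _ => ?_
    -- A pair `r < s` is written as `r ≤ j` with `s = j + 1`; this shift accounts for the global
    -- minus sign in `bracketDifferential`.
    rw [Fin.sum_univ_succ, if_neg (by simp), zero_add, ← Finset.sum_neg_distrib,
      show Finset.Ici r = Finset.univ.filter (r ≤ ·) by ext; simp, Finset.sum_filter]
    refine Finset.sum_congr rfl fun s _ => ?_
    by_cases hrs : r ≤ s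
    · rw [if_pos hrs, if_pos (Fin.castSucc_lt_succ_iff.mpr hrs), Fin.removeNth_removeNth_eq_swap,
        Fin.val_succ, ← add_assoc, pow_succ, G.bracket_eq]
      have h1 : r.castSucc.succAbove s = s.succ := Fin.succAbove_of_le_castSucc _ _ (by simpa)
      have h2 : s.predAbove r.castSucc = r := by simp [Fin.predAbove, hrs]
      rw [h1, h2]
      simp only [Int.reduceNeg, zsmul_eq_mul, Int.cast_pow, Int.cast_neg, Int.cast_one, mul_neg_one, neg_mul]
      rfl
    · rw [if_neg hrs, if_neg (by rwa [Fin.castSucc_lt_succ_iff])]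

theorem mem_lieCocycles_iff {K : Type*} [NontriviallyNormedField K]
    [IsUltrametricDist K] {m : ℕ} (G : FormalGroupLaw (unitBallRing K) m) {n : ℕ}
    (ω : (Fin m → K) [⋀^Fin n]→ₗ[K] K) :
    ω ∈ lieCocycles G K n ↔ AlternatingMap.bracketDifferential G.bilin n ω = 0 := by
  rw [lieCocycles, LinearMap.mem_ker, lieDifferential_eq_bracketDifferential]
  exact (DFunLike.coe_injective.eq_iff' rfl)

theorem mem_lieCoboundaries_succ_iff {K : Type*} [NontriviallyNormedField K]
    [IsUltrametricDist K] {m : ℕ} (G : FormalGroupLaw (unitBallRing K) m) {n : ℕ}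
    (ω : (Fin m → K) [⋀^Fin (n + 1)]→ₗ[K] K) :
    ω ∈ lieCoboundaries G K (n + 1) ↔ ∃ η, AlternatingMap.bracketDifferential G.bilin n η = ω := by
  change (∃ η, _) ↔ _
  simp only [lieDifferential_eq_bracketDifferential, DFunLike.coe_injective.eq_iff]

end AlternatingAlgebra


/-! ### The double complex of forms with values in rigid cochains -/

noncomputable section DoubleComplex

open AlternatingMap (wedge wedge_eq wedge_apply wedge_wedge wedge_alternatizeUncurryFin
  bracketDifferential bracketDifferential_zero compAlternatingMap_wedge
  compAlternatingMap_bracketDifferential alternatizeUncurryFin alternatizeUncurryFin_apply)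

variable {p : ℕ} {K : Type*} [NontriviallyNormedField K] [IsUltrametricDist K]
  {m : ℕ} {G : FormalGroupLaw (unitBallRing K) m} {h : ℝ} [Fact p.Prime] [Fact (0 ≤ h)]
  [CompleteSpace K]

theorem AlternatingMap.neg_smul_eq {R M N ι : Type*} [CommRing R] [AddCommGroup M] [Module R M]
    [AddCommGroup N] [Module R N] (c : R) (ω : M [⋀^ι]→ₗ[R] N) : (-c) • ω = -(c • ω) := by
  ext
  simp

variable (p G h) in
/-- Alternating forms on the Lie algebra with values in rigid cochains. -/
abbrev RigidForm (k q : ℕ) : Type _ := (Fin m → K) [⋀^Fin q]→ₗ[K] RigidCochain p G h k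

variable (p G h) in
/-- The Chevalley–Eilenberg differential of forms with values in the cochains, on which the Lie
algebra acts through the first entry. -/
def formD (k q : ℕ) : RigidForm p G h (k + 1) q →ₗ[K] RigidForm p G h (k + 1) (q + 1) :=
  wedge (rigidLie p G h k) q + bracketDifferential G.bilin q

variable (p G h) in
/-- Differentiation of the first entry at the identity, for forms. -/
def formDeriv (k q : ℕ) : RigidForm p G h (k + 1) q →ₗ[K] RigidForm p G h k (q + 1) :=
  wedge (rigidDeriv p G h k) q

variable (p G h) in
/-- `rigidDelta` for forms. -/
def formDelta (k q : ℕ) : RigidForm p G h k q →ₗ[K] RigidForm p G h (k + 1) q :=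
  LinearMap.compAlternatingMapₗ K (rigidDelta p G h k)

variable (p G h) in
/-- `rigidTail` for forms. -/
def formTail (k q : ℕ) : RigidForm p G h k q →ₗ[K] RigidForm p G h (k + 1) q :=
  LinearMap.compAlternatingMapₗ K (rigidTail p G h k)

variable (p G h) in
/-- `rigidEvalOne` for forms. -/
def formEvalOne (k q : ℕ) : RigidForm p G h (k + 1) q →ₗ[K] RigidForm p G h k q :=
  LinearMap.compAlternatingMapₗ K (rigidEvalOne p G h k)

theorem formD_apply {k q : ℕ} (β : RigidForm p G h (k + 1) q) : formD p G h k q β =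
    wedge (rigidLie p G h k) q β + bracketDifferential G.bilin q β := rfl

theorem formDelta_apply {k q : ℕ} (β : RigidForm p G h k q) (v : Fin q → Fin m → K) :
    formDelta p G h k q β v = rigidDelta p G h k (β v) := rfl

theorem formTail_apply {k q : ℕ} (β : RigidForm p G h k q) (v : Fin q → Fin m → K) :
    formTail p G h k q β v = rigidTail p G h k (β v) := rfl

theorem formEvalOne_apply {k q : ℕ} (β : RigidForm p G h (k + 1) q) (v : Fin q → Fin m → K) :
    formEvalOne p G h k q β v = rigidEvalOne p G h k (β v) := rfl

theorem formDeriv_formDelta {k q : ℕ} (β : RigidForm p G h (k + 1) q) :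
    formDeriv p G h (k + 1) q (formDelta p G h (k + 1) q β) =
      wedge (rigidLie p G h k) q β - formDelta p G h k (q + 1) (formDeriv p G h k q β) := by
  ext1 v
  rw [AlternatingMap.sub_apply, formDelta_apply, formDeriv, formDeriv, wedge_apply, wedge_apply,
    wedge_apply, map_sum, ← Finset.sum_sub_distrib]
  refine Finset.sum_congr rfl fun i _ => ?_
  rw [formDelta_apply, rigidDeriv_rigidDelta, map_zsmul, smul_sub]

theorem formDeriv_formTail {k q : ℕ} (β : RigidForm p G h k q) :
    formDeriv p G h k q (formTail p G h k q β) = 0 := by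
  ext1 v
  rw [formDeriv, wedge_apply]
  refine Finset.sum_eq_zero fun i _ => ?_
  rw [formTail_apply, rigidDeriv_rigidTail, smul_zero]

theorem formDeriv_wedge_rigidLie {k q : ℕ} (β : RigidForm p G h (k + 1) q) :
    formDeriv p G h k (q + 1) (wedge (rigidLie p G h k) q β) =
      -bracketDifferential G.bilin (q + 1) (formDeriv p G h k q β) -
        formDeriv p G h k (q + 1) (bracketDifferential G.bilin q β) :=
  wedge_wedge G.bilin (fun v w f => by
    rw [rigidDeriv_rigidLie_sub, G.bracket_eq, map_sub, LinearMap.sub_apply]) β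

theorem formEvalOne_bracketDifferential {k q : ℕ} (β : RigidForm p G h (k + 1) q) :
    formEvalOne p G h k (q + 1) (bracketDifferential G.bilin q β) =
      bracketDifferential G.bilin q (formEvalOne p G h k q β) :=
  compAlternatingMap_bracketDifferential _ _ _

theorem formDelta_bracketDifferential {k q : ℕ} (β : RigidForm p G h k q) :
    formDelta p G h k (q + 1) (bracketDifferential G.bilin q β) =
      bracketDifferential G.bilin q (formDelta p G h k q β) :=
  compAlternatingMap_bracketDifferential _ _ _

theorem formEvalOne_formD {k q : ℕ} (β : RigidForm p G h (k + 1) q) :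
    formEvalOne p G h k (q + 1) (formD p G h k q β) =
      bracketDifferential G.bilin q (formEvalOne p G h k q β) - formDeriv p G h k q β := by
  rw [formD_apply, map_add, formEvalOne_bracketDifferential, sub_eq_neg_add]
  congr 1
  ext1 v
  rw [AlternatingMap.neg_apply, formEvalOne_apply, formDeriv, wedge_apply, wedge_apply, map_sum,
    ← Finset.sum_neg_distrib]
  refine Finset.sum_congr rfl fun i _ => ?_
  rw [map_zsmul, rigidEvalOne_rigidLie, smul_neg]

theorem formD_formDelta {k q : ℕ} (β : RigidForm p G h (k + 1) q) :
    formD p G h (k + 1) q (formDelta p G h (k + 1) q β) =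
      formDelta p G h (k + 1) (q + 1) (formD p G h k q β) := by
  rw [formD_apply, formD_apply, map_add, formDelta_bracketDifferential]
  congr 1
  exact (compAlternatingMap_wedge (fun v f => (rigidLie_rigidDelta v f).symm) β).symm

theorem formD_formDelta_zero {q : ℕ} (β : RigidForm p G h 0 q) :
    formD p G h 0 q (formDelta p G h 0 q β) =
      formDelta p G h 0 (q + 1) (bracketDifferential G.bilin q β) := by
  rw [formD_apply, formDelta_bracketDifferential, add_eq_right]
  ext1 v
  rw [wedge_apply]
  refine Finset.sum_eq_zero fun i _ => ?_
  rw [formDelta_apply, rigidLie_rigidDelta_zero, smul_zero]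

theorem formDelta_formDelta {k q : ℕ} (β : RigidForm p G h k q) :
    formDelta p G h (k + 1) q (formDelta p G h k q β) = 0 := by
  ext1 v
  rw [formDelta_apply, formDelta_apply, rigidDelta_rigidDelta]
  rfl

theorem formEvalOne_formDelta {k q : ℕ} (β : RigidForm p G h (k + 1) q) :
    formEvalOne p G h (k + 1) q (formDelta p G h (k + 1) q β) =
      -β - formDelta p G h k q (formEvalOne p G h k q β) := by
  ext1 v
  rw [formEvalOne_apply, formDelta_apply, rigidEvalOne_rigidDelta]
  rfl

theorem formEvalOne_formTail {k q : ℕ} (β : RigidForm p G h k q) :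
    formEvalOne p G h k q (formTail p G h k q β) = β := rfl

theorem formDelta_zero {q : ℕ} (β : RigidForm p G h 0 q) :
    formDelta p G h 0 q β = -formTail p G h 0 q β := by
  ext1 v
  rw [formDelta_apply, rigidDelta_zero]
  rfl

/-- Exactness for `formDelta`, with the primitive supplied by the contracting homotopy. -/
theorem eq_formDelta_of_formDelta_eq_zero {k q : ℕ} {α : RigidForm p G h (k + 1) q}
    (hα : formDelta p G h (k + 1) q α = 0) :
    formDelta p G h k q (-formEvalOne p G h k q α) = α := by
  have h1 := formEvalOne_formDelta α
  rw [hα, map_zero] at h1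
  rw [map_neg, neg_eq_iff_eq_neg]
  exact (sub_eq_zero.mp h1.symm).symm

variable (p G h) in
/-- Cochains of degree `0` are constants. -/
def rigidConstEquiv : RigidCochain p G h 0 ≃ₗ[K] K where
  toFun f := f.val Fin.elim0
  map_add' _ _ := rfl
  map_smul' _ _ := rfl
  invFun c := RigidCochain.mk (fun _ => c)
    (mem_rigidCochains_of_isRigid (IsRigid.const levelRadius_pos c) fun _ => rfl)
  left_inv f := rigidCochains_ext fun _ => congrArg f.val (Subsingleton.elim _ _)
  right_inv _ := rfl

variable (p G h) in
/-- Successive differentiation of all entries of a form with values in cochains. -/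
def formEval : (k q N : ℕ) → q + k = N →
    RigidForm p G h k q →ₗ[K] (Fin m → K) [⋀^Fin N]→ₗ[K] K
  | 0, _, _, e => (AlternatingMap.domDomCongrₗ K (finCongr e)).toLinearMap ∘ₗ
      LinearMap.compAlternatingMapₗ K (rigidConstEquiv p G h).toLinearMap
  | k + 1, q, N, e => formEval k (q + 1) N (by omega) ∘ₗ formDeriv p G h k q

theorem formEval_succ {k q N : ℕ} (e : q + (k + 1) = N) (β : RigidForm p G h (k + 1) q) :
    formEval p G h (k + 1) q N e β =
      formEval p G h k (q + 1) N (by omega) (formDeriv p G h k q β) := rfl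

theorem formEval_zero {q : ℕ} (β : RigidForm p G h 0 q) :
    formEval p G h 0 q q rfl β =
      (rigidConstEquiv p G h).toLinearMap.compAlternatingMap β := rfl

theorem formEval_formTail {k q N : ℕ} (e : q + (k + 1) = N) (β : RigidForm p G h k q) :
    formEval p G h (k + 1) q N e (formTail p G h k q β) = 0 := by
  rw [formEval_succ, formDeriv_formTail, map_zero]

/-- Differentiating `δ β` once gives the Lie action on `β` minus `δ` of the derivative of `β`. The
induction hypothesis treats the second term, `formDeriv_wedge_rigidLie` the first, and the two
occurrences of the bracket differential of the derivative cancel. -/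
theorem formEval_formDelta {k q N : ℕ} (e : q + k = N) (β : RigidForm p G h k q) :
    formEval p G h (k + 1) q (N + 1) (by omega) (formDelta p G h k q β) =
      (-1 : K) ^ k • bracketDifferential G.bilin N (formEval p G h k q N e β) -
        formEval p G h k (q + 1) (N + 1) (by omega) (bracketDifferential G.bilin q β) := by
  induction k generalizing q with
  | zero =>
    obtain rfl : q = N := e
    rw [formDelta_zero, map_neg, formEval_formTail, neg_zero, pow_zero, one_smul, eq_comm,
      sub_eq_zero]
    exact (compAlternatingMap_bracketDifferential G.bilin
      (rigidConstEquiv p G h).toLinearMap β).symm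
  | succ k ih =>
    rw [formEval_succ, formDeriv_formDelta, map_sub, ih (by omega), formEval_succ,
      formDeriv_wedge_rigidLie, map_sub, map_neg, formEval_succ, formEval_succ, pow_succ,
      mul_neg_one, AlternatingMap.neg_smul_eq]
    abel

/-- One step of a zigzag: the elements `formD β` and `δ β` have the same value up to a Lie
coboundary. -/
theorem formEval_formEvalOne_formDelta {k q N : ℕ} (e : q + k = N)
    (β : RigidForm p G h (k + 1) q) :
    formEval p G h (k + 1) q (N + 1) (by omega)
        (formEvalOne p G h (k + 1) q (formDelta p G h (k + 1) q β)) =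
      formEval p G h k (q + 1) (N + 1) (by omega)
        (formEvalOne p G h k (q + 1) (formD p G h k q β)) -
      (-1 : K) ^ k •
        bracketDifferential G.bilin N (formEval p G h k q N e (formEvalOne p G h k q β)) := by
  rw [formEvalOne_formDelta, formEvalOne_formD, map_sub, map_sub, map_neg, formEval_formDelta e,
    formEval_succ]
  abel

/-- Each of the `k` remaining alternations passes the given one at the cost of a sign. -/
theorem formEval_alternatizeUncurryFin {k q N : ℕ} (e : q + k = N)
    (g : (Fin m → K) →ₗ[K] RigidForm p G h k q) :
    formEval p G h k (q + 1) (N + 1) (by omega) (alternatizeUncurryFin g) =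
      (-1 : K) ^ k • alternatizeUncurryFin (formEval p G h k q N e ∘ₗ g) := by
  induction k generalizing q with
  | zero =>
    obtain rfl : q = N := e
    rw [pow_zero, one_smul]
    exact AlternatingMap.compAlternatingMap_alternatizeUncurryFin
      (rigidConstEquiv p G h).toLinearMap g
  | succ k ih =>
    rw [formEval_succ, formDeriv, wedge_alternatizeUncurryFin, map_neg, ih (by omega), pow_succ,
      mul_neg_one, AlternatingMap.neg_smul_eq]
    rfl

end DoubleComplex


/-! ### Partial derivatives, Euler field and contraction in the first variable -/

noncomputable section CoordinateFrame

variable {p : ℕ} {K : Type*} [NontriviallyNormedField K] [IsUltrametricDist K]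
  {m : ℕ} {G : FormalGroupLaw (unitBallRing K) m} {h : ℝ} [Fact p.Prime] [Fact (0 ≤ h)]

theorem fderiv_extendByZero {k : ℕ} {f : (Fin k → StandardGroup p G h) → K}
    {F : (Fin k → Fin m → K) → K} (hF : ∀ x, f x = F (tupleVal x))
    (x : Fin k → StandardGroup p G h) :
    fderiv K (extendByZero f) (tupleVal x) = fderiv K F (tupleVal x) :=
  ((extendByZero_eqOn hF).eventuallyEq_of_mem (eball_mem_nhds (tupleVal_mem x))).fderiv_eq

variable [CompleteSpace K]

/-- Rigid functions are differentiable. -/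
theorem RigidCochain.differentiableAt {k : ℕ} (f : RigidCochain p G h k)
    (x : Fin k → StandardGroup p G h) : DifferentiableAt K (extendByZero f.val) (tupleVal x) :=
  (isRigid_of_mem f.mem).differentiableAt (tupleVal_mem x)

theorem fderiv_extendByZero_add {k : ℕ} (f g : RigidCochain p G h k)
    (x : Fin k → StandardGroup p G h) : fderiv K (extendByZero (f + g).val) (tupleVal x) =
      fderiv K (extendByZero f.val) (tupleVal x) + fderiv K (extendByZero g.val) (tupleVal x) := by
  rw [RigidCochain.val_add, extendByZero_add, fderiv_add (f.differentiableAt x)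
    (g.differentiableAt x)]

theorem fderiv_extendByZero_smul {k : ℕ} (c : K) (f : RigidCochain p G h k)
    (x : Fin k → StandardGroup p G h) : fderiv K (extendByZero (c • f).val) (tupleVal x) =
      c • fderiv K (extendByZero f.val) (tupleVal x) := by
  rw [RigidCochain.val_smul, extendByZero_smul, fderiv_const_smul (f.differentiableAt x)]

variable (p G h) in
/-- The partial derivatives with respect to the first entry. -/
def rigidPartial (k : ℕ) :
    (Fin m → K) →ₗ[K] RigidCochain p G h (k + 1) →ₗ[K] RigidCochain p G h (k + 1) :=
  LinearMap.mk₂ K (fun v f => RigidCochain.mk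
      (fun x => fderiv K (extendByZero f.val) (tupleVal x) (singleZeroCLM K m k v))
      (mem_rigidCochains_of_isRigid ((isRigid_of_mem f.mem).fderiv.clm_comp
        (ContinuousLinearMap.apply K K (singleZeroCLM K m k v))) fun _ => rfl))
    (fun v w f => rigidCochains_ext fun x => by
      change fderiv K (extendByZero f.val) (tupleVal x) (singleZeroCLM K m k (v + w)) = _
      rw [map_add, map_add]
      rfl)
    (fun c v f => rigidCochains_ext fun x => by
      change fderiv K (extendByZero f.val) (tupleVal x) (singleZeroCLM K m k (c • v)) = _
      rw [map_smul, map_smul]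
      rfl)
    (fun v f g => rigidCochains_ext fun x => by
      change fderiv K (extendByZero (f + g).val) _ _ = _
      rw [fderiv_extendByZero_add]
      rfl)
    (fun c v f => rigidCochains_ext fun x => by
      change fderiv K (extendByZero (c • f).val) _ _ = _
      rw [fderiv_extendByZero_smul]
      rfl)

theorem rigidPartial_val {k : ℕ} (v : Fin m → K) (f : RigidCochain p G h (k + 1))
    (x : Fin (k + 1) → StandardGroup p G h) : (rigidPartial p G h k v f).val x =
      fderiv K (extendByZero f.val) (tupleVal x) (singleZeroCLM K m k v) := rfl

variable (K m) in
/-- The projection onto the first entry. -/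
def headCLM (k : ℕ) : (Fin (k + 1) → Fin m → K) →L[K] (Fin m → K) :=
  ContinuousLinearMap.proj 0

variable (K m) in
/-- The projection onto the first entry, as an endomorphism. -/
def headProj (k : ℕ) : (Fin (k + 1) → Fin m → K) →L[K] (Fin (k + 1) → Fin m → K) :=
  (singleZeroCLM K m k).comp (headCLM K m k)

theorem headProj_apply {k : ℕ} (w : Fin (k + 1) → Fin m → K) :
    headProj K m k w = Fin.cons (w 0) 0 := singleZeroCLM_apply _

theorem sub_headProj_apply {k : ℕ} (w : Fin (k + 1) → Fin m → K) :
    w - headProj K m k w = Fin.cons 0 (Fin.tail w) := by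
  rw [headProj_apply]
  funext i
  refine Fin.cases ?_ (fun i => ?_) i
  · simp
  · simp [Fin.tail]

theorem headProj_headProj {k : ℕ} (w : Fin (k + 1) → Fin m → K) :
    headProj K m k (headProj K m k w) = headProj K m k w := by
  rw [headProj_apply, headProj_apply, Fin.cons_zero]

theorem norm_headProj_le {k : ℕ} : ‖headProj K m k‖ ≤ 1 := by
  refine ContinuousLinearMap.opNorm_le_bound _ zero_le_one fun w => ?_
  rw [one_mul, headProj_apply]
  refine (pi_norm_le_iff_of_nonneg (norm_nonneg _)).mpr fun i => ?_
  refine Fin.cases ?_ (fun i => ?_) i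
  · exact norm_le_pi_norm w 0
  · simp

theorem norm_one_sub_headProj_le {k : ℕ} : ‖1 - headProj K m k‖ ≤ 1 := by
  refine ContinuousLinearMap.opNorm_le_bound _ zero_le_one fun w => ?_
  rw [one_mul, sub_apply, one_apply_eq_self, sub_headProj_apply]
  refine (pi_norm_le_iff_of_nonneg (norm_nonneg _)).mpr fun i => ?_
  refine Fin.cases ?_ (fun i => ?_) i
  · simp
  · exact norm_le_pi_norm w i.succ

theorem isRigid_fderiv_headProj {k : ℕ} {F : (Fin (k + 1) → Fin m → K) → K}
    (hF : IsRigid K (levelRadius p h) F) :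
    IsRigid K (levelRadius p h) fun w => fderiv K F w (headProj K m k w) :=
  IsRigid.bilinear (ContinuousLinearMap.id K ((Fin (k + 1) → Fin m → K) →L[K] K)) hF.fderiv
    (IsRigid.clm levelRadius_pos (headProj K m k))

variable (p G h) in
/-- The derivative along the Euler vector field of the first entry. -/
def rigidEuler (k : ℕ) : RigidCochain p G h (k + 1) →ₗ[K] RigidCochain p G h (k + 1) where
  toFun f := RigidCochain.mk
    (fun x => fderiv K (extendByZero f.val) (tupleVal x) (headProj K m k (tupleVal x)))
    (mem_rigidCochains_of_isRigid (isRigid_fderiv_headProj (isRigid_of_mem f.mem)) fun _ => rfl)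
  map_add' f g := rigidCochains_ext fun x => by
    change fderiv K (extendByZero (f + g).val) _ _ = _
    rw [fderiv_extendByZero_add]
    rfl
  map_smul' c f := rigidCochains_ext fun x => by
    change fderiv K (extendByZero (c • f).val) _ _ = _
    rw [fderiv_extendByZero_smul]
    rfl

theorem rigidEuler_val {k : ℕ} (f : RigidCochain p G h (k + 1))
    (x : Fin (k + 1) → StandardGroup p G h) : (rigidEuler p G h k f).val x =
      fderiv K (extendByZero f.val) (tupleVal x) (headProj K m k (tupleVal x)) := rfl

theorem sum_smul_single (v : Fin m → K) : ∑ j, v j • (Pi.single j 1 : Fin m → K) = v := by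
  conv_rhs => rw [pi_eq_sum_univ' v]

variable (p G h) in
/-- Contraction of a `1`-form with the Euler vector field of the first entry. -/
def rigidContraction (k : ℕ) :
    ((Fin m → K) →ₗ[K] RigidCochain p G h (k + 1)) →ₗ[K] RigidCochain p G h (k + 1) where
  toFun φ := RigidCochain.mk (fun x => (φ (x 0).val).val x) (by
    -- By linearity of `φ` the value is a finite sum of coordinates times rigid functions.
    refine mem_rigidCochains_of_isRigid (F := fun w => ∑ j : Fin m,
      headCLM K m k w j * extendByZero (φ (Pi.single j 1)).val w) ?_ fun x => ?_
    · refine IsRigid.sum _ levelRadius_pos fun j _ => ?_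
      exact IsRigid.bilinear (ContinuousLinearMap.mul K K) (IsRigid.clm levelRadius_pos
        ((ContinuousLinearMap.proj (R := K) (φ := fun _ : Fin m => K) j).comp (headCLM K m k)))
        (isRigid_of_mem (φ (Pi.single j 1)).mem)
    · conv_lhs => rw [← sum_smul_single (x 0).val, map_sum, ← RigidCochain.valHom_apply, map_sum,
        Finset.sum_apply]
      refine Finset.sum_congr rfl fun j _ => ?_
      rw [map_smul, map_smul, extendByZero_tupleVal]
      rfl)
  map_add' φ ψ := rfl
  map_smul' c φ := rfl

theorem rigidContraction_val {k : ℕ} (φ : (Fin m → K) →ₗ[K] RigidCochain p G h (k + 1))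
    (x : Fin (k + 1) → StandardGroup p G h) :
    (rigidContraction p G h k φ).val x = (φ (x 0).val).val x := rfl

theorem rigidPartial_comm {k : ℕ} (v w : Fin m → K) (f : RigidCochain p G h (k + 1)) :
    rigidPartial p G h k v (rigidPartial p G h k w f) =
      rigidPartial p G h k w (rigidPartial p G h k v f) := by
  refine rigidCochains_ext fun x => ?_
  have hA := (isRigid_of_mem f.mem).analyticOnNhd _ (tupleVal_mem x)
  have h1 : ∀ v w : Fin m → K,
      (rigidPartial p G h k v (rigidPartial p G h k w f)).val x =
        fderiv K (fderiv K (extendByZero f.val)) (tupleVal x) (singleZeroCLM K m k v)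
          (singleZeroCLM K m k w) := fun v w => by
    rw [rigidPartial_val, fderiv_extendByZero (F := fun w' => fderiv K (extendByZero f.val) w' (singleZeroCLM K m k w))
        (fun y => rigidPartial_val w f y),
      (hA.fderiv.differentiableAt.hasFDerivAt.clm_apply (hasFDerivAt_const _ _)).fderiv]
    simp
  rw [h1, h1]
  exact (hA.contDiffAt (n := ⊤)).isSymmSndFDerivAt_of_omega _ _

/-- The Euler field is linear and its derivative in the direction `v` is `v`; this commutator
produces the shift of `c` in the Poincaré lemma. -/
theorem rigidPartial_rigidEuler {k : ℕ} (v : Fin m → K) (f : RigidCochain p G h (k + 1)) :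
    rigidPartial p G h k v (rigidEuler p G h k f) =
      rigidEuler p G h k (rigidPartial p G h k v f) + rigidPartial p G h k v f := by
  refine rigidCochains_ext fun x => ?_
  have hA := (isRigid_of_mem f.mem).analyticOnNhd _ (tupleVal_mem x)
  have hsymm := (hA.contDiffAt (n := ⊤)).isSymmSndFDerivAt_of_omega (singleZeroCLM K m k v)
    (headProj K m k (tupleVal x))
  rw [rigidPartial_val, fderiv_extendByZero (F := fun w => fderiv K (extendByZero f.val) w (headProj K m k w))
      (fun y => rigidEuler_val f y), RigidCochain.val_add,
    Pi.add_apply, rigidEuler_val, fderiv_extendByZero (F := fun w => fderiv K (extendByZero f.val) w (singleZeroCLM K m k v))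
      (fun y => rigidPartial_val v f y),
    (hA.fderiv.differentiableAt.hasFDerivAt.clm_apply (hasFDerivAt_const _ _)).fderiv,
    (hA.fderiv.differentiableAt.hasFDerivAt.clm_apply (headProj K m k).hasFDerivAt).fderiv,
    rigidPartial_val]
  have h1 : headProj K m k (singleZeroCLM K m k v) = singleZeroCLM K m k v := by
    rw [headProj_apply, singleZeroCLM_apply, Fin.cons_zero]
  simp [h1, hsymm, add_comm]

theorem rigidPartial_rigidContraction {k : ℕ} (v : Fin m → K)
    (φ : (Fin m → K) →ₗ[K] RigidCochain p G h (k + 1)) :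
    rigidPartial p G h k v (rigidContraction p G h k φ) =
      rigidContraction p G h k (rigidPartial p G h k v ∘ₗ φ) + φ v := by
  refine rigidCochains_ext fun x => ?_
  have h0 : ∀ (φ : (Fin m → K) →ₗ[K] RigidCochain p G h (k + 1))
      (x : Fin (k + 1) → StandardGroup p G h) (u : Fin m → K),
      (φ u).val x = ∑ j, u j * extendByZero (φ (Pi.single j 1)).val (tupleVal x) := fun φ x u => by
    conv_lhs => rw [← sum_smul_single u, map_sum, ← RigidCochain.valHom_apply, map_sum,
        Finset.sum_apply]
    refine Finset.sum_congr rfl fun j _ => ?_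
    rw [map_smul, map_smul, extendByZero_tupleVal]
    rfl
  have h1 : ∀ j : Fin m, HasFDerivAt (fun w : Fin (k + 1) → Fin m → K => w 0 j)
      ((ContinuousLinearMap.proj (R := K) (φ := fun _ : Fin m => K) j).comp (headCLM K m k))
      (tupleVal x) := fun j =>
    ((ContinuousLinearMap.proj (R := K) (φ := fun _ : Fin m => K) j).comp
      (headCLM K m k)).hasFDerivAt
  have h2 := HasFDerivAt.fun_sum (u := Finset.univ) fun j _ =>
    (h1 j).mul ((φ (Pi.single j 1)).differentiableAt x).hasFDerivAt
  have h3 : fderiv K (fun w => ∑ j, w 0 j * extendByZero (φ (Pi.single j 1)).val w) (tupleVal x) =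
    _ := h2.fderiv
  rw [rigidPartial_val, fderiv_extendByZero (f := (rigidContraction p G h k φ).val)
      (F := fun w => ∑ j, w 0 j * extendByZero (φ (Pi.single j 1)).val w)
      (fun y => h0 φ y (y 0).val), h3,
    RigidCochain.val_add, Pi.add_apply, rigidContraction_val, h0, h0]
  rw [sum_apply, ← Finset.sum_add_distrib]
  refine Finset.sum_congr rfl fun j _ => ?_
  rw [extendByZero_tupleVal, extendByZero_tupleVal]
  simp [headCLM, singleZeroCLM_apply, rigidPartial_val, tupleVal, mul_comm]

end CoordinateFrame


/-! ### The Poincaré lemma on the open polydisc -/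

noncomputable section PoincareLemma

open AlternatingMap (wedge wedge_eq wedge_apply compAlternatingMap_wedge alternatizeUncurryFin
  alternatizeUncurryFinLM alternatizeUncurryFin_apply curryLeft_alternatizeUncurryFin)

variable {p : ℕ} {K : Type*} [NontriviallyNormedField K] [IsUltrametricDist K]
  {m : ℕ} {G : FormalGroupLaw (unitBallRing K) m} {h : ℝ} [Fact p.Prime] [Fact (0 ≤ h)]
  [CompleteSpace K]

theorem extendByZero_rigidEuler_add_smul {k : ℕ} (c : ℕ) (f : RigidCochain p G h (k + 1))
    (x : Fin (k + 1) → StandardGroup p G h) :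
    (rigidEuler p G h k f + (c : K) • f).val x =
      fderiv K (extendByZero f.val) (tupleVal x) (headProj K m k (tupleVal x)) +
        (c : K) • extendByZero f.val (tupleVal x) := by
  rw [extendByZero_tupleVal]
  rfl

theorem eq_rigidTail_of_rigidEuler_eq_zero [CharZero K] {k : ℕ} {c : ℕ}
    {f : RigidCochain p G h (k + 1)} (hf : rigidEuler p G h k f + (c : K) • f = 0) :
    f = rigidTail p G h k (rigidEvalOne p G h k f) := by
  obtain ⟨q, hq⟩ := isRigid_of_mem f.mem
  refine rigidCochains_ext fun x => ?_
  have h1 := hq.eq_of_euler_eq_zero (P := headProj K m k) norm_headProj_le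
    norm_one_sub_headProj_le headProj_headProj c (fun w hw => by
      obtain ⟨y, rfl⟩ := exists_tupleVal_eq (G := G) hw
      rw [← extendByZero_rigidEuler_add_smul, hf]
      rfl) (tupleVal_mem x)
  rw [extendByZero_tupleVal, sub_headProj_apply] at h1
  rw [h1, rigidTail_apply, rigidEvalOne_apply, ← extendByZero_tupleVal f.val, tupleVal_cons]
  rfl

/-- Such an `f` does not depend on the first variable. Where that variable is the identity the Euler
field vanishes, so the equation reads `c f = 0` there. -/
theorem rigidEuler_add_smul_injective [CharZero K] {k : ℕ} {c : ℕ} (hc : c ≠ 0)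
    {f : RigidCochain p G h (k + 1)} (hf : rigidEuler p G h k f + (c : K) • f = 0) : f = 0 := by
  have h1 := eq_rigidTail_of_rigidEuler_eq_zero hf
  refine rigidCochains_ext fun x => ?_
  have h2 := congrArg (fun g : RigidCochain p G h (k + 1) => g.val (Fin.cons 1 (Fin.tail x))) hf
  change _ = (0 : K) at h2
  have h3 : headProj K m k
      (tupleVal (Fin.cons 1 (Fin.tail x) : Fin (k + 1) → StandardGroup p G h)) = 0 := by
    rw [headProj_apply]
    funext i
    refine Fin.cases ?_ (fun i => ?_) i <;> rfl
  rw [extendByZero_rigidEuler_add_smul, h3, map_zero, zero_add, extendByZero_tupleVal,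
    smul_eq_zero] at h2
  rw [h1]
  exact h2.resolve_left (Nat.cast_ne_zero.mpr hc)

theorem exists_rigidEuler_add_smul_eq (hnat : ∀ n : ℕ, n ≠ 0 → (n : K) ≠ 0 ∧ ‖(n : K)⁻¹‖ ≤ n)
    {k : ℕ} {c : ℕ} (hc : c ≠ 0) (f : RigidCochain p G h (k + 1)) :
    ∃ g, rigidEuler p G h k g + (c : K) • g = f := by
  obtain ⟨q, hq⟩ := isRigid_of_mem f.mem
  obtain ⟨g, r, hg, hgf⟩ := hq.exists_euler_inverse hnat (P := headProj K m k) norm_headProj_le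
    norm_one_sub_headProj_le headProj_headProj hc
  refine ⟨RigidCochain.mk (fun x => g (tupleVal x)) (mem_rigidCochains_of_isRigid ⟨r, hg⟩
    fun _ => rfl), rigidCochains_ext fun x => ?_⟩
  have h1 := hgf _ (tupleVal_mem x)
  rw [extendByZero_tupleVal] at h1
  rw [extendByZero_rigidEuler_add_smul, RigidCochain.val_mk, fderiv_extendByZero (F := g)
    (fun _ => rfl), extendByZero_tupleVal, h1]

variable (p G h) in
/-- The exterior derivative with respect to the first entry. -/
def formPartial (k q : ℕ) : RigidForm p G h (k + 1) q →ₗ[K] RigidForm p G h (k + 1) (q + 1) :=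
  wedge (rigidPartial p G h k) q

theorem formPartial_formPartial {k q : ℕ} (β : RigidForm p G h (k + 1) q) :
    formPartial p G h k (q + 1) (formPartial p G h k q β) = 0 := by
  have h1 := AlternatingMap.alternatizeUncurryFin_alternatizeUncurryFinLM_comp_of_symmetric
    (f := (AlternatingMap.actLM (rigidPartial p G h k) q ∘ₗ
      AlternatingMap.actLM (rigidPartial p G h k) q β).flip) fun v w => by
    ext1 u
    exact rigidPartial_comm v w (β u)
  refine Eq.trans ?_ h1
  rw [formPartial, wedge_eq]
  congr 1
  refine LinearMap.ext fun v => ?_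
  exact AlternatingMap.compAlternatingMap_alternatizeUncurryFin _ _

/-- The linear map obtained from a form by fixing all arguments but the first. -/
def formInsert {k q : ℕ} (β : RigidForm p G h k (q + 1)) (v : Fin q → Fin m → K) :
    (Fin m → K) →ₗ[K] RigidCochain p G h k where
  toFun u := β (Matrix.vecCons u v)
  map_add' u w := β.map_vecCons_add v u w
  map_smul' c u := β.map_vecCons_smul v c u

theorem rigidContraction_formInsert_val {k q : ℕ} (β : RigidForm p G h (k + 1) (q + 1))
    (v : Fin q → Fin m → K) (x : Fin (k + 1) → StandardGroup p G h) :
    (rigidContraction p G h k (formInsert β v)).val x = (β.curryLeft (x 0).val v).val x := rfl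

/-- Contraction of forms with the Euler vector field of the first entry. -/
def formContraction {k q : ℕ} (β : RigidForm p G h (k + 1) (q + 1)) :
    RigidForm p G h (k + 1) q where
  toFun v := rigidContraction p G h k (formInsert β v)
  map_update_add' v i y z := rigidCochains_ext fun x => by
    rw [RigidCochain.val_add, Pi.add_apply, rigidContraction_formInsert_val,
      rigidContraction_formInsert_val, rigidContraction_formInsert_val,
      AlternatingMap.map_update_add]
    rfl
  map_update_smul' v i c y := rigidCochains_ext fun x => by
    rw [RigidCochain.val_smul, Pi.smul_apply, rigidContraction_formInsert_val,
      rigidContraction_formInsert_val, AlternatingMap.map_update_smul]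
    rfl
  map_eq_zero_of_eq' v i j hv hij := rigidCochains_ext fun x => by
    rw [rigidContraction_formInsert_val, AlternatingMap.map_eq_zero_of_eq _ v hv hij]

theorem formContraction_apply {k q : ℕ} (β : RigidForm p G h (k + 1) (q + 1))
    (v : Fin q → Fin m → K) :
    formContraction β v = rigidContraction p G h k (formInsert β v) := rfl

variable (p G h) in
/-- Evaluation of rigid cochains at a point. -/
def rigidEvalAt {k : ℕ} (x : Fin k → StandardGroup p G h) : RigidCochain p G h k →ₗ[K] K :=
  LinearMap.proj x ∘ₗ RigidCochain.valHom p G h k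

theorem rigidEvalAt_apply {k : ℕ} (x : Fin k → StandardGroup p G h) (f : RigidCochain p G h k) :
    rigidEvalAt p G h x f = f.val x := rfl

/-- Cartan's formula for a closed form. -/
theorem formPartial_formContraction {k q : ℕ} (β : RigidForm p G h (k + 1) (q + 1))
    (hβ : formPartial p G h k (q + 1) β = 0) :
    formPartial p G h k q (formContraction β) =
      (rigidEuler p G h k + ((q + 1 : ℕ) : K) • LinearMap.id).compAlternatingMap β := by
  ext1 v
  refine rigidCochains_ext fun x => ?_
  -- The factor `q + 1` arises here: alternating `β.curryLeft` reproduces `β` that many times.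
  have h1 := congrArg (fun ω : RigidForm p G h (k + 1) (q + 1) => rigidEvalAt p G h x (ω v))
    (AlternatingMap.alternatizeUncurryFin_curryLeft β)
  have h2 := congrArg (fun ω : RigidForm p G h (k + 1) (q + 1) => rigidEvalAt p G h x (ω v))
    (curryLeft_alternatizeUncurryFin (AlternatingMap.actLM (rigidPartial p G h k) (q + 1) β)
      (x 0).val)
  -- Closedness turns the derivative of `β` in the direction `x 0`, that is, the Euler derivative at
  -- `x`, into an alternating sum of derivatives of contracted values.
  rw [← wedge_eq, ← formPartial, hβ] at h2
  simp only [AlternatingMap.sub_apply, map_sub] at h2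
  replace h2 := sub_eq_zero.mp h2.symm
  rw [alternatizeUncurryFin_apply, map_sum] at h1 h2
  change rigidEvalAt p G h x (formPartial p G h k q (formContraction β) v) =
    rigidEvalAt p G h x (rigidEuler p G h k (β v) + ((q + 1 : ℕ) : K) • β v)
  have h3 : rigidEvalAt p G h x (((q + 1 : ℕ) : K) • β v) =
      rigidEvalAt p G h x (((q + 1 : ℕ) • β) v) := by
    rw [Nat.cast_smul_eq_nsmul]
    rfl
  have h4 : rigidEvalAt p G h x (rigidEuler p G h k (β v)) =
    rigidEvalAt p G h x
      (AlternatingMap.actLM (rigidPartial p G h k) (q + 1) β (x 0).val v) := rfl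
  rw [map_add, h3, h4, h2]
  refine Eq.trans ?_ (congrArg _ h1)
  rw [formPartial, wedge_apply, map_sum, ← Finset.sum_add_distrib]
  refine Finset.sum_congr rfl fun i _ => ?_
  rw [formContraction_apply, rigidPartial_rigidContraction, smul_add, map_add]
  rfl

/-- The coefficients are divided by the operator `L (q + 1)` before contracting. The quotient `Ω` is
still closed because the exterior derivative intertwines `L (q + 1)` with the injective `L (q + 2)`;
Cartan's formula for `Ω` then returns `β`. -/
theorem exists_formPartial_eq [CharZero K]
    (hnat : ∀ n : ℕ, n ≠ 0 → (n : K) ≠ 0 ∧ ‖(n : K)⁻¹‖ ≤ n) {k q : ℕ}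
    (β : RigidForm p G h (k + 1) (q + 1)) (hβ : formPartial p G h k (q + 1) β = 0) :
    ∃ γ, formPartial p G h k q γ = β := by
  let L : ℕ → RigidCochain p G h (k + 1) →ₗ[K] RigidCochain p G h (k + 1) := fun c =>
    rigidEuler p G h k + (c : K) • LinearMap.id
  have hinj : ∀ c, c ≠ 0 → ∀ f, L c f = 0 → f = 0 := fun c hc f hf =>
    rigidEuler_add_smul_injective hc hf
  let S := LinearEquiv.ofBijective (L (q + 1))
    ⟨(injective_iff_map_eq_zero _).mpr (hinj (q + 1) (by omega)),
      exists_rigidEuler_add_smul_eq hnat (by omega)⟩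
  let Ω := S.symm.toLinearMap.compAlternatingMap β
  have hΩ : (L (q + 1)).compAlternatingMap Ω = β := by
    ext1 v
    exact S.apply_symm_apply (β v)
  have hcl : formPartial p G h k (q + 1) Ω = 0 := by
    have h1 : (L (q + 2)).compAlternatingMap (formPartial p G h k (q + 1) Ω) =
        formPartial p G h k (q + 1) ((L (q + 1)).compAlternatingMap Ω) :=
      compAlternatingMap_wedge (fun v f => by
        simp only [L, LinearMap.add_apply, LinearMap.smul_apply, LinearMap.id_apply, map_add,
          rigidPartial_rigidEuler, map_smul]
        rw [add_assoc, show q + 2 = (q + 1) + 1 from rfl, Nat.cast_succ (q + 1), add_smul, one_smul,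
          add_comm (_ • _)]) Ω
    rw [hΩ, hβ] at h1
    ext1 v
    exact hinj (q + 2) (by omega) _ (congrArg (fun ω : RigidForm p G h (k + 1) (q + 2) => ω v) h1)
  exact ⟨formContraction Ω, (formPartial_formContraction Ω hcl).trans hΩ⟩

end PoincareLemma


/-! ### From the invariant frame to the coordinate frame -/

noncomputable section FrameChange

open AlternatingMap (wedge wedge_eq wedge_apply bracketDifferential bracketDifferential_zero
  bracketDifferential_apply)

theorem AlternatingMap.eq_sum_prod_smul {K N : Type*} [CommRing K] [AddCommGroup N] [Module K N]
    {m q : ℕ} (f : (Fin m → K) [⋀^Fin q]→ₗ[K] N) (v : Fin q → Fin m → K) :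
    f v = ∑ r : Fin q → Fin m, (∏ i, v i (r i)) • f fun i => Pi.single (r i) 1 := by
  have h1 : v = fun i => ∑ j, v i j • (Pi.single j 1 : Fin m → K) :=
    funext fun i => pi_eq_sum_univ' (v i)
  conv_lhs => rw [h1]
  refine (f.toMultilinearMap.map_sum _).trans ?_
  exact Finset.sum_congr rfl fun r _ => f.toMultilinearMap.map_smul_univ _ _

variable {p : ℕ} {K : Type*} [NontriviallyNormedField K] [IsUltrametricDist K]
  {m : ℕ} {G : FormalGroupLaw (unitBallRing K) m} {h : ℝ}

/-- Alternating forms in finite dimension are continuous. -/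
def AlternatingMap.toContinuousForm {q : ℕ} (f : (Fin m → K) [⋀^Fin q]→ₗ[K] K) :
    (Fin m → K) [⋀^Fin q]→L[K] K :=
  f.mkContinuous (∑ r : Fin q → Fin m, ‖f fun i => Pi.single (r i) 1‖) fun v => by
    rw [f.eq_sum_prod_smul v, Finset.sum_mul]
    refine (norm_sum_le _ _).trans (Finset.sum_le_sum fun r _ => ?_)
    rw [norm_smul, mul_comm, norm_prod]
    gcongr with i
    exact norm_le_pi_norm (v i) (r i)

variable [Fact p.Prime] [Fact (0 ≤ h)] [CompleteSpace K]

theorem mul_mem_rigidCochains {k : ℕ} {f g : (Fin k → StandardGroup p G h) → K}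
    (hf : f ∈ rigidCochains p G h k) (hg : g ∈ rigidCochains p G h k) :
    (fun x => f x * g x) ∈ rigidCochains p G h k :=
  mem_rigidCochains_of_isRigid
    (IsRigid.bilinear (ContinuousLinearMap.mul K K) (isRigid_of_mem hf) (isRigid_of_mem hg))
    fun x => by rw [extendByZero_tupleVal, extendByZero_tupleVal]; rfl

theorem prod_mem_rigidCochains {k : ℕ} {ι : Type*} (s : Finset ι)
    {f : ι → (Fin k → StandardGroup p G h) → K} (hf : ∀ i, f i ∈ rigidCochains p G h k) :
    (fun x => ∏ i ∈ s, f i x) ∈ rigidCochains p G h k := by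
  classical
  induction s using Finset.induction_on with
  | empty =>
    exact mem_rigidCochains_of_isRigid (IsRigid.const levelRadius_pos 1) fun x => by simp
  | insert a s ha ih =>
    simp only [Finset.prod_insert ha]
    exact mul_mem_rigidCochains (hf a) ih

/-- Pull-back of forms by a matrix of rigid functions. -/
def pullForm {k q : ℕ} {A : (Fin k → StandardGroup p G h) → (Fin m → K) →ₗ[K] (Fin m → K)}
    (hA : ∀ v j, (fun x => A x v j) ∈ rigidCochains p G h k) (Ω : RigidForm p G h k q) :
    RigidForm p G h k q where
  toFun v := RigidCochain.mk (fun x => (Ω fun i => A x (v i)).val x) (by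
    have h1 : (fun x => (Ω fun i => A x (v i)).val x) = ∑ r : Fin q → Fin m,
        fun x => (∏ i, A x (v i) (r i)) * (Ω fun i => Pi.single (r i) 1).val x := by
      funext x
      rw [Ω.eq_sum_prod_smul, ← rigidEvalAt_apply, map_sum, Finset.sum_apply]
      exact Finset.sum_congr rfl fun r _ => map_smul _ _ _
    rw [h1]
    exact Submodule.sum_mem _ fun r _ => mul_mem_rigidCochains
      (prod_mem_rigidCochains _ fun i => hA (v i) (r i)) (RigidCochain.mem _))
  map_update_add' v i y z := rigidCochains_ext fun x =>
    (((rigidEvalAt p G h x).compAlternatingMap Ω).compLinearMap (A x)).map_update_add v i y z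
  map_update_smul' v i c y := rigidCochains_ext fun x =>
    (((rigidEvalAt p G h x).compAlternatingMap Ω).compLinearMap (A x)).map_update_smul v i c y
  map_eq_zero_of_eq' v i j hv hij := rigidCochains_ext fun x =>
    (((rigidEvalAt p G h x).compAlternatingMap Ω).compLinearMap (A x)).map_eq_zero_of_eq v hv hij

theorem pullForm_val {k q : ℕ} {A : (Fin k → StandardGroup p G h) → (Fin m → K) →ₗ[K] (Fin m → K)}
    (hA : ∀ v j, (fun x => A x v j) ∈ rigidCochains p G h k) (Ω : RigidForm p G h k q)
    (v : Fin q → Fin m → K) (x : Fin k → StandardGroup p G h) :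
    (pullForm hA Ω v).val x = (Ω fun i => A x (v i)).val x := rfl

theorem pullForm_pullForm {k q : ℕ}
    {A B : (Fin k → StandardGroup p G h) → (Fin m → K) →ₗ[K] (Fin m → K)}
    (hA : ∀ v j, (fun x => A x v j) ∈ rigidCochains p G h k)
    (hB : ∀ v j, (fun x => B x v j) ∈ rigidCochains p G h k)
    (hAB : ∀ x v, B x (A x v) = v) (Ω : RigidForm p G h k q) :
    pullForm hA (pullForm hB Ω) = Ω := by
  ext1 v
  refine rigidCochains_ext fun x => ?_
  rw [pullForm_val, pullForm_val]
  simp only [hAB]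

/-- The frame of right invariant vector fields along the first entry. -/
def tangentFrame {k : ℕ} (x : Fin (k + 1) → StandardGroup p G h) :
    (Fin m → K) →ₗ[K] (Fin m → K) :=
  -(G.tangent (x 0).val).toLinearMap

/-- The inverse of the frame of right invariant vector fields. -/
def tangentFrameInv {k : ℕ} (x : Fin (k + 1) → StandardGroup p G h) :
    (Fin m → K) →ₗ[K] (Fin m → K) :=
  -(Ring.inverse (G.tangent (x 0).val)).toLinearMap

theorem isContractive_headCLM {k : ℕ} : IsContractive K (levelRadius p h) (headCLM K m k) :=
  IsContractive.clm levelRadius_pos _ (ContinuousLinearMap.opNorm_le_bound _ zero_le_one fun w => by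
    rw [one_mul]
    exact norm_le_pi_norm w 0)

theorem mem_rigidCochains_of_clm {k : ℕ} {T : (Fin m → K) → (Fin m → K) →L[K] (Fin m → K)}
    (hT : IsRigid K (levelRadius p h) T) (v : Fin m → K) (j : Fin m) :
    (fun x : Fin (k + 1) → StandardGroup p G h => (-(T (x 0).val).toLinearMap) v j) ∈
      rigidCochains p G h (k + 1) :=
  mem_rigidCochains_of_isRigid ((hT.comp levelRadius_le_one isContractive_headCLM).clm_comp
    (-((ContinuousLinearMap.proj (R := K) (φ := fun _ : Fin m => K) j).comp
      (ContinuousLinearMap.apply K (Fin m → K) v)))) fun _ => rfl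

/-- The derivative of the contractive map `G`, minus its value at the origin, is contractive, and
the tangent map at the origin is `1`. -/
theorem FormalGroupLaw.isContractive_one_sub_tangent (G : FormalGroupLaw (unitBallRing K) m)
    {R : ℝ≥0∞} (h0 : 0 < R) (hR : R ≤ 1) : IsContractive K R fun y => 1 - G.tangent y := by
  have h1 := (G.isContractive_mulMap h0 hR).fderiv_sub
  have h2 : IsContractive K R (ContinuousLinearMap.inr K (Fin m → K) (Fin m → K)) :=
    IsContractive.clm h0 _ (ContinuousLinearMap.opNorm_le_bound _ zero_le_one fun v => by
      simp [Prod.norm_def])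
  have h3 := h1.comp hR h2
  let L : (((Fin m → K) × (Fin m → K)) →L[K] (Fin m → K)) →L[K] (Fin m → K) →L[K] (Fin m → K) :=
    -(ContinuousLinearMap.compL K _ _ _).flip (ContinuousLinearMap.inl K _ _)
  have hL : ‖L‖ ≤ 1 := by
    refine ContinuousLinearMap.opNorm_le_bound _ zero_le_one fun A => ?_
    refine ContinuousLinearMap.opNorm_le_bound _ (by positivity) fun v => ?_
    have h4 := A.le_opNorm (v, 0)
    simpa [L, Prod.norm_def] using h4
  refine IsContractive.congr ((IsContractive.clm h0 L hL).comp hR h3) fun y _ => ?_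
  have hLT : ∀ z, L (fderiv K G.mulMap (0, z)) = -(G.tangent z) := fun z => rfl
  have h5 : L (fderiv K G.mulMap (0, y) - fderiv K G.mulMap (0, 0)) = 1 - G.tangent y := by
    rw [map_sub, hLT, hLT, G.tangent_zero]
    abel
  exact h5

theorem FormalGroupLaw.norm_one_sub_tangent_lt (G : FormalGroupLaw (unitBallRing K) m)
    {y : Fin m → K} (hy : ‖y‖ < 1) : ‖1 - G.tangent y‖ < 1 := by
  have h1 : y ∈ Metric.eball (0 : Fin m → K) 1 := by
    rw [mem_eball_zero_iff, ← ofReal_norm]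
    exact ENNReal.ofReal_lt_one.mpr hy
  exact ((G.isContractive_one_sub_tangent one_pos le_rfl).norm_apply_le le_rfl h1).trans_lt hy

theorem FormalGroupLaw.isUnit_tangent (G : FormalGroupLaw (unitBallRing K) m)
    {y : Fin m → K} (hy : ‖y‖ < 1) : IsUnit (G.tangent y) := by
  have h1 := isUnit_one_sub_of_norm_lt_one (G.norm_one_sub_tangent_lt hy)
  rwa [sub_sub_cancel] at h1

/-- The geometric series composed with the contractive map `1 - G.tangent y` converges on the same
ball, so the dual frame is rigid too. -/
theorem FormalGroupLaw.isRigid_inverse_tangent (G : FormalGroupLaw (unitBallRing K) m)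
    {R : ℝ≥0∞} (h0 : 0 < R) (hR : R ≤ 1) : IsRigid K R fun y => Ring.inverse (G.tangent y) := by
  have h1 : IsRigid K R fun N : (Fin m → K) →L[K] (Fin m → K) => Ring.inverse (1 - N) :=
    ⟨_, (hasFPowerSeriesOnBall_inverse_one_sub K ((Fin m → K) →L[K] (Fin m → K))).mono h0 hR⟩
  refine (h1.comp hR (G.isContractive_one_sub_tangent h0 hR)).congr fun y _ => ?_
  exact congrArg Ring.inverse (sub_sub_cancel _ _)

theorem tangentFrame_mem {k : ℕ} (v : Fin m → K) (j : Fin m) :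
    (fun x : Fin (k + 1) → StandardGroup p G h => tangentFrame x v j) ∈
      rigidCochains p G h (k + 1) :=
  mem_rigidCochains_of_clm (G.isRigid_tangent levelRadius_pos levelRadius_le_one) v j

theorem tangentFrameInv_mem {k : ℕ} (v : Fin m → K) (j : Fin m) :
    (fun x : Fin (k + 1) → StandardGroup p G h => tangentFrameInv x v j) ∈
      rigidCochains p G h (k + 1) :=
  mem_rigidCochains_of_clm (G.isRigid_inverse_tangent levelRadius_pos levelRadius_le_one) v j

theorem tangentFrame_tangentFrameInv {k : ℕ} (x : Fin (k + 1) → StandardGroup p G h)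
    (v : Fin m → K) : tangentFrame x (tangentFrameInv x v) = v := by
  have h1 := Ring.mul_inverse_cancel _ (G.isUnit_tangent (x 0).norm_val_lt_one)
  change -(G.tangent (x 0).val (-(Ring.inverse (G.tangent (x 0).val) v))) = v
  rw [map_neg, neg_neg]
  exact congrArg (fun A : (Fin m → K) →L[K] (Fin m → K) => A v) h1

theorem tangentFrameInv_tangentFrame {k : ℕ} (x : Fin (k + 1) → StandardGroup p G h)
    (v : Fin m → K) : tangentFrameInv x (tangentFrame x v) = v := by
  have h1 := Ring.inverse_mul_cancel _ (G.isUnit_tangent (x 0).norm_val_lt_one)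
  change -(Ring.inverse (G.tangent (x 0).val) (-(G.tangent (x 0).val v))) = v
  rw [map_neg, neg_neg]
  exact congrArg (fun A : (Fin m → K) →L[K] (Fin m → K) => A v) h1

theorem rigidLie_eq_rigidPartial {k : ℕ} (v : Fin m → K) (f : RigidCochain p G h (k + 1))
    (x : Fin (k + 1) → StandardGroup p G h) :
    (rigidLie p G h k v f).val x = (rigidPartial p G h k (tangentFrame x v) f).val x := by
  rw [rigidLie_eq_fderiv, rigidPartial_val]
  change _ = fderiv K _ _ (singleZeroCLM K m k (-(G.tangent (x 0).val v)))
  rw [map_neg, map_neg]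

/-- The value of a rigid function along the first entry. -/
theorem rigidPartial_val_eq {k : ℕ} (v : Fin m → K) (f : RigidCochain p G h (k + 1))
    (x : Fin (k + 1) → StandardGroup p G h) {F : (Fin m → K) → K}
    (hF : ∀ z : StandardGroup p G h, f.val (Fin.cons z (Fin.tail x)) = F z.val) :
    (rigidPartial p G h k v f).val x = fderiv K F (x 0).val v := by
  have hx : (Fin.cons (x 0).val (tupleVal (Fin.tail x)) : Fin (k + 1) → Fin m → K) = tupleVal x :=
    by rw [← tupleVal_cons, Fin.cons_self_tail]
  have h1 : DifferentiableAt K (extendByZero f.val)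
      (Fin.cons (x 0).val (tupleVal (Fin.tail x))) := by
    rw [hx]
    exact f.differentiableAt x
  have h2 := h1.hasFDerivAt.comp (x 0).val (hasFDerivAt_cons (x 0).val (tupleVal (Fin.tail x)))
  have h3 : F =ᶠ[𝓝 (x 0).val] extendByZero f.val ∘ fun z => Fin.cons z (tupleVal (Fin.tail x)) := by
    filter_upwards [eball_mem_nhds (x 0).val_mem_eball] with z hz
    obtain ⟨y, rfl⟩ := exists_val_eq (G := G) hz
    rw [← hF, Function.comp_apply, ← tupleVal_cons, extendByZero_tupleVal]
  rw [h3.fderiv_eq, h2.fderiv, hx, rigidPartial_val]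
  rfl

variable (p G h) in
/-- Evaluation of rigid cochains at the coordinates of a point, extended by zero. -/
def rigidEvalExt {k : ℕ} (w : Fin k → Fin m → K) : RigidCochain p G h k →ₗ[K] K where
  toFun f := extendByZero f.val w
  map_add' f g := by rw [RigidCochain.val_add, extendByZero_add]; rfl
  map_smul' c f := by rw [RigidCochain.val_smul, extendByZero_smul]; rfl

/-- The values of a form with rigid coefficients. -/
def formAt {k q : ℕ} (Ω : RigidForm p G h k q) (w : Fin k → Fin m → K) :
    (Fin m → K) [⋀^Fin q]→L[K] K :=
  ((rigidEvalExt p G h w).compAlternatingMap Ω).toContinuousForm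

theorem formAt_apply {k q : ℕ} (Ω : RigidForm p G h k q) (w : Fin k → Fin m → K)
    (v : Fin q → Fin m → K) : formAt Ω w v = extendByZero (Ω v).val w := rfl

theorem isRigid_formAt {k q : ℕ} (Ω : RigidForm p G h k q) :
    IsRigid K (levelRadius p h) (formAt Ω) := by
  refine IsRigid.of_injective (ι := Fin q → Fin m)
    { toFun := fun ω r => ω fun i => Pi.single (r i) 1
      map_add' := fun _ _ => rfl
      map_smul' := fun _ _ => rfl } (fun ω η hωη => ?_)
    (IsRigid.pi levelRadius_pos fun r => isRigid_of_mem (Ω _).mem)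
  refine ContinuousAlternatingMap.toAlternatingMap_injective ?_
  ext1 v
  rw [AlternatingMap.eq_sum_prod_smul, AlternatingMap.eq_sum_prod_smul]
  exact Finset.sum_congr rfl fun r _ => congrArg _ (congrFun hωη r)

/-- With the minus sign, `v ↦ -(G.tangent · v)` is a homomorphism of Lie algebras. -/
theorem lieBracket_tangent (G : FormalGroupLaw (unitBallRing K) m) {y : Fin m → K}
    (hy : ‖y‖ < 1) (v w : Fin m → K) :
    VectorField.lieBracket K (fun y => -(G.tangent y v)) (fun y => -(G.tangent y w)) y =
      -(G.tangent y (G.bracket v w)) := by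
  have h1 : DifferentiableAt K G.tangent y :=
    (G.isRigid_tangent one_pos le_rfl).differentiableAt (by
      rw [mem_eball_zero_iff, ← ofReal_norm]
      exact ENNReal.ofReal_lt_one.mpr hy)
  have h2 : ∀ u : Fin m → K, fderiv K (fun y => -(G.tangent y u)) y =
      -((fderiv K G.tangent y).flip u) := fun u => by
    have h3 := (h1.hasFDerivAt.clm_apply (hasFDerivAt_const u y)).neg.fderiv
    rw [show (fun y => -(G.tangent y u)) = -fun y => G.tangent y u from rfl, h3]
    simp
  rw [VectorField.lieBracket, h2, h2, ← G.fderiv_tangent_tangent hy]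
  simp

/-- Freeze all variables but the first. On the invariant fields, the invariant formula for the
exterior derivative is the Chevalley–Eilenberg differential, because the bracket of two of these
fields is the field of the bracket. -/
theorem formD_pullForm {k q : ℕ} (Ω : RigidForm p G h (k + 1) q) :
    formD p G h k q (pullForm tangentFrame_mem Ω) =
      pullForm tangentFrame_mem (formPartial p G h k q Ω) := by
  ext1 v
  refine rigidCochains_ext fun x => ?_
  set y := (x 0).val with hy
  set ω : (Fin m → K) → (Fin m → K) [⋀^Fin q]→L[K] K :=
    fun z => formAt Ω (Fin.cons z (tupleVal (Fin.tail x))) with hω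
  set X : Fin (q + 1) → (Fin m → K) → (Fin m → K) := fun i z => -(G.tangent z (v i)) with hX
  have hX0 : ∀ i, X i y = tangentFrame x (v i) := fun i => rfl
  have hωv : ∀ (z : StandardGroup p G h) (u : Fin q → Fin m → K),
      (Ω u).val (Fin.cons z (Fin.tail x)) = ω z.val u := fun z u => by
    rw [hω]
    simp only
    rw [formAt_apply, ← tupleVal_cons, extendByZero_tupleVal]
  have hxy : (Fin.cons y (tupleVal (Fin.tail x)) : Fin (k + 1) → Fin m → K) = tupleVal x := by
    rw [hy, ← tupleVal_cons, Fin.cons_self_tail]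
  have hωd : DifferentiableAt K ω y := by
    have h1 : DifferentiableAt K (formAt Ω) (Fin.cons y (tupleVal (Fin.tail x))) := by
      rw [hxy]
      exact (isRigid_formAt Ω).differentiableAt (tupleVal_mem x)
    exact (h1.hasFDerivAt.comp y (hasFDerivAt_cons y (tupleVal (Fin.tail x)))).differentiableAt
  have hR : (pullForm tangentFrame_mem (formPartial p G h k q Ω) v).val x =
      extDeriv ω y fun i => X i y := by
    rw [extDeriv_apply hωd, pullForm_val, formPartial, wedge_apply, ← rigidEvalAt_apply, map_sum]
    refine Finset.sum_congr rfl fun i _ => ?_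
    rw [map_zsmul, rigidEvalAt_apply, rigidPartial_val_eq (F := fun z => ω z _) _ _ _
      fun z => hωv z _]
    rfl
  -- Here the functions being differentiated contain the moving frame, unlike in `hR`; the bracket
  -- term compensates the difference.
  have hE : (wedge (rigidLie p G h k) q (pullForm tangentFrame_mem Ω) v).val x =
      ∑ i : Fin (q + 1), (-1) ^ (i : ℕ) • fderiv K (fun z => ω z (i.removeNth fun j => X j z)) y (X i y) := by
    rw [wedge_apply, ← rigidEvalAt_apply, map_sum]
    refine Finset.sum_congr rfl fun i _ => ?_
    rw [map_zsmul, rigidEvalAt_apply, rigidLie_eq_rigidPartial, rigidPartial_val_eq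
      (F := fun z => ω z (i.removeNth fun j => X j z)) _ _ _ fun z => ?_]
    · rfl
    · rw [pullForm_val, hωv]
      rfl
  rw [hR, formD_apply, AlternatingMap.add_apply, RigidCochain.val_add, Pi.add_apply, hE]
  cases q with
  | zero =>
    rw [bracketDifferential_zero, AlternatingMap.zero_apply, RigidCochain.val_zero, Pi.zero_apply,
      add_zero, extDeriv_apply hωd]
    refine Finset.sum_congr rfl fun i _ => ?_
    congr 3
    funext z
    congr 1
    exact Subsingleton.elim _ _
  | succ q =>
    have hXd : ∀ i, DifferentiableAt K (X i) y := fun i =>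
      ((((G.isRigid_tangent levelRadius_pos levelRadius_le_one).differentiableAt
        (x 0).val_mem_eball).hasFDerivAt.clm_apply
          (hasFDerivAt_const (v i) y)).neg).differentiableAt
    rw [extDeriv_apply_vectorField hωd hXd, sub_eq_add_neg]
    congr 1
    rw [bracketDifferential_apply, RigidCochain.val_neg, Pi.neg_apply, ← rigidEvalAt_apply,
      map_sum]
    congr 1
    refine Finset.sum_congr rfl fun i _ => ?_
    rw [map_sum]
    refine Finset.sum_congr rfl fun j _ => ?_
    rw [map_zsmul, rigidEvalAt_apply, pullForm_val, lieBracket_tangent G (x 0).norm_val_lt_one]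
    congr 1
    have h1 := hωv (x 0) fun l => tangentFrame x
      ((Fin.cons (G.bilin (v i.castSucc) (v j.succ) - G.bilin (v j.succ) (v i.castSucc))
        (j.removeNth (i.castSucc.removeNth v)) : Fin (q + 1) → Fin m → K) l)
    rw [Fin.cons_self_tail] at h1
    refine h1.trans (congrArg (ω y) (funext fun l => ?_))
    refine Fin.cases ?_ (fun l => ?_) l
    · rw [G.bracket_eq]
      rfl
    · rfl

end FrameChange


/-! ### Zigzags in the double complex -/

noncomputable section RigidComparison

open AlternatingMap (wedge bracketDifferential compAlternatingMap_bracketDifferential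
  bracketDifferential_zero)

variable {p : ℕ} {K : Type*} [NontriviallyNormedField K] [IsUltrametricDist K]
  {m : ℕ} {G : FormalGroupLaw (unitBallRing K) m} {h : ℝ} [Fact p.Prime] [Fact (0 ≤ h)]
  [CompleteSpace K]

theorem rigidLie_rigidTail {k : ℕ} (v : Fin m → K) (f : RigidCochain p G h k) :
    rigidLie p G h k v (rigidTail p G h k f) = 0 := by
  have h1 : rigidContract p G h (k + 1) 0 (rigidTail p G h k f) =
      rigidTail p G h (k + 1) (rigidTail p G h k f) := by
    refine rigidCochains_ext fun x => ?_
    rw [rigidContract_apply, ← Fin.cons_self_tail x, Fin.contractNth_zero_cons]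
    rfl
  rw [rigidLie_apply, h1, rigidDeriv_rigidTail, neg_zero]

/-- Transported from the exterior derivative by the change of frame. -/
theorem formD_formD {k q : ℕ} (β : RigidForm p G h (k + 1) q) :
    formD p G h k (q + 1) (formD p G h k q β) = 0 := by
  rw [← pullForm_pullForm tangentFrame_mem tangentFrameInv_mem tangentFrameInv_tangentFrame β,
    formD_pullForm, formD_pullForm, formPartial_formPartial]
  rfl

theorem formPartial_pullForm_eq_zero {k q : ℕ} {β : RigidForm p G h (k + 1) q}
    (hβ : formD p G h k q β = 0) :
    formPartial p G h k q (pullForm tangentFrameInv_mem β) = 0 := by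
  rw [← pullForm_pullForm tangentFrame_mem tangentFrameInv_mem tangentFrameInv_tangentFrame β,
    formD_pullForm] at hβ
  rw [← pullForm_pullForm tangentFrameInv_mem tangentFrame_mem tangentFrame_tangentFrameInv
    (formPartial p G h k q (pullForm tangentFrameInv_mem β)), hβ]
  rfl

theorem exists_formD_eq [CharZero K]
    (hnat : ∀ n : ℕ, n ≠ 0 → (n : K) ≠ 0 ∧ ‖(n : K)⁻¹‖ ≤ n) {k q : ℕ}
    {β : RigidForm p G h (k + 1) (q + 1)} (hβ : formD p G h k (q + 1) β = 0) :
    ∃ γ, formD p G h k q γ = β := by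
  obtain ⟨γ, hγ⟩ := exists_formPartial_eq hnat _ (formPartial_pullForm_eq_zero hβ)
  exact ⟨pullForm tangentFrame_mem γ, by
    rw [formD_pullForm, hγ, pullForm_pullForm tangentFrame_mem tangentFrameInv_mem
      tangentFrameInv_tangentFrame]⟩

theorem eq_formTail_of_formD_eq_zero [CharZero K] {k : ℕ} {β : RigidForm p G h (k + 1) 0}
    (hβ : formD p G h k 0 β = 0) : β = formTail p G h k 0 (formEvalOne p G h k 0 β) := by
  ext1 v
  refine eq_rigidTail_of_rigidEuler_eq_zero (c := 0) ?_
  rw [Nat.cast_zero, zero_smul, add_zero]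
  refine rigidCochains_ext fun x => ?_
  -- Evaluating the vanishing exterior derivative on the vector `x 0` itself gives the Euler
  -- derivative at `x`.
  have h1 := congrArg (fun ω : RigidForm p G h (k + 1) 1 => (ω fun _ => (x 0).val).val x)
    (formPartial_pullForm_eq_zero hβ)
  simp only [formPartial, AlternatingMap.wedge_apply, Fin.sum_univ_succ,
    Finset.univ_eq_empty, Finset.sum_empty, add_zero, Fin.val_zero, pow_zero, one_smul] at h1
  have h2 : pullForm tangentFrameInv_mem β (Fin.removeNth 0 fun _ => (x 0).val) = β v :=
    rigidCochains_ext fun y => by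
      rw [pullForm_val]
      congr 2
      exact Subsingleton.elim _ _
  rw [h2] at h1
  exact h1

variable (p G h) in
/-- The coboundary, for forms. -/
def formCoboundary (k q : ℕ) : RigidForm p G h k q →ₗ[K] RigidForm p G h (k + 1) q :=
  LinearMap.compAlternatingMapₗ K (rigidCoboundary p G h k)

theorem formCoboundary_apply {k q : ℕ} (β : RigidForm p G h k q) :
    formCoboundary p G h k q β = formTail p G h k q β + formDelta p G h k q β := rfl

theorem formDelta_formTail {k q : ℕ} (β : RigidForm p G h k q) :
    formDelta p G h (k + 1) q (formTail p G h k q β) =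
      -formTail p G h (k + 1) q (formCoboundary p G h k q β) := by
  have h1 : formCoboundary p G h (k + 1) q (formTail p G h k q β) =
      -formTail p G h (k + 1) q (formDelta p G h k q β) := by
    ext1 v
    exact rigidCoboundary_rigidTail (β v)
  rw [formCoboundary_apply] at h1 ⊢
  rw [map_add, neg_add, ← h1]
  abel

theorem formTail_injective {k q : ℕ} : Function.Injective (formTail p G h k q) :=
  Function.LeftInverse.injective formEvalOne_formTail

theorem formEval_formCoboundary {k q N : ℕ} (e : q + k = N) (β : RigidForm p G h k q) :
    formEval p G h (k + 1) q (N + 1) (by omega) (formCoboundary p G h k q β) =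
      (-1 : K) ^ k • bracketDifferential G.bilin N (formEval p G h k q N e β) -
        formEval p G h k (q + 1) (N + 1) (by omega) (bracketDifferential G.bilin q β) := by
  rw [formCoboundary_apply, map_add, formEval_formTail, zero_add, formEval_formDelta]

theorem bracketDifferential_mem_lieCoboundaries {n : ℕ} (η : (Fin m → K) [⋀^Fin n]→ₗ[K] K) :
    bracketDifferential G.bilin n η ∈ lieCoboundaries G K (n + 1) :=
  (mem_lieCoboundaries_succ_iff G _).mpr ⟨η, rfl⟩

/-- The zigzag from forms to functions, by induction on `q`. If `q > 0`, write the element as `formD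
γ` and continue with `δ γ`, which has one form degree less and one group variable more and whose
value differs by a Lie coboundary. For `q = 0` the element does not depend on its first variable,
and removing that variable leaves a group cocycle. -/
theorem exists_formCoboundary_eq_zero [CharZero K]
    (hnat : ∀ n : ℕ, n ≠ 0 → (n : K) ≠ 0 ∧ ‖(n : K)⁻¹‖ ≤ n) {k q N : ℕ} (e : q + k = N)
    {α : RigidForm p G h (k + 1) q} (hd : formD p G h k q α = 0)
    (hδ : formDelta p G h (k + 1) q α = 0) :
    ∃ f : RigidForm p G h N 0, formCoboundary p G h N 0 f = 0 ∧
      formEval p G h N 0 N (by omega) f - formEval p G h k q N e (formEvalOne p G h k q α) ∈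
        lieCoboundaries G K N := by
  induction q generalizing k with
  | zero =>
    obtain rfl : k = N := by omega
    refine ⟨formEvalOne p G h k 0 α, formTail_injective ?_, ?_⟩
    · rw [map_zero, ← neg_eq_zero, ← formDelta_formTail, ← eq_formTail_of_formD_eq_zero hd, hδ]
    · rw [sub_self]
      exact Submodule.zero_mem _
  | succ q ih =>
    obtain ⟨γ, rfl⟩ := exists_formD_eq hnat hd
    obtain ⟨N, rfl⟩ : ∃ M, N = M + 1 := ⟨q + k, by omega⟩
    obtain ⟨f, hf, h1⟩ := ih (k := k + 1) (by omega) (α := formDelta p G h (k + 1) q γ)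
      (by rw [formD_formDelta, hδ]) (formDelta_formDelta γ)
    refine ⟨f, hf, ?_⟩
    rw [formEval_formEvalOne_formDelta (N := N) (by omega)] at h1
    have h2 := Submodule.sub_mem _ h1 (Submodule.smul_mem _ ((-1 : K) ^ k)
      (bracketDifferential_mem_lieCoboundaries (G := G)
        (formEval p G h k q N (by omega) (formEvalOne p G h k q γ))))
    convert h2 using 1
    abel

/-- Half a step backwards. Take the `δ`-primitive `γ` of `α` from the homotopy; `formD γ` satisfies
the assumptions of `H`, so it equals `formD γ'` with `δ γ' = 0`, and `γ - γ'` is the required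
primitive. -/
theorem exists_formDelta_eq_of_forall
    {k q N : ℕ} (e : q + (k + 1) = N)
    (H : ∀ α : RigidForm p G h (k + 1) (q + 1), formD p G h k (q + 1) α = 0 →
      formDelta p G h (k + 1) (q + 1) α = 0 →
      formEval p G h k (q + 1) N (by omega) (formEvalOne p G h k (q + 1) α) ∈
        lieCoboundaries G K N →
      ∃ γ, formD p G h k q γ = α ∧ formDelta p G h (k + 1) q γ = 0)
    {α : RigidForm p G h (k + 2) q} (hd : formD p G h (k + 1) q α = 0)
    (hδ : formDelta p G h (k + 2) q α = 0)
    (hα : formEval p G h (k + 1) q N e (formEvalOne p G h (k + 1) q α) ∈ lieCoboundaries G K N) :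
    ∃ γ, formD p G h k q γ = 0 ∧ formDelta p G h (k + 1) q γ = α := by
  obtain ⟨N, rfl⟩ : ∃ M, N = M + 1 := ⟨q + k, by omega⟩
  set γ := -formEvalOne p G h (k + 1) q α with hγ
  have h1 : formDelta p G h (k + 1) q γ = α := eq_formDelta_of_formDelta_eq_zero hδ
  obtain ⟨γ', h2, h3⟩ := H (formD p G h k q γ) (formD_formD γ)
    (by rw [← formD_formDelta, h1, hd]) (by
      have h4 := formEval_formEvalOne_formDelta (N := N) (by omega) γ
      rw [h1, eq_sub_iff_add_eq] at h4
      rw [← h4]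
      exact Submodule.add_mem _ hα (Submodule.smul_mem _ _
        (bracketDifferential_mem_lieCoboundaries (G := G) _)))
  exact ⟨γ - γ', by rw [map_sub, h2, sub_self], by rw [map_sub, h1, h3, sub_zero]⟩

/-- Induction on `k`. For `k = 0` the element comes from a form with constant values, whose Lie
primitive is inserted. For larger `k` a `formD`-closed `δ`-primitive has the form `formD ζ` by the
Poincaré lemma, and `δ ζ` is the answer. -/
theorem exists_formD_eq_formDelta_eq_zero [CharZero K]
    (hnat : ∀ n : ℕ, n ≠ 0 → (n : K) ≠ 0 ∧ ‖(n : K)⁻¹‖ ≤ n) {k q N : ℕ} (e : q + 1 + k = N)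
    {α : RigidForm p G h (k + 1) (q + 1)} (hd : formD p G h k (q + 1) α = 0)
    (hδ : formDelta p G h (k + 1) (q + 1) α = 0)
    (hα : formEval p G h k (q + 1) N e (formEvalOne p G h k (q + 1) α) ∈
      lieCoboundaries G K N) :
    ∃ γ, formD p G h k q γ = α ∧ formDelta p G h (k + 1) q γ = 0 := by
  induction k generalizing q with
  | zero =>
    obtain rfl : q + 1 = N := e
    obtain ⟨η, hη⟩ := (mem_lieCoboundaries_succ_iff G _).mp hα
    rw [formEval_zero] at hη
    have h1 : formEvalOne p G h 0 (q + 1) α = bracketDifferential G.bilin q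
        ((rigidConstEquiv p G h).symm.toLinearMap.compAlternatingMap η) := by
      rw [← compAlternatingMap_bracketDifferential, hη]
      ext1 v
      exact ((rigidConstEquiv p G h).symm_apply_apply _).symm
    refine ⟨-formDelta p G h 0 q
      ((rigidConstEquiv p G h).symm.toLinearMap.compAlternatingMap η), ?_, ?_⟩
    · rw [map_neg, formD_formDelta_zero, ← h1, ← map_neg, eq_formDelta_of_formDelta_eq_zero hδ]
    · rw [map_neg, formDelta_formDelta, neg_zero]
  | succ k ih =>
    obtain ⟨γ, h1, h2⟩ := exists_formDelta_eq_of_forall e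
      (fun α' h3 h4 h5 => ih (by omega) h3 h4 h5) hd hδ hα
    obtain ⟨ζ, rfl⟩ := exists_formD_eq hnat h1
    exact ⟨formDelta p G h (k + 1) q ζ, by rw [formD_formDelta, h2], formDelta_formDelta ζ⟩

/-- Differentiating all entries of a cocycle gives a cocycle. -/
theorem formEval_mem_lieCocycles {n : ℕ} {f : RigidForm p G h n 0}
    (hf : formCoboundary p G h n 0 f = 0) :
    formEval p G h n 0 n (by omega) f ∈ lieCocycles G K n := by
  have h1 := formEval_formCoboundary (N := n) (by omega) f
  rw [hf, map_zero, bracketDifferential_zero, map_zero, sub_zero] at h1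
  rw [mem_lieCocycles_iff]
  exact (smul_eq_zero.mp h1.symm).resolve_left (by simp)

theorem formEval_formCoboundary_mem {n : ℕ} (g : RigidForm p G h n 0) :
    formEval p G h (n + 1) 0 (n + 1) (by omega) (formCoboundary p G h n 0 g) ∈
      lieCoboundaries G K (n + 1) := by
  rw [formEval_formCoboundary (N := n) (by omega), bracketDifferential_zero, map_zero, sub_zero]
  exact Submodule.smul_mem _ _ (bracketDifferential_mem_lieCoboundaries _)

theorem exists_formEval_sub_mem [CharZero K]
    (hnat : ∀ n : ℕ, n ≠ 0 → (n : K) ≠ 0 ∧ ‖(n : K)⁻¹‖ ≤ n) {n : ℕ}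
    {ω : (Fin m → K) [⋀^Fin n]→ₗ[K] K} (hω : ω ∈ lieCocycles G K n) :
    ∃ f : RigidForm p G h n 0, formCoboundary p G h n 0 f = 0 ∧
      formEval p G h n 0 n (by omega) f - ω ∈ lieCoboundaries G K n := by
  rw [mem_lieCocycles_iff] at hω
  set ω' := (rigidConstEquiv p G h).symm.toLinearMap.compAlternatingMap ω with hω'
  obtain ⟨f, h1, h2⟩ := exists_formCoboundary_eq_zero hnat (k := 0) (q := n) (N := n) rfl
    (α := formDelta p G h 0 n (-ω'))
    (by
      rw [formD_formDelta_zero, map_neg, hω', ← compAlternatingMap_bracketDifferential, hω,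
        LinearMap.compAlternatingMap_zero, neg_zero, map_zero])
    (formDelta_formDelta _)
  refine ⟨f, h1, ?_⟩
  rw [formDelta_zero, map_neg, formEvalOne_formTail, neg_neg, formEval_zero] at h2
  convert h2 using 2
  ext1 v
  exact ((rigidConstEquiv p G h).apply_symm_apply _).symm

/-- The zigzag is applied to the tail of `f`. The resulting `formD`-closed `δ`-primitive is itself a
tail, and `formDelta_formTail` reads off a primitive of `f`, up to sign. -/
theorem exists_formCoboundary_eq [CharZero K]
    (hnat : ∀ n : ℕ, n ≠ 0 → (n : K) ≠ 0 ∧ ‖(n : K)⁻¹‖ ≤ n) {n : ℕ}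
    {f : RigidForm p G h (n + 1) 0} (hf : formCoboundary p G h (n + 1) 0 f = 0)
    (hΦ : formEval p G h (n + 1) 0 (n + 1) (by omega) f ∈ lieCoboundaries G K (n + 1)) :
    ∃ g, formCoboundary p G h n 0 g = f := by
  have hd : ∀ {k : ℕ} (g : RigidForm p G h k 0), formD p G h k 0 (formTail p G h k 0 g) = 0 := by
    intro k g
    rw [formD_apply, bracketDifferential_zero, add_zero]
    ext1 v
    rw [AlternatingMap.wedge_apply]
    refine Finset.sum_eq_zero fun i _ => ?_
    rw [formTail_apply, rigidLie_rigidTail, smul_zero]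
  obtain ⟨γ, h1, h2⟩ := exists_formDelta_eq_of_forall (k := n) (q := 0) (N := n + 1) (by omega)
    (fun α h3 h4 h5 => exists_formD_eq_formDelta_eq_zero hnat (by omega) h3 h4 h5)
    (hd f) (by rw [formDelta_formTail, hf, map_zero, neg_zero])
    (by rwa [formEvalOne_formTail])
  refine ⟨-formEvalOne p G h n 0 γ, formTail_injective ?_⟩
  rw [map_neg, map_neg, ← formDelta_formTail, ← eq_formTail_of_formD_eq_zero h1, h2]

end RigidComparison


/-! ### Successive differentiation and the iterated derivative -/

theorem MultilinearMap.alternatization_succ_apply {R M N : Type*} [CommRing R] [AddCommGroup M]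
    [Module R M] [AddCommGroup N] [Module R N] {n : ℕ}
    (f : MultilinearMap R (fun _ : Fin (n + 1) => M) N) (v : Fin (n + 1) → M) :
    MultilinearMap.alternatization f v = ∑ i : Fin (n + 1),
      (-1) ^ (i : ℕ) • MultilinearMap.alternatization (f.curryLeft (v i)) (i.removeNth v) := by
  rw [MultilinearMap.alternatization_apply, Finset.univ_perm_fin_succ,
    ← Finset.univ_product_univ]
  simp only [Finset.sum_map, Equiv.toEmbedding_apply, Finset.sum_product]
  refine Finset.sum_congr rfl fun i _ => Fin.cases ?_ (fun i => ?_) i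
  · simp only [MultilinearMap.alternatization_apply, Fin.val_zero, pow_zero, one_smul]
    refine Finset.sum_congr rfl fun σ _ => ?_
    rw [Equiv.Perm.decomposeFin.symm_sign, if_pos rfl, one_mul]
    congr 1
    change f _ = f (Fin.cons (v 0) _)
    congr 1
    funext j
    refine Fin.cases ?_ (fun j => ?_) j
    · simp [Equiv.Perm.decomposeFin_symm_apply_zero]
    · simp [Equiv.Perm.decomposeFin_symm_apply_succ, Fin.removeNth]
  -- Permutations are sorted by their value at `0`. `decomposeFin` reaches that value by a
  -- transposition and `removeNth` by a shift; the two orders differ by `i.cycleRange`, of sign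
  -- `(-1) ^ i`.
  · have h1 := (MultilinearMap.alternatization (f.curryLeft (v i.succ))).map_perm
      (i.succ.removeNth v) i.cycleRange
    have h2 : (-1 : ℤ) ^ (i.succ : ℕ) • MultilinearMap.alternatization (f.curryLeft (v i.succ))
        (i.succ.removeNth v) = -MultilinearMap.alternatization (f.curryLeft (v i.succ))
          (i.succ.removeNth v ∘ i.cycleRange) := by
      rw [h1, Fin.sign_cycleRange, Fin.val_succ, pow_succ, mul_neg_one, neg_smul, Units.smul_def]
      simp
    rw [h2, MultilinearMap.alternatization_apply, ← Finset.sum_neg_distrib]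
    refine Finset.sum_congr rfl fun σ _ => ?_
    rw [Equiv.Perm.decomposeFin.symm_sign, if_neg (Fin.succ_ne_zero i), neg_one_mul, Units.neg_smul]
    congr 2
    change f _ = f (Fin.cons (v i.succ) _)
    congr 1
    funext j
    refine Fin.cases ?_ (fun j => ?_) j
    · simp [Equiv.Perm.decomposeFin_symm_apply_zero]
    · simp [Equiv.Perm.decomposeFin_symm_apply_succ, Fin.removeNth, Fin.succAbove_cycleRange]

noncomputable section Differentiation

open AlternatingMap (wedge wedge_eq alternatizeUncurryFin alternatizeUncurryFin_apply)

/-- The recursion for the iterated derivative splits off the last argument; symmetry of the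
derivatives of an analytic function moves the first argument there by a rotation. -/
theorem iteratedFDeriv_succ_cons {𝕜 E F : Type*} [NontriviallyNormedField 𝕜]
    [NormedAddCommGroup E] [NormedSpace 𝕜 E] [NormedAddCommGroup F] [NormedSpace 𝕜 F]
    [CompleteSpace F] {f : E → F} {x : E} (hf : AnalyticAt 𝕜 f x) {n : ℕ} (a : E) (v : Fin n → E) :
    iteratedFDeriv 𝕜 (n + 1) f x (Fin.cons a v) =
      iteratedFDeriv 𝕜 n (fun y => fderiv 𝕜 f y a) x v := by
  have h1 := (hf.contDiffAt (n := ⊤)).iteratedFDeriv_comp_perm (n := n + 1)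
    (Fin.cons a v) (finRotate _)
  have h2 : (Fin.cons a v : Fin (n + 1) → E) ∘ finRotate _ = Fin.snoc v a :=
    (Fin.snoc_eq_cons_rotate v a).symm
  rw [← h1, h2, iteratedFDeriv_succ_apply_right, Fin.init_snoc, Fin.snoc_last]
  have h3 := (ContinuousLinearMap.apply 𝕜 F a).iteratedFDeriv_comp_left
    (f := fun y => fderiv 𝕜 f y) (x := x) (hf.fderiv.contDiffAt (n := n)) (i := n) le_rfl
  exact congrArg (fun φ : E [×n]→L[𝕜] F => φ v) h3.symm

variable {p : ℕ} {K : Type*} [NontriviallyNormedField K] [IsUltrametricDist K]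
  {m : ℕ} {G : FormalGroupLaw (unitBallRing K) m} {h : ℝ} [Fact p.Prime] [Fact (0 ≤ h)]
  [CompleteSpace K]

theorem iteratedFDeriv_extendByZero_cons {n : ℕ} (f : RigidCochain p G h (n + 1))
    (v : Fin m → K) (u : Fin n → Fin m → K) :
    iteratedFDeriv K (n + 1) (extendByZero f.val) 0
        (fun i => Pi.single i ((Fin.cons v u : Fin (n + 1) → Fin m → K) i)) =
      iteratedFDeriv K n (extendByZero (rigidDeriv p G h n v f).val) 0
        (fun i => Pi.single i (u i)) := by
  have hA := (isRigid_of_mem f.mem).analyticOnNhd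
  have h1 : (fun i => Pi.single i ((Fin.cons v u : Fin (n + 1) → Fin m → K) i)) =
      (Fin.cons (singleZeroCLM K m n v) fun i => consZeroCLM K m n (Pi.single i (u i)) :
        Fin (n + 1) → Fin (n + 1) → Fin m → K) := by
    funext i
    refine Fin.cases ?_ (fun i => ?_) i
    · rfl
    · rw [Fin.cons_succ, Fin.cons_succ, consZeroCLM_apply]
      funext j
      refine Fin.cases ?_ (fun j => ?_) j
      · simp
      · simp [Pi.single_apply]
  rw [h1, iteratedFDeriv_succ_cons (hA 0 zero_mem_eball)]
  set H : (Fin (n + 1) → Fin m → K) → K := fun y =>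
    fderiv K (extendByZero f.val) y (singleZeroCLM K m n v) with hH
  -- `rigidDeriv` is the partial derivative restricted to the slice where the first variable is `0`;
  -- the other derivatives are taken within that slice.
  have h2 : extendByZero (rigidDeriv p G h n v f).val =ᶠ[𝓝 0] H ∘ consZeroCLM K m n :=
    (extendByZero_eqOn fun x => derivOne_cons f.mem x v).eventuallyEq_of_mem
      (eball_mem_nhds zero_mem_eball)
  rw [(h2.iteratedFDeriv K n).eq_of_nhds]
  have hHc : ContDiffOn K n H (Metric.eball 0 (levelRadius p h)) := by
    have h3 : AnalyticOnNhd K H (Metric.eball 0 (levelRadius p h)) :=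
      ((isRigid_of_mem f.mem).fderiv.clm_comp
        (ContinuousLinearMap.apply K K (singleZeroCLM K m n v))).analyticOnNhd
    exact fun y hy => (h3 y hy).contDiffAt.contDiffWithinAt
  have ho : IsOpen (consZeroCLM K m n ⁻¹' Metric.eball 0 (levelRadius p h)) :=
    Metric.isOpen_eball.preimage (consZeroCLM K m n).continuous
  have h0 : consZeroCLM K m n 0 ∈ Metric.eball 0 (levelRadius p h) := by
    rw [map_zero]
    exact zero_mem_eball
  have h4 := (consZeroCLM K m n).iteratedFDerivWithin_comp_right hHc
    Metric.isOpen_eball.uniqueDiffOn ho.uniqueDiffOn h0 (i := n) le_rfl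
  rw [iteratedFDerivWithin_of_isOpen n ho h0, iteratedFDerivWithin_of_isOpen n Metric.isOpen_eball h0,
    map_zero] at h4
  rw [h4]
  rfl

theorem differentiateCochain_succ_apply {n : ℕ} (f : RigidCochain p G h (n + 1))
    (v : Fin (n + 1) → Fin m → K) :
    differentiateCochain f.val v = ∑ i : Fin (n + 1), (-1) ^ (i : ℕ) •
      differentiateCochain (rigidDeriv p G h n (v i) f).val (i.removeNth v) := by
  rw [differentiateCochain, MultilinearMap.alternatization_succ_apply]
  refine Finset.sum_congr rfl fun i _ => ?_
  congr 2
  rw [differentiateCochain]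
  exact congrArg _ (MultilinearMap.ext fun u => iteratedFDeriv_extendByZero_cons f (v i) u)

/-- Cochains, as forms of degree zero. -/
def constForm {n : ℕ} (f : RigidCochain p G h n) : RigidForm p G h n 0 :=
  AlternatingMap.constOfIsEmpty K (Fin m → K) (Fin 0) f

theorem constForm_apply {n : ℕ} (f : RigidCochain p G h n) (v : Fin 0 → Fin m → K) :
    constForm f v = f := rfl

theorem exists_constForm_eq {n : ℕ} (β : RigidForm p G h n 0) : ∃ f, constForm f = β :=
  ⟨β Fin.elim0, by
    ext1 v
    rw [constForm_apply, Subsingleton.elim v Fin.elim0]⟩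

theorem constForm_injective {n : ℕ} :
    Function.Injective (constForm : RigidCochain p G h n → RigidForm p G h n 0) := fun _ _ hfg =>
  congrArg (fun β : RigidForm p G h n 0 => β Fin.elim0) hfg

theorem formCoboundary_constForm {n : ℕ} (f : RigidCochain p G h n) :
    formCoboundary p G h n 0 (constForm f) = constForm (rigidCoboundary p G h n f) := by
  ext1 v
  rfl

/-- Successive differentiation agrees with differentiation of cochains up to sign. -/
theorem exists_formEval_eq (n : ℕ) : ∃ ε : K, ε ≠ 0 ∧ ∀ f : RigidCochain p G h n,
    formEval p G h n 0 n (by omega) (constForm f) = ε • differentiateCochain f.val := by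
  induction n with
  | zero =>
    refine ⟨1, one_ne_zero, fun f => ?_⟩
    rw [one_smul]
    ext v
    rw [differentiateCochain, MultilinearMap.alternatization_apply]
    rw [Fintype.sum_subsingleton _ 1, Equiv.Perm.sign_one, one_smul]
    change f.val Fin.elim0 = extendByZero f.val 0
    rw [extendByZero, dif_pos fun i => i.elim0]
    congr 1
    exact Subsingleton.elim _ _
  | succ n ih =>
    obtain ⟨ε, hε, ih⟩ := ih
    refine ⟨(-1) ^ n * ε, mul_ne_zero (by simp) hε, fun f => ?_⟩
    let g : (Fin m → K) →ₗ[K] RigidForm p G h n 0 :=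
      AlternatingMap.actLM (rigidDeriv p G h n) 0 (constForm f)
    have hg : ∀ u, g u = constForm (rigidDeriv p G h n u f) := fun u => by
      ext1 v
      rfl
    rw [formEval_succ, show formDeriv p G h n 0 (constForm f) = alternatizeUncurryFin g from rfl,
      formEval_alternatizeUncurryFin (N := n) (by omega), mul_smul]
    congr 1
    ext1 v
    rw [alternatizeUncurryFin_apply, AlternatingMap.smul_apply, differentiateCochain_succ_apply,
      Finset.smul_sum]
    refine Finset.sum_congr rfl fun i _ => ?_
    rw [LinearMap.comp_apply, hg, ih, smul_comm]
    rfl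

end Differentiation


/-! ### The comparison for rigid cochains -/

noncomputable section RigidCochainComparison

variable {p : ℕ} {K : Type*} [NontriviallyNormedField K] [IsUltrametricDist K]
  {m : ℕ} {G : FormalGroupLaw (unitBallRing K) m} {h : ℝ} [Fact p.Prime] [Fact (0 ≤ h)]
  [CompleteSpace K]

theorem formCoboundary_constForm_eq_zero {n : ℕ} {f : RigidCochain p G h n}
    (hf : cochainDifferential (StandardGroup p G h) K n f.val = 0) :
    formCoboundary p G h n 0 (constForm f) = 0 := by
  rw [formCoboundary_constForm, show rigidCoboundary p G h n f = 0 from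
    RigidCochain.val_injective ((coe_rigidCoboundary f).trans hf)]
  rfl

theorem differentiateCochain_mem_lieCocycles_of_rigid {n : ℕ} {f : RigidCochain p G h n}
    (hf : cochainDifferential (StandardGroup p G h) K n f.val = 0) :
    differentiateCochain f.val ∈ lieCocycles G K n := by
  obtain ⟨ε, hε, h1⟩ := exists_formEval_eq (p := p) (G := G) (h := h) n
  have h2 := formEval_mem_lieCocycles (formCoboundary_constForm_eq_zero hf)
  rw [h1] at h2
  exact ((lieCocycles G K n).smul_mem_iff hε).mp h2

theorem differentiateCochain_coboundary_mem_of_rigid {n : ℕ} (g : RigidCochain p G h n) :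
    differentiateCochain (cochainDifferential (StandardGroup p G h) K n g.val) ∈
      lieCoboundaries G K (n + 1) := by
  obtain ⟨ε, hε, h1⟩ := exists_formEval_eq (p := p) (G := G) (h := h) (n + 1)
  have h2 := formEval_formCoboundary_mem (constForm g)
  rw [formCoboundary_constForm, h1, coe_rigidCoboundary] at h2
  exact ((lieCoboundaries G K (n + 1)).smul_mem_iff hε).mp h2

/-- Every Lie algebra cocycle is, up to coboundaries, the derivative of a rigid cocycle. -/
theorem exists_rigid_differentiateCochain_sub_mem [CharZero K]
    (hnat : ∀ n : ℕ, n ≠ 0 → (n : K) ≠ 0 ∧ ‖(n : K)⁻¹‖ ≤ n) {n : ℕ}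
    {ω : (Fin m → K) [⋀^Fin n]→ₗ[K] K} (hω : ω ∈ lieCocycles G K n) :
    ∃ f : RigidCochain p G h n, cochainDifferential (StandardGroup p G h) K n f.val = 0 ∧
      differentiateCochain f.val - ω ∈ lieCoboundaries G K n := by
  obtain ⟨ε, hε, h1⟩ := exists_formEval_eq (p := p) (G := G) (h := h) n
  obtain ⟨β, h2, h3⟩ := exists_formEval_sub_mem (p := p) (h := h) hnat hω
  obtain ⟨f, hf⟩ := exists_constForm_eq (ε • β)
  refine ⟨f, ?_, ?_⟩
  · have h4 : rigidCoboundary p G h n f = 0 := constForm_injective (by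
      rw [← formCoboundary_constForm, hf, map_smul, h2, smul_zero]
      rfl)
    rw [← coe_rigidCoboundary, h4, RigidCochain.val_zero]
  · have h5 := h1 f
    rw [hf, map_smul] at h5
    rwa [← smul_right_injective _ hε h5]

/-- A rigid cocycle whose derivative is a coboundary is the coboundary of a rigid cochain. -/
theorem exists_rigid_cochainDifferential_eq [CharZero K]
    (hnat : ∀ n : ℕ, n ≠ 0 → (n : K) ≠ 0 ∧ ‖(n : K)⁻¹‖ ≤ n) {n : ℕ}
    {f : RigidCochain p G h (n + 1)}
    (hf : cochainDifferential (StandardGroup p G h) K (n + 1) f.val = 0)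
    (hΦ : differentiateCochain f.val ∈ lieCoboundaries G K (n + 1)) :
    ∃ g : RigidCochain p G h n, cochainDifferential (StandardGroup p G h) K n g.val = f.val := by
  obtain ⟨ε, -, h1⟩ := exists_formEval_eq (p := p) (G := G) (h := h) (n + 1)
  obtain ⟨β, hβ⟩ := exists_formCoboundary_eq hnat (formCoboundary_constForm_eq_zero hf)
    (by rw [h1]; exact Submodule.smul_mem _ _ hΦ)
  obtain ⟨g, rfl⟩ := exists_constForm_eq β
  rw [formCoboundary_constForm] at hβ
  exact ⟨g, by rw [← coe_rigidCoboundary, constForm_injective hβ]⟩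

end RigidCochainComparison


/-! ### The prism homotopy for homogeneous cochains -/

noncomputable section HomogeneousCochains

variable {M K : Type*} [CommRing K]

/-- The differential of homogeneous cochains. -/
def homogeneousDifferential {n : ℕ} (F : (Fin n → M) → K) (g : Fin (n + 1) → M) : K :=
  ∑ i : Fin (n + 1), (-1) ^ (i : ℕ) * F (i.removeNth g)

/-- The tuple `(ρ g₀, …, ρ gᵢ, gᵢ, …, gₙ)`. -/
def prismVertex (ρ : M → M) {n : ℕ} (i : Fin n) (g : Fin n → M) (j : Fin (n + 1)) : M :=
  if j ≤ i.castSucc then ρ (g (i.predAbove j)) else g (i.predAbove j)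

/-- The chain homotopy between the identity and the pull-back by `ρ`. -/
def prismOperator (ρ : M → M) {n : ℕ} (F : (Fin (n + 1) → M) → K) (g : Fin n → M) : K :=
  ∑ i : Fin n, (-1) ^ (i : ℕ) * F (prismVertex ρ i g)

theorem prismVertex_zero_cons (ρ : M → M) {n : ℕ} (a : M) (g : Fin n → M) :
    prismVertex ρ 0 (Fin.cons a g : Fin (n + 1) → M) = Fin.cons (ρ a) (Fin.cons a g) := by
  funext j
  refine Fin.cases ?_ (fun j => ?_) j
  · simp [prismVertex]
  · simp [prismVertex]

theorem prismVertex_succ_cons (ρ : M → M) {n : ℕ} (a : M) (i : Fin n) (g : Fin n → M) :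
    prismVertex ρ i.succ (Fin.cons a g : Fin (n + 1) → M) =
      Fin.cons (ρ a) (prismVertex ρ i g) := by
  funext j
  refine Fin.cases ?_ (fun j => ?_) j
  · simp [prismVertex]
  · simp [prismVertex]

theorem homogeneousDifferential_cons {n : ℕ} (F : (Fin (n + 1) → M) → K) (a : M)
    (g : Fin (n + 1) → M) :
    homogeneousDifferential F (Fin.cons a g) =
      F g - homogeneousDifferential (fun g => F (Fin.cons a g)) g := by
  rw [homogeneousDifferential, Fin.sum_univ_succ, homogeneousDifferential, sub_eq_add_neg,
    ← Finset.sum_neg_distrib]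
  congr 1
  · rw [Fin.val_zero, pow_zero, one_mul]
    rfl
  · refine Finset.sum_congr rfl fun i _ => ?_
    rw [Fin.val_succ, pow_succ, mul_neg_one, neg_mul]
    congr 3
    funext j
    refine Fin.cases ?_ (fun j => ?_) j
    · simp [Fin.removeNth]
    · simp [Fin.removeNth]

theorem prismOperator_cons (ρ : M → M) {n : ℕ} (F : (Fin (n + 2) → M) → K) (a : M)
    (g : Fin n → M) :
    prismOperator ρ F (Fin.cons a g) =
      F (Fin.cons (ρ a) (Fin.cons a g)) - prismOperator ρ (fun g => F (Fin.cons (ρ a) g)) g := by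
  rw [prismOperator, Fin.sum_univ_succ, prismOperator, sub_eq_add_neg, ← Finset.sum_neg_distrib]
  congr 1
  · rw [Fin.val_zero, pow_zero, one_mul, prismVertex_zero_cons]
  · refine Finset.sum_congr rfl fun i _ => ?_
    rw [Fin.val_succ, pow_succ, mul_neg_one, neg_mul, prismVertex_succ_cons]

theorem homogeneousDifferential_sub {n : ℕ} (F F' : (Fin n → M) → K) (g : Fin (n + 1) → M) :
    homogeneousDifferential (fun g => F g - F' g) g =
      homogeneousDifferential F g - homogeneousDifferential F' g := by
  simp only [homogeneousDifferential, mul_sub, Finset.sum_sub_distrib]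

theorem prismOperator_sub (ρ : M → M) {n : ℕ} (F F' : (Fin (n + 1) → M) → K) (g : Fin n → M) :
    prismOperator ρ (fun g => F g - F' g) g = prismOperator ρ F g - prismOperator ρ F' g := by
  simp only [prismOperator, mul_sub, Finset.sum_sub_distrib]

/-- Split off the first vertex: both operators then obey cone recursions, and all terms cancel
except those of the induction hypothesis for `F` with first vertex `ρ a`. -/
theorem homogeneousDifferential_prismOperator (ρ : M → M) {n : ℕ} (F : (Fin (n + 1) → M) → K)
    (g : Fin (n + 1) → M) :
    homogeneousDifferential (prismOperator ρ F) g + prismOperator ρ (homogeneousDifferential F) g =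
      F g - F fun i => ρ (g i) := by
  induction n with
  | zero =>
    obtain ⟨a, g, rfl⟩ : ∃ a g', g = Fin.cons a g' := ⟨_, _, (Fin.cons_self_tail g).symm⟩
    rw [prismOperator_cons, homogeneousDifferential_cons]
    simp only [homogeneousDifferential, prismOperator, Finset.univ_eq_empty, Finset.sum_empty,
      mul_zero, Finset.sum_const_zero, zero_add, sub_zero]
    have : Subsingleton (Fin (0 + 1)) := inferInstanceAs (Subsingleton (Fin 1))
    rw [Fintype.sum_subsingleton _ 0, Fin.val_zero, pow_zero, one_mul]
    congr 2
    funext j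
    rw [Subsingleton.elim j 0]
    rfl
  | succ n ih =>
    obtain ⟨a, g, rfl⟩ : ∃ a g', g = Fin.cons a g' := ⟨_, _, (Fin.cons_self_tail g).symm⟩
    have h1 : (fun i => ρ ((Fin.cons a g : Fin (n + 2) → M) i)) =
        Fin.cons (ρ a) fun i => ρ (g i) := by
      funext j
      refine Fin.cases rfl (fun j => rfl) j
    have h2 := ih (fun g => F (Fin.cons (ρ a) g)) g
    rw [homogeneousDifferential_cons, prismOperator_cons, homogeneousDifferential_cons,
      homogeneousDifferential_cons, h1]
    simp only [prismOperator_cons, homogeneousDifferential_cons]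
    rw [homogeneousDifferential_sub, prismOperator_sub]
    linear_combination h2

end HomogeneousCochains

/-! ### Cocycles vanishing on a subgroup of finite index -/

noncomputable section FiniteIndex

variable {M K : Type*} [Group M] [Field K]

/-- The homogeneous cochain of an inhomogeneous one. -/
def homogenize {n : ℕ} (f : (Fin n → M) → K) (g : Fin (n + 1) → M) : K :=
  f fun i => (g i.castSucc)⁻¹ * g i.succ

theorem homogenize_mul_left {n : ℕ} (f : (Fin n → M) → K) (a : M) (g : Fin (n + 1) → M) :
    homogenize f (fun i => a * g i) = homogenize f g := by
  simp only [homogenize, mul_inv_rev, mul_assoc, inv_mul_cancel_left]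

theorem homogenize_partialProd {n : ℕ} (f : (Fin n → M) → K) (x : Fin n → M) :
    homogenize f (Fin.partialProd x) = f x := by
  simp only [homogenize, Fin.partialProd_right_inv]

theorem cochainDifferential_partialProd {n : ℕ} {F : (Fin (n + 1) → M) → K}
    (hF : ∀ a g, F (fun i => a * g i) = F g) (x : Fin (n + 1) → M) :
    cochainDifferential M K n (fun x => F (Fin.partialProd x)) x =
      homogeneousDifferential F (Fin.partialProd x) := by
  rw [homogeneousDifferential, Fin.sum_univ_succ]
  change F (Fin.partialProd fun i => x i.succ) + ∑ j : Fin (n + 1), _ = _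
  congr 1
  · rw [Fin.val_zero, pow_zero, one_mul, ← hF (x 0)]
    congr 1
    funext i
    exact (Fin.partialProd_succ' x i).symm
  · refine Finset.sum_congr rfl fun j _ => ?_
    change _ * F (Fin.partialProd (Fin.contractNth j (· * ·) x)) = _
    rw [Fin.val_succ, Fin.partialProd_contractNth]
    rfl

/-- By invariance the tuple may be translated so that it starts at the identity; it is then a tuple
of partial products, where the two differentials agree. -/
theorem homogeneousDifferential_homogenize {n : ℕ} {f : (Fin n → M) → K}
    (hf : cochainDifferential M K n f = 0) (g : Fin (n + 2) → M) :
    homogeneousDifferential (homogenize f) g = 0 := by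
  have h1 := cochainDifferential_partialProd (homogenize_mul_left f)
    fun i => (g i.castSucc)⁻¹ * g i.succ
  simp only [homogenize_partialProd] at h1
  change cochainDifferential M K n f _ = _ at h1
  rw [hf] at h1
  have h2 : g = fun i => g 0 * Fin.partialProd (fun i => (g i.castSucc)⁻¹ * g i.succ) i := by
    have := Fin.partialProd_left_inv g
    funext i
    exact (congrFun this i).symm
  rw [h2]
  refine Eq.trans ?_ h1.symm
  refine Finset.sum_congr rfl fun i _ => ?_
  congr 1
  exact homogenize_mul_left f _ _

variable (H : Subgroup M)

/-- The retraction of `M` onto the subgroup `H` given by representatives of the cosets. -/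
def cosetRetraction (g : M) : M := g * (QuotientGroup.mk (s := H) g⁻¹).out

theorem cosetRetraction_mem (g : M) : cosetRetraction H g ∈ H := by
  have h1 := QuotientGroup.eq.mp (QuotientGroup.out_eq' (QuotientGroup.mk (s := H) g⁻¹))
  have h2 := H.inv_mem h1
  simpa [cosetRetraction] using h2

/-- The representative is chosen in the coset of `g⁻¹`, which does not change when `g` is multiplied
on the left by an element of `H`. -/
theorem cosetRetraction_mul {a : M} (ha : a ∈ H) (g : M) :
    cosetRetraction H (a * g) = a * cosetRetraction H g := by
  rw [cosetRetraction, cosetRetraction, mul_assoc]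
  congr 3
  rw [QuotientGroup.eq]
  simpa using ha

/-- The cochain whose coboundary is a given cocycle `f` that vanishes on the subgroup `H`. -/
def averagedPrism [Fintype (M ⧸ H)] {n : ℕ} (f : (Fin (n + 1) → M) → K) (x : Fin n → M) : K :=
  (Fintype.card (M ⧸ H) : K)⁻¹ * ∑ c : M ⧸ H,
    prismOperator (cosetRetraction H) (homogenize f) fun i => c.out⁻¹ * Fin.partialProd x i

/-- The retraction sends the homogenised cocycle to its restriction to `H`, which is zero, so the
prism operator gives a primitive. That primitive is only `H`-invariant; averaging it over the cosets
makes it invariant under the whole group, as an inhomogeneous cochain requires. -/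
theorem cochainDifferential_averagedPrism [CharZero K] [Fintype (M ⧸ H)] {n : ℕ}
    {f : (Fin (n + 1) → M) → K} (hf : cochainDifferential M K (n + 1) f = 0)
    (h0 : ∀ x : Fin (n + 1) → M, (∀ i, x i ∈ H) → f x = 0) :
    cochainDifferential M K n (averagedPrism H f) = f := by
  set P := prismOperator (cosetRetraction H) (homogenize f) with hP
  have hPH : ∀ a ∈ H, ∀ g : Fin (n + 1) → M, P (fun i => a * g i) = P g := by
    intro a ha g
    refine Finset.sum_congr rfl fun i _ => ?_
    congr 1
    rw [← homogenize_mul_left f a (prismVertex _ i g)]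
    congr 1
    funext j
    simp only [prismVertex, cosetRetraction_mul H ha]
    split_ifs <;> rfl
  set Q : (Fin (n + 1) → M) → K := fun g =>
    (Fintype.card (M ⧸ H) : K)⁻¹ * ∑ c : M ⧸ H, P fun i => c.out⁻¹ * g i with hQ
  have hQM : ∀ a g, Q (fun i => a * g i) = Q g := by
    intro a g
    simp only [hQ]
    congr 1
    -- Translation by `a` permutes the cosets; the change of representatives lies in `H` and is
    -- absorbed by `hPH`.
    refine Fintype.sum_equiv (MulAction.toPerm a⁻¹) _ _ fun c => ?_
    have h1 : ((MulAction.toPerm a⁻¹ c : M ⧸ H)).out⁻¹ * (a⁻¹ * c.out) ∈ H := by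
      rw [← QuotientGroup.eq, QuotientGroup.out_eq']
      conv_lhs => rw [← QuotientGroup.out_eq' c]
      rfl
    rw [← hPH _ h1]
    congr 1
    funext i
    group
  funext x
  have h2 := cochainDifferential_partialProd hQM x
  refine h2.trans ?_
  have h3 : ∀ g : Fin (n + 2) → M, homogeneousDifferential P g = homogenize f g := by
    intro g
    have h4 := homogeneousDifferential_prismOperator (cosetRetraction H) (homogenize f) g
    have h5 : homogeneousDifferential (homogenize f) = fun _ => 0 :=
      funext (homogeneousDifferential_homogenize hf)
    have h6 : homogenize f (fun i => cosetRetraction H (g i)) = 0 :=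
      h0 _ fun i => H.mul_mem (H.inv_mem (cosetRetraction_mem H _)) (cosetRetraction_mem H _)
    rw [h5, h6, sub_zero] at h4
    rw [← h4]
    simp [prismOperator, hP]
  have h7 : ∀ g : Fin (n + 2) → M, homogeneousDifferential Q g =
      (Fintype.card (M ⧸ H) : K)⁻¹ *
        ∑ c : M ⧸ H, homogeneousDifferential P fun i => c.out⁻¹ * g i := by
    intro g
    simp only [homogeneousDifferential, hQ]
    rw [Finset.sum_comm, Finset.mul_sum]
    refine Finset.sum_congr rfl fun i _ => ?_
    rw [← Finset.mul_sum, mul_left_comm]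
    rfl
  rw [h7]
  simp only [h3, homogenize_mul_left, homogenize_partialProd]
  rw [Finset.sum_const, Finset.card_univ, nsmul_eq_mul, ← mul_assoc, inv_mul_cancel₀, one_mul]
  exact_mod_cast Fintype.card_ne_zero

end FiniteIndex


/-! ### Local analyticity of the averaged prism -/

noncomputable section LocallyAnalyticPoints

variable {p : ℕ} {K : Type*} [NontriviallyNormedField K] [IsUltrametricDist K]
  {m : ℕ} {G : FormalGroupLaw (unitBallRing K) m} {h : ℝ} [Fact p.Prime] [Fact (0 ≤ h)]

/-- The neighbourhoods of a tuple of points. -/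
def nhdsTuple {k : ℕ} (x : Fin k → StandardGroup p G h) : Filter (Fin k → StandardGroup p G h) :=
  (𝓝 (tupleVal x)).comap tupleVal

theorem tendsto_tupleVal {k : ℕ} (x : Fin k → StandardGroup p G h) :
    Tendsto tupleVal (nhdsTuple x) (𝓝 (tupleVal x)) := tendsto_comap

theorem eventually_self_of_nhdsTuple {k : ℕ} {x : Fin k → StandardGroup p G h}
    {P : (Fin k → StandardGroup p G h) → Prop} (hP : ∀ᶠ y in nhdsTuple x, P y) : P x := by
  rw [nhdsTuple, eventually_comap] at hP
  exact hP.self_of_nhds x rfl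

theorem extendByZero_eventuallyEq_iff {k : ℕ} {f : (Fin k → StandardGroup p G h) → K}
    {x : Fin k → StandardGroup p G h} {F : (Fin k → Fin m → K) → K} :
    extendByZero f =ᶠ[𝓝 (tupleVal x)] F ↔ ∀ᶠ y in nhdsTuple x, f y = F (tupleVal y) := by
  rw [nhdsTuple, eventually_comap]
  constructor
  · intro hF
    filter_upwards [hF] with w hw y hy
    rw [← extendByZero_tupleVal f y, hy, hw]
  · intro hF
    filter_upwards [hF, eball_mem_nhds (tupleVal_mem x)] with w hw hw'
    obtain ⟨y, rfl⟩ := exists_tupleVal_eq (G := G) hw'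
    rw [extendByZero_tupleVal, hw y rfl]

theorem mem_laCochains_iff {k : ℕ} {f : (Fin k → StandardGroup p G h) → K} :
    f ∈ laCochains p G h k ↔ ∀ x, ∃ F : (Fin k → Fin m → K) → K,
      AnalyticAt K F (tupleVal x) ∧ ∀ᶠ y in nhdsTuple x, f y = F (tupleVal y) := by
  constructor
  · intro hf x
    exact ⟨_, hf _ fun i => (x i).mem, Eventually.of_forall fun y => (extendByZero_tupleVal f y).symm⟩
  · intro hf w hw
    obtain ⟨F, h1, h2⟩ := hf fun i => ⟨w i, hw i⟩
    exact h1.congr (extendByZero_eventuallyEq_iff.mpr h2).symm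

/-- The coordinates of `a x` are locally given by convergent power series in those of `x`. -/
def IsLocallyAnalyticPoint {k : ℕ} (a : (Fin k → StandardGroup p G h) → StandardGroup p G h) :
    Prop :=
  ∀ x, ∃ A : (Fin k → Fin m → K) → Fin m → K,
    AnalyticAt K A (tupleVal x) ∧ ∀ᶠ y in nhdsTuple x, (a y).val = A (tupleVal y)

theorem isLocallyAnalyticPoint_apply {k : ℕ} (i : Fin k) :
    IsLocallyAnalyticPoint fun x : Fin k → StandardGroup p G h => x i := fun _ =>
  ⟨_, (ContinuousLinearMap.proj (R := K) (φ := fun _ : Fin k => Fin m → K) i).analyticAt _,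
    Eventually.of_forall fun _ => rfl⟩

theorem isLocallyAnalyticPoint_const {k : ℕ} (a : StandardGroup p G h) :
    IsLocallyAnalyticPoint fun _ : Fin k → StandardGroup p G h => a := fun _ =>
  ⟨fun _ => a.val, analyticAt_const, Eventually.of_forall fun _ => rfl⟩

theorem IsLocallyAnalyticPoint.tendsto {k : ℕ}
    {a : (Fin k → StandardGroup p G h) → StandardGroup p G h} (ha : IsLocallyAnalyticPoint a)
    (x : Fin k → StandardGroup p G h) :
    Tendsto (fun y => (a y).val) (nhdsTuple x) (𝓝 (a x).val) := by
  obtain ⟨A, h1, h2⟩ := ha x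
  rw [eventually_self_of_nhdsTuple h2]
  exact (h1.continuousAt.tendsto.comp (tendsto_tupleVal x)).congr' (h2.mono fun y hy => hy.symm)

theorem IsLocallyAnalyticPoint.comp_of_locallyConstant {k : ℕ}
    {a : (Fin k → StandardGroup p G h) → StandardGroup p G h} (ha : IsLocallyAnalyticPoint a)
    {τ : StandardGroup p G h → StandardGroup p G h} {r : ℝ} (hr : 0 < r)
    (hτ : ∀ y z : StandardGroup p G h, ‖y.val - z.val‖ < r → τ y = τ z) :
    IsLocallyAnalyticPoint fun x => τ (a x) := fun x =>
  ⟨fun _ => (τ (a x)).val, analyticAt_const,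
    ((ha.tendsto x).eventually (Metric.ball_mem_nhds _ hr)).mono fun y hy => by
      exact congrArg StandardGroup.val (hτ _ _ (mem_ball_iff_norm.mp hy))⟩

theorem comp_mem_laCochains {k l : ℕ} {f : (Fin l → StandardGroup p G h) → K}
    (hf : f ∈ laCochains p G h l)
    {φ : (Fin k → StandardGroup p G h) → Fin l → StandardGroup p G h}
    (hφ : ∀ i, IsLocallyAnalyticPoint fun x => φ x i) :
    (fun x => f (φ x)) ∈ laCochains p G h k := by
  refine mem_laCochains_iff.mpr fun x => ?_
  obtain ⟨F, h1, h2⟩ := mem_laCochains_iff.mp hf (φ x)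
  choose A h3 h4 using fun i => hφ i x
  have h5 : tupleVal (φ x) = fun i => A i (tupleVal x) := funext fun i =>
    eventually_self_of_nhdsTuple (h4 i)
  have h6 : Tendsto φ (nhdsTuple x) (nhdsTuple (φ x)) :=
    tendsto_comap_iff.mpr (tendsto_pi_nhds.mpr fun i => (hφ i).tendsto x)
  refine ⟨fun w => F fun i => A i w, ?_, ?_⟩
  · refine AnalyticAt.comp (g := F) (f := fun w i => A i w) ?_ (AnalyticAt.pi h3)
    rwa [← h5]
  · filter_upwards [h6.eventually h2, eventually_all.mpr h4] with y h7 h8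
    rw [h7]
    congr 1
    exact funext h8

theorem rigidCochains_le_laCochains [CompleteSpace K] (k : ℕ) :
    rigidCochains p G h k ≤ laCochains p G h k := fun _ hf w hw =>
  (isRigid_of_mem hf).analyticOnNhd w ((mem_eball_pi_iff levelRadius_pos).mpr fun i =>
    mem_levelDisc_iff.mp (hw i))

variable [CompleteSpace K]

theorem IsLocallyAnalyticPoint.mul {k : ℕ}
    {a b : (Fin k → StandardGroup p G h) → StandardGroup p G h}
    (ha : IsLocallyAnalyticPoint a) (hb : IsLocallyAnalyticPoint b) :
    IsLocallyAnalyticPoint fun x => a x * b x := fun x => by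
  obtain ⟨A, h1, h2⟩ := ha x
  obtain ⟨B, h3, h4⟩ := hb x
  refine ⟨fun w => G.mulMap (A w, B w), ?_, ?_⟩
  · refine AnalyticAt.comp (g := G.mulMap) (f := fun w => (A w, B w)) ?_ (h1.prod h3)
    rw [← eventually_self_of_nhdsTuple h2, ← eventually_self_of_nhdsTuple h4]
    refine (G.isContractive_mulMap (R := 1) one_pos le_rfl).isRigid.analyticOnNhd _ ?_
    rw [mem_eball_zero_iff, ← ofReal_norm]
    exact ENNReal.ofReal_lt_one.mpr (max_lt (a x).norm_val_lt_one (b x).norm_val_lt_one)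
  · filter_upwards [h2, h4] with y h5 h6
    rw [StandardGroup.mul_val, h5, h6]

theorem isLocallyAnalyticPoint_partialProd {n : ℕ} (i : Fin (n + 1)) :
    IsLocallyAnalyticPoint fun x : Fin n → StandardGroup p G h => Fin.partialProd x i := by
  induction i using Fin.induction with
  | zero =>
    simp only [Fin.partialProd_zero]
    exact isLocallyAnalyticPoint_const 1
  | succ i ih =>
    simp only [Fin.partialProd_succ]
    exact ih.mul (isLocallyAnalyticPoint_apply i)

/-- The quotient of partial products is one of the entries of `x`, or `1`, so analyticity of
inversion is not needed. -/
theorem isLocallyAnalyticPoint_predAbove {n : ℕ} (i j : Fin (n + 1)) :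
    IsLocallyAnalyticPoint fun x : Fin n → StandardGroup p G h =>
      (Fin.partialProd x (i.predAbove j.castSucc))⁻¹ * Fin.partialProd x (i.predAbove j.succ) := by
  rcases lt_trichotomy i j with hij | rfl | hij
  · obtain ⟨j, rfl⟩ := Fin.exists_succ_eq.mpr (Fin.ne_zero_of_lt hij)
    have h1 : i.predAbove j.succ.castSucc = j.castSucc := by
      rw [Fin.predAbove_of_castSucc_lt _ _ (Fin.lt_def.mpr (Fin.lt_def.mp hij))]
      ext
      simp
    have h2 : i.predAbove j.succ.succ = j.succ := by
      rw [Fin.predAbove_of_castSucc_lt _ _ (by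
        have : (i : ℕ) < j + 1 := hij
        rw [Fin.lt_def, Fin.val_castSucc, Fin.val_succ, Fin.val_succ]
        omega)]
      ext
      simp
    simp only [h1, h2, Fin.partialProd_right_inv]
    exact isLocallyAnalyticPoint_apply j
  · simp only [Fin.predAbove_castSucc_self, Fin.predAbove_succ_self, inv_mul_cancel]
    exact isLocallyAnalyticPoint_const 1
  · obtain ⟨j, rfl⟩ : ∃ j' : Fin n, j = j'.castSucc :=
      ⟨⟨j, by omega⟩, rfl⟩
    have h1 : i.predAbove j.castSucc.castSucc = j.castSucc := by
      rw [Fin.predAbove_of_le_castSucc _ _ (Fin.le_def.mpr (Fin.lt_def.mp hij).le)]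
      ext
      simp
    have h2 : i.predAbove j.castSucc.succ = j.succ := by
      rw [Fin.predAbove_of_le_castSucc _ _ (by
        have : (j : ℕ) < i := hij
        rw [Fin.le_def, Fin.val_castSucc, Fin.val_succ, Fin.val_castSucc]
        omega)]
      ext
      simp
    simp only [h1, h2, Fin.partialProd_right_inv]
    exact isLocallyAnalyticPoint_apply j

theorem StandardGroup.norm_mul_val_le (x y : StandardGroup p G h) :
    ‖(x * y).val‖ ≤ max ‖x.val‖ ‖y.val‖ :=
  G.norm_mulMap_le (z := (x.val, y.val)) (max_lt x.norm_val_lt_one y.norm_val_lt_one)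

variable (p G h) in
/-- The subgroup of the points of norm less than `r`. -/
def congruenceSubgroup {r : ℝ} (hr : 0 < r) : Subgroup (StandardGroup p G h) where
  carrier := {x | ‖x.val‖ < r}
  one_mem' := by
    rw [Set.mem_ofPred_eq, StandardGroup.one_val, norm_zero]
    exact hr
  mul_mem' {x y} hx hy := (StandardGroup.norm_mul_val_le x y).trans_lt (max_lt hx hy)
  inv_mem' {x} hx := x.norm_inv_val_le.trans_lt hx

theorem mem_congruenceSubgroup {r : ℝ} (hr : 0 < r) {x : StandardGroup p G h} :
    x ∈ congruenceSubgroup p G h hr ↔ ‖x.val‖ < r := Iff.rfl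

theorem StandardGroup.norm_mul_left_sub (x y z : StandardGroup p G h) :
    ‖(x * y).val - (x * z).val‖ = ‖y.val - z.val‖ :=
  G.norm_mulMap_left_sub x.norm_val_lt_one y.norm_val_lt_one z.norm_val_lt_one

theorem StandardGroup.norm_mul_inv_val (x y : StandardGroup p G h) :
    ‖(x * y⁻¹).val‖ = ‖x.val - y.val‖ := by
  have h1 := G.norm_mulMap_right_sub (x * y⁻¹).norm_val_lt_one
    (1 : StandardGroup p G h).norm_val_lt_one y.norm_val_lt_one
  rw [← mul_val, ← mul_val, inv_mul_cancel_right, one_mul, one_val, sub_zero] at h1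
  exact h1.symm

/-- Finitely many `r`-balls cover the closed unit ball; two representatives in the same ball lie in
one coset, since `x⁻¹ y` has norm `‖y - x‖`. -/
instance finite_quotient_congruenceSubgroup [ProperSpace K] {r : ℝ} (hr : 0 < r) :
    Finite (StandardGroup p G h ⧸ congruenceSubgroup p G h hr) := by
  obtain ⟨t, ht, h1⟩ := Metric.totallyBounded_iff.mp
    (isCompact_closedBall (0 : Fin m → K) 1).totallyBounded r hr
  have h2 : ∀ c : StandardGroup p G h ⧸ congruenceSubgroup p G h hr,
      ∃ y : t, c.out.val ∈ Metric.ball (y : Fin m → K) r := fun c => by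
    have h3 : c.out.val ∈ Metric.closedBall (0 : Fin m → K) 1 := by
      rw [mem_closedBall_zero_iff]
      exact c.out.norm_val_lt_one.le
    obtain ⟨y, hy, h4⟩ := Set.mem_iUnion₂.mp (h1 h3)
    exact ⟨⟨y, hy⟩, h4⟩
  choose Y hY using h2
  have := ht.to_subtype
  refine Finite.of_injective Y fun c c' hc => ?_
  have h4 := hY c'
  rw [← hc] at h4
  have h5 : ‖c'.out.val - c.out.val‖ < r := by
    rw [← dist_eq_norm]
    exact (dist_triangle_max _ (Y c : Fin m → K) _).trans_lt
      (max_lt (Metric.mem_ball.mp h4) (Metric.mem_ball'.mp (hY c)))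
  rw [← QuotientGroup.out_eq' c, ← QuotientGroup.out_eq' c', QuotientGroup.eq,
    mem_congruenceSubgroup, StandardGroup.norm_inv_mul_val]
  exact h5

theorem averagedPrism_mem_laCochains {H : Subgroup (StandardGroup p G h)} {r : ℝ} (hr : 0 < r)
    (hH : ∀ x : StandardGroup p G h, ‖x.val‖ < r → x ∈ H) [Fintype (StandardGroup p G h ⧸ H)]
    {n : ℕ} {f : (Fin (n + 1) → StandardGroup p G h) → K} (hf : f ∈ laCochains p G h (n + 1)) :
    averagedPrism H f ∈ laCochains p G h n := by
  have h1 : averagedPrism H f = (Fintype.card (StandardGroup p G h ⧸ H) : K)⁻¹ •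
      ∑ c : StandardGroup p G h ⧸ H, ∑ i : Fin (n + 1), (-1 : K) ^ (i : ℕ) • fun x =>
        homogenize f (prismVertex (cosetRetraction H) i fun j => c.out⁻¹ * Fin.partialProd x j) := by
    funext x
    simp only [averagedPrism, prismOperator, Pi.smul_apply, Finset.sum_apply, smul_eq_mul]
  rw [h1]
  refine Submodule.smul_mem _ _ (Submodule.sum_mem _ fun c _ => Submodule.sum_mem _ fun i _ =>
    Submodule.smul_mem _ _ (comp_mem_laCochains hf fun j => ?_))
  -- A vertex of the prism is a translated partial product times a chosen coset representative (or
  -- `1`). This factor is locally constant because `H` contains a ball, and translations and `x y⁻¹`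
  -- respect distances.
  let τ : Fin (n + 2) → StandardGroup p G h → StandardGroup p G h := fun l y =>
    if l ≤ i.castSucc then (QuotientGroup.mk (s := H) (c.out⁻¹ * y)⁻¹).out else 1
  have hτ : ∀ l (y z : StandardGroup p G h), ‖y.val - z.val‖ < r → τ l y = τ l z := by
    intro l y z hyz
    have h2 : QuotientGroup.mk (s := H) (c.out⁻¹ * y)⁻¹ = QuotientGroup.mk (c.out⁻¹ * z)⁻¹ := by
      rw [QuotientGroup.eq, inv_inv]
      refine hH _ ?_
      rwa [StandardGroup.norm_mul_inv_val, StandardGroup.norm_mul_left_sub]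
    simp only [τ, h2]
  have h3 : ∀ (l : Fin (n + 2)) (x : Fin n → StandardGroup p G h),
      prismVertex (cosetRetraction H) i (fun j => c.out⁻¹ * Fin.partialProd x j) l =
        c.out⁻¹ * Fin.partialProd x (i.predAbove l) * τ l (Fin.partialProd x (i.predAbove l)) := by
    intro l x
    simp only [prismVertex, τ, cosetRetraction]
    split_ifs
    · rfl
    · rw [mul_one]
  have h4 : ∀ x : Fin n → StandardGroup p G h,
      (prismVertex (cosetRetraction H) i (fun j => c.out⁻¹ * Fin.partialProd x j) j.castSucc)⁻¹ *
        prismVertex (cosetRetraction H) i (fun j => c.out⁻¹ * Fin.partialProd x j) j.succ =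
      (τ j.castSucc (Fin.partialProd x (i.predAbove j.castSucc)))⁻¹ *
        ((Fin.partialProd x (i.predAbove j.castSucc))⁻¹ * Fin.partialProd x (i.predAbove j.succ)) *
          τ j.succ (Fin.partialProd x (i.predAbove j.succ)) := by
    intro x
    rw [h3, h3]
    group
  simp only [h4]
  exact (((isLocallyAnalyticPoint_partialProd _).comp_of_locallyConstant
    (τ := fun y => (τ j.castSucc y)⁻¹) hr fun y z hyz => by rw [hτ _ y z hyz]).mul
      (isLocallyAnalyticPoint_predAbove i j)).mul
        ((isLocallyAnalyticPoint_partialProd _).comp_of_locallyConstant hr (hτ j.succ))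

end LocallyAnalyticPoints


/-! ### Change of level -/

noncomputable section Restriction

variable {p : ℕ} {K : Type*} [NontriviallyNormedField K] [IsUltrametricDist K]
  {m : ℕ} {G : FormalGroupLaw (unitBallRing K) m} {h h' : ℝ}

theorem differentiateCochain_congr {n : ℕ} {f : (Fin n → StandardGroup p G h) → K}
    {g : (Fin n → StandardGroup p G h') → K} (hfg : extendByZero f =ᶠ[𝓝 0] extendByZero g) :
    differentiateCochain f = differentiateCochain g := by
  rw [differentiateCochain, differentiateCochain, (hfg.iteratedFDeriv K n).eq_of_nhds]

variable [Fact p.Prime] [Fact (0 ≤ h)] [Fact (0 ≤ h')]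

theorem levelRadius_le_levelRadius (hle : h ≤ h') : levelRadius p h' ≤ levelRadius p h :=
  ENNReal.ofReal_le_ofReal (Real.rpow_le_rpow_of_exponent_le
    (by exact_mod_cast (Fact.out : p.Prime).one_le) (neg_le_neg hle))

theorem levelDisc_subset (hle : h ≤ h') : levelDisc p K m h' ⊆ levelDisc p K m h := fun _ hx =>
  mem_levelDisc_iff.mpr (Metric.eball_subset_eball (levelRadius_le_levelRadius hle)
    (mem_levelDisc_iff.mp hx))

/-- The inclusion of the standard group of a higher level. -/
def StandardGroup.inclusion (hle : h ≤ h') (x : StandardGroup p G h') : StandardGroup p G h :=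
  ⟨x.val, levelDisc_subset hle x.mem⟩

/-- Restriction of cochains to the standard group of a higher level. -/
def restrictCochain (hle : h ≤ h') {n : ℕ} (f : (Fin n → StandardGroup p G h) → K)
    (x : Fin n → StandardGroup p G h') : K :=
  f fun i => (x i).inclusion hle

theorem cochainDifferential_restrictCochain (hle : h ≤ h') {n : ℕ}
    (f : (Fin n → StandardGroup p G h) → K) :
    cochainDifferential (StandardGroup p G h') K n (restrictCochain hle f) =
      restrictCochain hle (cochainDifferential (StandardGroup p G h) K n f) := by
  funext x
  have h1 : ∀ j : Fin (n + 1), (fun i => (Fin.contractNth j (· * ·) x i).inclusion hle) =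
      Fin.contractNth j (· * ·) fun i => (x i).inclusion hle := fun j => by
    funext i
    simp only [Fin.contractNth]
    split_ifs <;> rfl
  simp only [cochainDifferential, LinearMap.coe_mk, AddHom.coe_mk, restrictCochain, h1]

theorem extendByZero_restrictCochain_eqOn (hle : h ≤ h') {n : ℕ}
    (f : (Fin n → StandardGroup p G h) → K) :
    Set.EqOn (extendByZero (restrictCochain hle f)) (extendByZero f)
      (Metric.eball 0 (levelRadius p h')) :=
  extendByZero_eqOn fun x =>
    (extendByZero_tupleVal f fun i => (x i).inclusion hle).symm

theorem differentiateCochain_restrictCochain (hle : h ≤ h') {n : ℕ}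
    (f : (Fin n → StandardGroup p G h) → K) :
    differentiateCochain (restrictCochain hle f) = differentiateCochain f :=
  differentiateCochain_congr ((extendByZero_restrictCochain_eqOn hle f).eventuallyEq_of_mem
    (eball_mem_nhds (zero_mem_eball (p := p) (h := h'))))

theorem exists_levelRadius_le {R : ℝ≥0∞} (hR : 0 < R) : ∃ h', h ≤ h' ∧ levelRadius p h' ≤ R := by
  have h1 : Tendsto (fun s : ℝ => levelRadius p s) atTop (𝓝 0) := by
    rw [← ENNReal.ofReal_zero]
    exact (ENNReal.continuous_ofReal.tendsto 0).comp
      ((tendsto_rpow_atBot_of_base_gt_one (p : ℝ)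
        (by exact_mod_cast (Fact.out : p.Prime).one_lt)).comp tendsto_neg_atTop_atBot)
  obtain ⟨s, hs, hs'⟩ := ((h1.eventually (gt_mem_nhds hR)).and (eventually_ge_atTop h)).exists
  exact ⟨s, hs', hs.le⟩

theorem analyticAt_extendByZero {n : ℕ} {f : (Fin n → StandardGroup p G h) → K}
    (hf : f ∈ laCochains p G h n) : AnalyticAt K (extendByZero f) 0 :=
  hf 0 fun _ => mem_levelDisc_iff.mpr zero_mem_eball

/-- Locally analytic cochains are rigid near the identity. -/
theorem exists_restrictCochain_mem_rigidCochains {n : ℕ}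
    {f : (Fin n → StandardGroup p G h) → K} (hf : f ∈ laCochains p G h n) :
    ∃ (h' : ℝ) (hle : h ≤ h') (_ : Fact (0 ≤ h')),
      restrictCochain hle f ∈ rigidCochains p G h' n := by
  obtain ⟨q, R, hq⟩ := analyticAt_extendByZero hf
  obtain ⟨h', hle, hR⟩ := exists_levelRadius_le (p := p) (h := h) hq.r_pos
  have : Fact (0 ≤ h') := ⟨(Fact.out : 0 ≤ h).trans hle⟩
  refine ⟨h', hle, this, mem_rigidCochains_of_isRigid
    (F := extendByZero f) ⟨q, hq.mono levelRadius_pos hR⟩ fun x => ?_⟩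
  exact (extendByZero_tupleVal f fun i => (x i).inclusion hle).symm

variable [CompleteSpace K]

theorem differentiateCochain_add {n : ℕ} {f g : (Fin n → StandardGroup p G h) → K}
    (hf : f ∈ laCochains p G h n) (hg : g ∈ laCochains p G h n) :
    differentiateCochain (f + g) = differentiateCochain f + differentiateCochain g := by
  have h1 := iteratedFDeriv_add_apply (𝕜 := K) (i := n) (analyticAt_extendByZero hf).contDiffAt
    (analyticAt_extendByZero hg).contDiffAt
  simp only [differentiateCochain]
  rw [extendByZero_add, h1, ← map_add]
  rfl

theorem differentiateCochain_smul {n : ℕ} (c : K) {f : (Fin n → StandardGroup p G h) → K}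
    (hf : f ∈ laCochains p G h n) :
    differentiateCochain (c • f) = c • differentiateCochain f := by
  have h1 := iteratedFDeriv_const_smul_apply (𝕜 := K) (i := n) (a := c)
    (analyticAt_extendByZero hf).contDiffAt
  simp only [differentiateCochain]
  rw [extendByZero_smul, h1]
  ext v
  simp only [MultilinearMap.alternatization_apply, AlternatingMap.smul_apply, Finset.smul_sum]
  refine Finset.sum_congr rfl fun σ _ => ?_
  rw [smul_comm]
  rfl

theorem differentiateCochain_zero_apply (f : (Fin 0 → StandardGroup p G h) → K)
    (v : Fin 0 → Fin m → K) : differentiateCochain f v = f Fin.elim0 := by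
  rw [differentiateCochain, MultilinearMap.alternatization_apply,
    Fintype.sum_subsingleton _ 1, Equiv.Perm.sign_one, one_smul]
  change extendByZero f 0 = f Fin.elim0
  rw [extendByZero, dif_pos fun i => i.elim0]
  congr 1
  exact Subsingleton.elim _ _

/-- Extension of cochains by zero to the standard group of a lower level. -/
def extendCochain (h : ℝ) {n : ℕ} (g : (Fin n → StandardGroup p G h') → K)
    (x : Fin n → StandardGroup p G h) : K :=
  extendByZero g (tupleVal x)

theorem restrictCochain_extendCochain (hle : h ≤ h') {n : ℕ}
    (g : (Fin n → StandardGroup p G h') → K) :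
    restrictCochain hle (extendCochain h g) = g := by
  funext x
  exact extendByZero_tupleVal g x

/-- The smaller polydisc is closed as well as open, so the extension vanishes identically near every
point outside it. -/
theorem extendCochain_mem_laCochains {n : ℕ} {g : (Fin n → StandardGroup p G h') → K}
    (hg : g ∈ laCochains p G h' n) : extendCochain h g ∈ laCochains p G h n := by
  refine mem_laCochains_iff.mpr fun x => ⟨extendByZero g, ?_, Eventually.of_forall fun _ => rfl⟩
  by_cases hx : tupleVal x ∈ Metric.eball 0 (levelRadius p h')
  · exact hg _ fun i => mem_levelDisc_iff.mpr ((mem_eball_pi_iff levelRadius_pos).mp hx i)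
  · have hc : IsClosed (Metric.eball (0 : Fin n → Fin m → K) (levelRadius p h')) := by
      rw [levelRadius, Metric.eball_ofReal]
      exact IsUltrametricDist.isClosed_ball _ _
    refine (analyticAt_const (v := (0 : K))).congr ?_
    filter_upwards [hc.isOpen_compl.mem_nhds hx] with w hw
    rw [extendByZero, dif_neg]
    refine fun hw' => hw ?_
    exact (mem_eball_pi_iff levelRadius_pos).mpr fun i => mem_levelDisc_iff.mp (hw' i)

end Restriction

theorem CocyclesModCoboundaries.exists_equiv {A M N : Type*} [Ring A] [AddCommGroup M] [Module A M]
    [AddCommGroup N] [Module A N] {Z B : Submodule A M} {Z' B' : Submodule A N} (L : Z →ₗ[A] Z')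
    (hB : ∀ f, f.1 ∈ B ↔ (L f).1 ∈ B') (hsurj : ∀ ω : Z', ∃ f, (L f).1 - ω.1 ∈ B') :
    ∃ e : CocyclesModCoboundaries Z B ≃ₗ[A] CocyclesModCoboundaries Z' B',
      ∀ f, e (Submodule.Quotient.mk f) = Submodule.Quotient.mk (L f) := by
  let T : Z →ₗ[A] CocyclesModCoboundaries Z' B' := (B'.submoduleOf Z').mkQ ∘ₗ L
  have hT : Function.Surjective T := fun y => by
    obtain ⟨ω, rfl⟩ := Submodule.Quotient.mk_surjective _ y
    obtain ⟨f, hf⟩ := hsurj ω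
    exact ⟨f, (Submodule.Quotient.eq _).mpr hf⟩
  have hker : B.submoduleOf Z = LinearMap.ker T := by
    ext f
    exact (hB f).trans (Submodule.Quotient.mk_eq_zero (B'.submoduleOf Z') (x := L f)).symm
  exact ⟨(Submodule.quotEquivOfEq _ _ hker).trans (T.quotKerEquivOfSurjective hT), fun _ => rfl⟩

/-! ### The comparison for locally analytic cochains -/

noncomputable section Comparison

variable {p : ℕ} {K : Type*} [NontriviallyNormedField K] [IsUltrametricDist K]
  {m : ℕ} {G : FormalGroupLaw (unitBallRing K) m} {h : ℝ} [Fact p.Prime] [Fact (0 ≤ h)]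
  [CompleteSpace K]

theorem cochainDifferential_mem_laCochains {n : ℕ} {f : (Fin n → StandardGroup p G h) → K}
    (hf : f ∈ laCochains p G h n) :
    cochainDifferential (StandardGroup p G h) K n f ∈ laCochains p G h (n + 1) := by
  have h1 : cochainDifferential (StandardGroup p G h) K n f =
      (fun x => f fun i => x i.succ) + ∑ j : Fin (n + 1), (-1 : K) ^ ((j : ℕ) + 1) •
        fun x => f (Fin.contractNth j (· * ·) x) := by
    funext x
    rw [Pi.add_apply, Finset.sum_apply]
    rfl
  rw [h1]
  refine Submodule.add_mem _ (comp_mem_laCochains hf fun i => isLocallyAnalyticPoint_apply i.succ)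
    (Submodule.sum_mem _ fun j _ => Submodule.smul_mem _ _ (comp_mem_laCochains hf fun i => ?_))
  simp only [Fin.contractNth]
  split_ifs
  · exact isLocallyAnalyticPoint_apply _
  · exact (isLocallyAnalyticPoint_apply _).mul (isLocallyAnalyticPoint_apply _)
  · exact isLocallyAnalyticPoint_apply _

/-- Differentiation sees only the germ at the identity, so the level may be raised until the cocycle
is rigid. -/
theorem differentiateCochain_mem_lieCocycles {n : ℕ} {f : (Fin n → StandardGroup p G h) → K}
    (hf : f ∈ laCocycles p G h n) : differentiateCochain f ∈ lieCocycles G K n := by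
  obtain ⟨h', hle, _, h1⟩ := exists_restrictCochain_mem_rigidCochains hf.1
  rw [← differentiateCochain_restrictCochain hle]
  refine differentiateCochain_mem_lieCocycles_of_rigid (f := RigidCochain.mk _ h1) ?_
  rw [RigidCochain.val_mk, cochainDifferential_restrictCochain, LinearMap.mem_ker.mp hf.2]
  rfl

theorem differentiateCochain_mem_lieCoboundaries {n : ℕ}
    {f : (Fin n → StandardGroup p G h) → K} (hf : f ∈ laCoboundaries p G h n) :
    differentiateCochain f ∈ lieCoboundaries G K n := by
  cases n with
  | zero =>
    have h1 : f = 0 := hf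
    change differentiateCochain f = 0
    ext v
    rw [differentiateCochain_zero_apply, h1]
    rfl
  | succ n =>
    obtain ⟨g, hg, rfl⟩ := hf
    obtain ⟨h', hle, _, h1⟩ := exists_restrictCochain_mem_rigidCochains hg
    rw [← differentiateCochain_restrictCochain hle, ← cochainDifferential_restrictCochain]
    exact differentiateCochain_coboundary_mem_of_rigid (RigidCochain.mk _ h1)

theorem mem_laCoboundaries_of_differentiateCochain_mem [CharZero K] [ProperSpace K]
    (hnat : ∀ n : ℕ, n ≠ 0 → (n : K) ≠ 0 ∧ ‖(n : K)⁻¹‖ ≤ n) {n : ℕ}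
    {f : (Fin n → StandardGroup p G h) → K} (hf : f ∈ laCocycles p G h n)
    (hΦ : differentiateCochain f ∈ lieCoboundaries G K n) : f ∈ laCoboundaries p G h n := by
  cases n with
  | zero =>
    have h1 : differentiateCochain f = 0 := hΦ
    change f = 0
    funext x
    rw [Subsingleton.elim x Fin.elim0, ← differentiateCochain_zero_apply f Fin.elim0, h1]
    rfl
  | succ n =>
    obtain ⟨h', hle, _, h1⟩ := exists_restrictCochain_mem_rigidCochains hf.1
    obtain ⟨g, hg⟩ := exists_rigid_cochainDifferential_eq hnat (f := RigidCochain.mk _ h1)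
      (by
        rw [RigidCochain.val_mk, cochainDifferential_restrictCochain, LinearMap.mem_ker.mp hf.2]
        rfl)
      (by rwa [RigidCochain.val_mk, differentiateCochain_restrictCochain])
    rw [RigidCochain.val_mk] at hg
    have hgla : extendCochain h g.val ∈ laCochains p G h n :=
      extendCochain_mem_laCochains (rigidCochains_le_laCochains n g.mem)
    -- On `𝒢(h')` the cocycle is the coboundary of `g`; after this correction it vanishes on that
    -- subgroup, which has finite index, and the averaged prism supplies the remaining primitive.
    set f' := f - cochainDifferential (StandardGroup p G h) K n (extendCochain h g.val) with hf'
    have hf'la : f' ∈ laCochains p G h (n + 1) :=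
      Submodule.sub_mem _ hf.1 (cochainDifferential_mem_laCochains hgla)
    have hf'd : cochainDifferential (StandardGroup p G h) K (n + 1) f' = 0 := by
      rw [hf', map_sub, LinearMap.mem_ker.mp hf.2]
      rw [cochainDifferential_cochainDifferential, sub_zero]
    have hr : (0 : ℝ) < (p : ℝ) ^ (-h') :=
      Real.rpow_pos_of_pos (by exact_mod_cast (Fact.out : p.Prime).pos) _
    have hf'0 : ∀ x : Fin (n + 1) → StandardGroup p G h,
        (∀ i, x i ∈ congruenceSubgroup p G h hr) → f' x = 0 := by
      intro x hx
      have h2 : restrictCochain hle f' = 0 := by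
        have h3 := cochainDifferential_restrictCochain hle (extendCochain h g.val)
        rw [restrictCochain_extendCochain, hg] at h3
        funext y
        have h4 := congrFun h3 y
        exact sub_eq_zero.mpr h4
      exact congrFun h2 fun i => ⟨(x i).val, ⟨(x i).mem.1, hx i⟩⟩
    have := Fintype.ofFinite (StandardGroup p G h ⧸ congruenceSubgroup p G h hr)
    refine ⟨averagedPrism (congruenceSubgroup p G h hr) f' + extendCochain h g.val,
      Submodule.add_mem _ (averagedPrism_mem_laCochains hr (fun _ hx => hx) hf'la) hgla, ?_⟩
    rw [map_add]
    have h5 := cochainDifferential_averagedPrism (congruenceSubgroup p G h hr) hf'd hf'0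
    exact (congrArg₂ (· + ·) h5 rfl).trans (sub_add_cancel _ _)

variable (p G h) in
/-- Differentiation of locally analytic cocycles. -/
def differentiateCocycle (n : ℕ) : laCocycles p G h n →ₗ[K] lieCocycles G K n where
  toFun f := ⟨differentiateCochain f.1, differentiateCochain_mem_lieCocycles f.2⟩
  map_add' f g := Subtype.ext (differentiateCochain_add f.2.1 g.2.1)
  map_smul' c f := Subtype.ext (differentiateCochain_smul c f.2.1)

theorem exists_equiv_of_proper [CharZero K] [ProperSpace K]
    (hnat : ∀ n : ℕ, n ≠ 0 → (n : K) ≠ 0 ∧ ‖(n : K)⁻¹‖ ≤ n) (n : ℕ) :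
    ∃ e : LACohomology p G h n ≃ₗ[K] LieCohomology G K n,
      ∀ f : laCocycles p G h n, e (Submodule.Quotient.mk f) =
        Submodule.Quotient.mk (differentiateCocycle p G h n f) := by
  refine CocyclesModCoboundaries.exists_equiv (differentiateCocycle p G h n)
    (fun f => ⟨fun hf => differentiateCochain_mem_lieCoboundaries hf,
      fun hf => mem_laCoboundaries_of_differentiateCochain_mem hnat f.2 hf⟩) fun ω => ?_
  obtain ⟨f, h1, h2⟩ := exists_rigid_differentiateCochain_sub_mem (p := p) (h := h) hnat ω.2
  exact ⟨⟨f.val, rigidCochains_le_laCochains n f.mem, LinearMap.mem_ker.mpr h1⟩, h2⟩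

end Comparison

/-- The norm of `1/n` is the largest power of `p` dividing `n`. -/
theorem norm_inv_natCast_le_of_padic (p : ℕ) [Fact p.Prime] (K : Type*) [NormedField K]
    [NormedAlgebra ℚ_[p] K] {n : ℕ} (hn : n ≠ 0) : ‖(n : K)⁻¹‖ ≤ n := by
  have h1 : ‖(n : K)‖ = ‖(n : ℚ_[p])‖ := by
    rw [← map_natCast (algebraMap ℚ_[p] K), norm_algebraMap']
  have h2 : ‖(n : ℚ_[p])‖ = ((p : ℝ) ^ padicValNat p n)⁻¹ := by
    have h3 := Padic.eq_padicNorm (p := p) (n : ℚ)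
    rw [padicNorm.eq_zpow_of_nonzero (by exact_mod_cast hn), padicValRat.of_nat] at h3
    rw [Rat.cast_natCast, Rat.cast_zpow, Rat.cast_natCast] at h3
    rw [h3, zpow_neg, zpow_natCast]
  rw [norm_inv, h1, h2, inv_inv]
  exact_mod_cast Nat.le_of_dvd (Nat.pos_of_ne_zero hn) pow_padicValNat_dvd

/-- Comparison theorem for standard groups: for `h > 1/(p-1)`, differentiating cochains sends
locally analytic cocycles to Lie algebra cocycles and induces an isomorphism on cohomology. -/
theorem theorem5 (p : ℕ) [Fact p.Prime] (K : Type*) [NontriviallyNormedField K]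
    [NormedAlgebra ℚ_[p] K] [FiniteDimensional ℚ_[p] K] [IsUltrametricDist K]
    (m : ℕ) (G : FormalGroupLaw (unitBallRing K) m)
    (h : ℝ) (hh : 1 / ((p : ℝ) - 1) < h) (n : ℕ) :
    ∃ e : LACohomology p G h n ≃ₗ[K] LieCohomology G K n,
      ∀ f : laCocycles p G h n,
        ∃ hf : differentiateCochain f.1 ∈ lieCocycles G K n,
          e (Submodule.Quotient.mk f) =
            Submodule.Quotient.mk ⟨differentiateCochain f.1, hf⟩ := by
  have hp : (1 : ℝ) ≤ p := by exact_mod_cast (Fact.out : p.Prime).one_le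
  have : Fact (0 ≤ h) := ⟨(div_nonneg zero_le_one (sub_nonneg.mpr hp)).trans hh.le⟩
  have : CompleteSpace K := FiniteDimensional.complete ℚ_[p] K
  -- Local compactness of `K` makes the congruence subgroups of finite index.
  have : ProperSpace K := FiniteDimensional.proper ℚ_[p] K
  have : CharZero K := charZero_of_injective_algebraMap (algebraMap ℚ_[p] K).injective
  obtain ⟨e, he⟩ := exists_equiv_of_proper (p := p) (G := G) (h := h)
    (fun n hn => ⟨Nat.cast_ne_zero.mpr hn, norm_inv_natCast_le_of_padic p K hn⟩) n
  exact ⟨e, fun f => ⟨differentiateCochain_mem_lieCocycles f.2, he f⟩⟩
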